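/- **Setting.** Let $d\ge 0$ be an integer and let $S$ be a finite or countable set with the discrete topology; $S^{\mathbb Z^d}$ carries the product topology and its Borel $\sigma$-algebra. For $x\in\mathbb Z^d$ and $r\in\mathbb N_0$ let $B(x,r)$ be the closed $L^1$-ball, and let $\sigma_{x,s}$ be the configuration $\sigma$ with the spin at $x$ replaced by $s$. Let $c_x(s,\sigma)$ ($x\in\mathbb Z^d$, $s\in S$, $\sigma\in S^{\mathbb Z^d}$) be jump intensities with a Kalikow-type decomposition $$c_x(s,\sigma)=M_x\sum_{r\ge 0}\nu_x(r)\,p_x^{[r]}(s\mid\sigma),$$ where $M_x>0$, $\nu_x$ is a probability function on $\mathbb N_0$, and $p_x^{[r]}(\cdot\mid\sigma)$ is a probability function on $S$ that depends on $\sigma$ only through $\{\sigma(y):y\in B(x,r)\}$. Assume $$0<\inf_x M_x\le\sup_x M_x<\infty\qquad\text{and}\qquad\sum_{r\ge 1}r^d\sup_x\nu_x(r)<\infty .$$ For bounded cylinder functions $f$ on $S^{\mathbb Z^d}$ put $$Lf(\sigma)=\sum_{x\in\mathbb Z^d}\sum_{s\in S}c_x(s,\sigma)\,[f(\sigma_{x,s})-f(\sigma)]=\sum_{x}\sum_{s}\sum_{r\ge0}M_x\nu_x(r)p_x^{[r]}(s\mid\sigma)\,[f(\sigma_{x,s})-f(\sigma)].$$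 An *interacting particle system with generator $L$ started from $\eta$* is a càdlàg Markov process on $S^{\mathbb Z^d}$ with $\sigma_0=\eta$ a.s. that has a semigroup $(\kappa_t)_{t\ge0}$ of Markov transition kernels with $(\kappa_tf-f)/t\to Lf$ uniformly as $t\downarrow0$, for every bounded cylinder function $f$. *Harris system.* Let $(T_{x,n})_n$, $x\in\mathbb Z^d$, be the epochs of independent Poisson processes on $[0,\infty)$ with rates $M_x$, with independent marks $K_{x,n}$ of law $\nu_x$ and $U_{x,n}$ uniform on $[0,1]$, on the canonical probability space of these variables. An *update rule* is a family of functions $W_{x,r}(\sigma,u)\in S$, measurable in $u\in[0,1]$ and depending on $\sigma$ only through its restriction to $B(x,r)$, such that $W_{x,r}(\sigma,U)$ has law $p_x^{[r]}(\cdot\mid\sigma)$ for $U$ uniform on $[0,1]$. A *path driven by the Harris system from $\eta$* is a càdlàg path $(\pi_t)_{t\ge0}$ in $S^{\mathbb Z^d}$ with $\pi_0=\eta$ whose spin at $x$ changes only at epochs $T_{x,n}$ and satisfies $\pi_t(x)=W_{x,K_{x,n}}(\pi_{t-},U_{x,n})$ at $t=T_{x,n}$. The *Harris graph* $\mathcal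 G_{\tau,t}$ has vertex set $\mathbb Z^d$ and an edge between $x\ne y$ iff $y\in B(x,K_{x,n})$ for some $T_{x,n}\in(\tau,t]$ or $x\in B(y,K_{y,n})$ for some $T_{y,n}\in(\tau,t]$. **Theorem.** Update rules exist. Moreover: 1. There is a deterministic $t_0>0$ such that, for every update rule, almost surely, for every $k\in\mathbb N_0$, every connected component (island) $C$ of $\mathcal G_{kt_0,(k+1)t_0}$ is finite, and islands do not interact: two paths driven by the Harris system, from any initial configurations, that agree on $C$ at time $kt_0$ agree on $C$ throughout $[kt_0,(k+1)t_0]$. 2. For every update rule and every $\eta\in S^{\mathbb Z^d}$ there is an interacting particle system $(\sigma_t^\eta)_{t\ge0}$ with generator $L$ started from $\eta$, defined on the probability space of the Harris system, such that almost surely $(\sigma^\eta_t)_{t\ge0}$ is the one and only path driven by the Harris system from $\eta$. 3. It is also unique in law: every interacting particle system with generator $L$ started from $\eta$, on any probability space, has the same law on $(S^{\mathbb Z^d})^{[0,\infty)}$ (with the product $\sigma$-algebra) as $(\sigma_t^\eta)_{t\ge0}$. -/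

import Mathlib

open MeasureTheory ProbabilityTheory Filter Topology
open scoped NNReal ENNReal

namespace ParticleSystem

/-- Sites: the points of the lattice `ℤ^d`. -/
abbrev Site (d : ℕ) : Type := Fin d → ℤ

/-- Configurations: the space `S^(ℤ^d)`; it carries the product topology and product `σ`-algebra. -/
abbrev Config (d : ℕ) (S : Type*) : Type _ := Site d → S

/-- The closed ball of radius `r` around `x` in the `L¹` norm. -/
def ball {d : ℕ} (x : Site d) (r : ℕ) : Set (Site d) :=
  {y | ∑ i, (y i - x i).natAbs ≤ r}

/-- `f` is a bounded cylinder function: it depends on the spins at finitely many sites only. -/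
def IsBoundedCylinder {d : ℕ} {S : Type*} (f : Config d S → ℝ) : Prop :=
  (∃ Λ : Finset (Site d), DependsOn f (Λ : Set (Site d))) ∧ ∃ B : ℝ, ∀ σ, |f σ| ≤ B

/-- The generator with jump intensities `c`:
`L f (σ) = ∑ₓ ∑ₛ c_x(s, σ) (f(σ_{x,s}) - f(σ))`, for bounded cylinder functions `f`. -/
noncomputable def generator {d : ℕ} {S : Type*} (c : Site d → S → Config d S → ℝ)
    (f : Config d S → ℝ) (σ : Config d S) : ℝ :=
  ∑' x, ∑' s, c x s σ * (f (Function.update σ x s) - f σ)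

/-- A Kalikow-type decomposition of the jump intensities:
`c_x(s, σ) = M_x ∑_r ν_x(r) p_x^{[r]}(s | σ)`, with `p_x^{[r]}(· | σ)` depending on `σ` only
through the spins in the ball of radius `r` around `x`. -/
structure KalikowDecomposition {d : ℕ} {S : Type*} (c : Site d → S → Config d S → ℝ) where
  M : Site d → ℝ
  ν : Site d → PMF ℕ
  p : Site d → ℕ → Config d S → PMF S
  M_pos : ∀ x, 0 < M x
  p_dependsOn : ∀ x r, DependsOn (p x r) (ball x r)
  rates : ∀ x s σ, c x s σ = M x * ∑' r, (ν x r).toReal * (p x r σ s).toReal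

/-- The generator written out through the decomposition. -/
theorem KalikowDecomposition.generator_eq {d : ℕ} {S : Type*}
    {c : Site d → S → Config d S → ℝ} (D : KalikowDecomposition c)
    (f : Config d S → ℝ) (σ : Config d S) :
    generator c f σ = ∑' x, ∑' s, ∑' r,
      D.M x * (D.ν x r).toReal * (D.p x r σ s).toReal * (f (Function.update σ x s) - f σ) := by
  unfold generator
  refine tsum_congr fun x => tsum_congr fun s => ?_
  simp_rw [D.rates, tsum_mul_right, mul_assoc, tsum_mul_left, mul_assoc]

/-! ### Markov processes with a given generator -/

/-- A path that is right-continuous and has left limits. -/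
def IsCadlag {E : Type*} [TopologicalSpace E] (π : ℝ≥0 → E) : Prop :=
  ∀ t, ContinuousWithinAt π (Set.Ici t) t ∧ ∃ l, Tendsto π (𝓝[<] t) (𝓝 l)

/-- A semigroup of Markov transition kernels. -/
structure IsTransitionSemigroup {E : Type*} [MeasurableSpace E] (κ : ℝ≥0 → Kernel E E) :
    Prop where
  isMarkov : ∀ t, IsMarkovKernel (κ t)
  zero : κ 0 = Kernel.id
  add : ∀ s t, κ (s + t) = κ t ∘ₖ κ s

/-- On bounded cylinder functions, the generator of the semigroup `κ` is the one with jump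
intensities `c`: `(κ_t f - f) / t → L f` uniformly as `t ↓ 0`. -/
def HasGenerator {d : ℕ} {S : Type*} [MeasurableSpace S]
    (κ : ℝ≥0 → Kernel (Config d S) (Config d S)) (c : Site d → S → Config d S → ℝ) : Prop :=
  ∀ f : Config d S → ℝ, IsBoundedCylinder f →
    TendstoUniformly (fun (t : ℝ≥0) ζ => ((∫ ξ, f ξ ∂(κ t ζ)) - f ζ) / (t : ℝ))
      (generator c f) (𝓝[>] 0)

/-- The history up to time `s` of the process `σ`. -/
abbrev history {Ω E : Type*} [MeasurableSpace E] (σ : ℝ≥0 → Ω → E) (s : ℝ≥0) : MeasurableSpace Ω :=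
  ⨆ u : Set.Iic s, MeasurableSpace.comap (σ u) inferInstance

/-- On the probability space `(Ω, P)`, `σ` is an interacting particle system with jump intensities
`c` and initial configuration `η`: a càdlàg Markov process started from `η`, with a transition
semigroup whose generator is the one with jump intensities `c`. -/
structure IsParticleSystem {d : ℕ} {S : Type*} [TopologicalSpace S] [MeasurableSpace S]
    (c : Site d → S → Config d S → ℝ) (η : Config d S)
    {Ω : Type*} [MeasurableSpace Ω] (P : Measure Ω) (σ : ℝ≥0 → Ω → Config d S) : Prop where
  measurable : ∀ t, Measurable (σ t)
  start : ∀ᵐ ω ∂P, σ 0 ω = η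
  cadlag : ∀ᵐ ω ∂P, IsCadlag (fun t => σ t ω)
  markov : ∃ κ : ℝ≥0 → Kernel (Config d S) (Config d S),
    IsTransitionSemigroup κ ∧ HasGenerator κ c ∧
    ∀ s t : ℝ≥0, ∀ A : Set (Config d S), MeasurableSet A →
      P⟦σ (s + t) ⁻¹' A | history σ s⟧ =ᵐ[P] fun ω => (κ t (σ s ω)).real A

/-! ### The Harris graphical construction -/

/-- A realization of the marks: to the site `x` and the index `n` are attached the waiting time
before the `n`-th epoch at `x`, the range `K_{x,n}` and the uniform variable `U_{x,n}`. -/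
abbrev Marks (d : ℕ) : Type := Site d × ℕ → ℝ × ℕ × ℝ

/-- The `n`-th epoch `T_{x,n}` of the Poisson process at the site `x`. -/
noncomputable def epoch {d : ℕ} (ω : Marks d) (x : Site d) (n : ℕ) : ℝ :=
  ∑ i ∈ Finset.range (n + 1), (ω (x, i)).1

/-- The range of interaction `K_{x,n}`. -/
def range {d : ℕ} (ω : Marks d) (x : Site d) (n : ℕ) : ℕ := (ω (x, n)).2.1

/-- The uniform variable `U_{x,n}`. -/
def unif {d : ℕ} (ω : Marks d) (x : Site d) (n : ℕ) : ℝ := (ω (x, n)).2.2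

section Kalikow

variable {d : ℕ} {S : Type*} {c : Site d → S → Config d S → ℝ} (D : KalikowDecomposition c)

/-- The law of the marks attached to a pair `(x, n)`: an exponential waiting time of rate `M_x`,
a range of law `ν_x` and a uniform variable on `[0, 1]`, independent of each other. -/
noncomputable def KalikowDecomposition.markLaw (x : Site d) : Measure (ℝ × ℕ × ℝ) :=
  (expMeasure (D.M x)).prod ((D.ν x).toMeasure.prod (volume.restrict (Set.Icc (0 : ℝ) 1)))

/-- The law of the whole family of independent marked Poisson processes, the process at `x` having
rate `M_x`, that is, i.i.d. exponential waiting times of rate `M_x`. -/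
noncomputable def KalikowDecomposition.harrisMeasure : Measure (Marks d) :=
  Measure.infinitePi fun i : Site d × ℕ => D.markLaw i.1

instance KalikowDecomposition.isProbabilityMeasure_markLaw (x : Site d) :
    IsProbabilityMeasure (D.markLaw x) := by
  have h1 : IsProbabilityMeasure (expMeasure (D.M x)) := isProbabilityMeasure_expMeasure (D.M_pos x)
  have h2 : IsProbabilityMeasure (volume.restrict (Set.Icc (0 : ℝ) 1)) := ⟨by simp⟩
  unfold KalikowDecomposition.markLaw
  infer_instance

instance KalikowDecomposition.isProbabilityMeasure_harrisMeasure :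
    IsProbabilityMeasure D.harrisMeasure := by
  unfold KalikowDecomposition.harrisMeasure
  infer_instance

/-- `W` is an update rule: evaluated at a uniform variable on `[0, 1]`, `W x r σ` has law
`p_x^{[r]}(· | σ)`, and it uses `σ` only through the spins in the ball of radius `r` around `x`. -/
structure KalikowDecomposition.IsUpdateRule [MeasurableSpace S]
    (W : Site d → ℕ → Config d S → ℝ → S) : Prop where
  measurable : ∀ x r σ, Measurable (W x r σ)
  dependsOn : ∀ x r, DependsOn (W x r) (ball x r)
  law : ∀ x r σ, (volume.restrict (Set.Icc (0 : ℝ) 1)).map (W x r σ) = (D.p x r σ).toMeasure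

end Kalikow

/-- `π` is a path driven by the marks `ω` from the initial configuration `η`: the spin at `x` changes
at epochs of `x` only, and at the epoch `t = T_{x,n}` it becomes `W x K_{x,n} π(t-) U_{x,n}`. -/
structure IsHarrisPath {d : ℕ} {S : Type*} [TopologicalSpace S]
    (W : Site d → ℕ → Config d S → ℝ → S) (ω : Marks d) (η : Config d S)
    (π : ℝ≥0 → Config d S) : Prop where
  start : π 0 = η
  cadlag : IsCadlag π
  constant : ∀ x (s t : ℝ≥0), s ≤ t → (∀ n, epoch ω x n ∉ Set.Ioc (s : ℝ) t) → π t x = π s x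
  update : ∀ x n (t : ℝ≥0), (t : ℝ) = epoch ω x n → ∀ l, Tendsto π (𝓝[<] t) (𝓝 l) →
    π t x = W x (range ω x n) l (unif ω x n)

/-- The Harris random graph of the time interval `(τ, t]`: `x` and `y` are joined by an edge if at
some epoch of this interval one of them is updated with a range that reaches the other. -/
def harrisGraph {d : ℕ} (ω : Marks d) (τ t : ℝ≥0) : SimpleGraph (Site d) where
  Adj x y := x ≠ y ∧
    ((∃ n, epoch ω x n ∈ Set.Ioc (τ : ℝ) t ∧ y ∈ ball x (range ω x n)) ∨
      ∃ n, epoch ω y n ∈ Set.Ioc (τ : ℝ) t ∧ x ∈ ball y (range ω y n))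
  symm := ⟨fun _ _ h => ⟨h.1.symm, h.2.symm⟩⟩
  loopless := ⟨fun _ h => h.1 rfl⟩

end ParticleSystem

/-! Three ideas carry the proof.

Finite islands. Give every site the largest range it uses during a time slab of length `t₀`. The
edges of the Harris graph are then covered by a Boolean model with independent radii, where the
radius at `x` equals `j ≥ 1` with probability at most `2 M_x t₀ ν_x(j)` for small `t₀`
(`measure_seqRadius_le`). Such a model is treated by renormalization: a crossing of an annulus at
scale `10α` forces either a ball of radius above `α` nearby, or two crossings at scale `α` in
disjoint regions (`Crossing.split`). By independence the crossing probabilities satisfy `q_{n+1} ≤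
E_n + C q_n²`, where `E_n → 0` by the `d`-th moment, so they tend to `0` along a subsequence once
`t₀` is small (`tendsto_scaleBound`, `ae_finite_cluster`). Exponential waiting times have no memory,
so the Harris system after time `s` has its original law and is independent of the past; hence one
`t₀` serves all slabs.

Graphical construction. A finite island sees finitely many epochs in a slab, so the relation
"earlier epoch inside the ball of an update" admits induction; `Good` records this. It produces the
path (`exists_limitSpin`, `isHarrisPath_harrisPath`) and shows that two driven paths that agree on a
set of sites which the updates do not leave go on agreeing there (`Good.eq_of_eq_on`). Islands and
the whole lattice are such sets, which gives both non-interaction and uniqueness of the path.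
Uniqueness gives a flow property, and independence of past and future marks turns it into the Markov
property (`measure_past_inter`). The generator comes from the fact that, up to probability `O(t²)`,
at most one relevant epoch occurs before `t`, and it sees the initial configuration.

Uniqueness in law. A semigroup and the initial state determine the law, so the generator has to
determine the semigroup. In general `L f` is not a cylinder function, so `L` cannot simply be
iterated. It is truncated to finitely many pairs of a site and a range and followed by an Euler
scheme. For small steps an Euler step is a convex combination of averages of the function, so it
preserves sup bounds, and it enlarges oscillation bounds by a factor `1 + hC` if these form a
summable weight adapted to the influence of the updates (`exists_isWeight`). Truncation errors are
then tails of one convergent series, and every semigroup with this generator is close to the same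
Euler iterate (`exists_approx`). -/

namespace ParticleSystem

/-! ### Boolean percolation on the lattice -/

/-- The closed ball of radius `r` around `x` in the supremum norm. -/
noncomputable def box {d : ℕ} (x : Site d) (r : ℕ) : Finset (Site d) :=
  Finset.Icc (fun i => x i - r) (fun i => x i + r)

theorem mem_box {d : ℕ} {x y : Site d} {r : ℕ} : y ∈ box x r ↔ ∀ i, |y i - x i| ≤ r := by
  simp only [box, Finset.mem_Icc, Pi.le_def, abs_le]
  constructor
  · rintro ⟨h1, h2⟩ i
    have := h1 i
    have := h2 i
    constructor <;> linarith
  · intro h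
    refine ⟨fun i => ?_, fun i => ?_⟩ <;> have := h i <;> linarith

theorem mem_box_comm {d : ℕ} {x y : Site d} {r : ℕ} : y ∈ box x r ↔ x ∈ box y r := by
  simp only [mem_box, abs_sub_comm]

theorem mem_box_self {d : ℕ} (x : Site d) (r : ℕ) : x ∈ box x r := by simp [mem_box]

theorem mem_box_trans {d : ℕ} {x y z : Site d} {r s : ℕ} (h : y ∈ box x r) (h' : z ∈ box y s) :
    z ∈ box x (r + s) := by
  rw [mem_box] at *
  intro i
  have h1 := h i
  have h2 := h' i
  rw [abs_le] at *
  push_cast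
  constructor <;> linarith

theorem box_mono {d : ℕ} (x : Site d) {r s : ℕ} (h : r ≤ s) : box x r ⊆ box x s := by
  intro y hy
  rw [mem_box] at *
  intro i
  exact (hy i).trans (by exact_mod_cast h)

theorem card_box {d : ℕ} (x : Site d) (r : ℕ) : (box x r).card = (2 * r + 1) ^ d := by
  rw [box, Pi.card_Icc]
  have : ∀ i : Fin d, (Finset.Icc (x i - (r : ℤ)) (x i + r)).card = 2 * r + 1 := by
    intro i
    rw [Int.card_Icc]
    omega
  simp [this]

theorem ball_subset_box {d : ℕ} (x : Site d) (r : ℕ) : ball x r ⊆ (box x r : Set (Site d)) := by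
  intro y hy
  simp only [ball, Set.mem_ofPred_eq] at hy
  rw [Finset.mem_coe, mem_box]
  intro i
  have : (y i - x i).natAbs ≤ r :=
    (Finset.single_le_sum (f := fun i => (y i - x i).natAbs) (fun _ _ => Nat.zero_le _)
      (Finset.mem_univ i)).trans hy
  rw [Int.abs_eq_natAbs]
  exact_mod_cast this

theorem finite_ball {d : ℕ} (x : Site d) (r : ℕ) : (ball x r).Finite :=
  (box x r).finite_toSet.subset (ball_subset_box x r)

/-- Cuts a path at its first exit from a region. The initial piece never leaves the region, the
final piece starts just outside; both are needed to extract short crossings from a long path. -/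
theorem exists_exit {α : Type*} {r : α → α → Prop} {p : α → Prop} {u v : α}
    (h : Relation.ReflTransGen r u v) (hu : p u) (hv : ¬ p v) :
    ∃ a b, Relation.ReflTransGen (fun y z => r y z ∧ p y ∧ p z) u a ∧ p a ∧ r a b ∧ ¬ p b ∧
      Relation.ReflTransGen r b v := by
  induction h using Relation.ReflTransGen.head_induction_on with
  | refl => exact absurd hu hv
  | head h1 h2 ih =>
    rename_i a c
    by_cases hc : p c
    · obtain ⟨a', b, h3, h4, h5, h6, h7⟩ := ih hc
      exact ⟨a', b, h3.head ⟨h1, hu, hc⟩, h4, h5, h6, h7⟩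
    · exact ⟨a, c, .refl, hu, h1, hc, h2⟩

/-- One step from `u` to `v` inside a ball of the Boolean model with radii `R`, when only centres
near `x` and radii up to `α` are used. -/
def Step {d : ℕ} (R : Site d → ℕ) (x : Site d) (α : ℕ) (u v : Site d) : Prop :=
  ∃ w, (w = u ∨ w = v) ∧ w ∈ box x (10 * α) ∧ R w ≤ α ∧ v ∈ box u (R w)

/-- The Boolean model with radii `R` has, at scale `α`, a crossing of the annulus around `x`. -/
def Crossing {d : ℕ} (R : Site d → ℕ) (x : Site d) (α : ℕ) : Prop :=
  ∃ u v, u ∈ box x α ∧ v ∉ box x (8 * α) ∧ Relation.ReflTransGen (Step R x α) u v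

/-- Some ball of the Boolean model with a radius larger than `α` comes close to `x`. -/
def Big {d : ℕ} (R : Site d → ℕ) (x : Site d) (α : ℕ) : Prop :=
  ∃ w, α < R w ∧ w ∈ box x (100 * R w)

theorem radius_le_of_not_big {d : ℕ} {R : Site d → ℕ} {x : Site d} {α : ℕ} (h : ¬ Big R x α)
    {w : Site d} (hw : w ∈ box x (100 * α)) : R w ≤ α := by
  by_contra hlt
  exact h ⟨w, by omega, box_mono x (by omega) hw⟩

/-- Stop the long path at its first exit from the box of radius `8α` around `y`. As its radii are at
most `α`, all centres used until then lie within `9α` of `y`, inside the window `10α` that a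
crossing at scale `α` may consult. -/
theorem crossing_of_path {d : ℕ} {R : Site d → ℕ} {x y u v : Site d} {α : ℕ}
    (hR : ∀ w ∈ box x (100 * α), R w ≤ α)
    (h : Relation.ReflTransGen (Step R x (10 * α)) u v) (hu : u ∈ box y α)
    (hv : v ∉ box y (8 * α)) : Crossing R y α := by
  obtain ⟨a, b, h1, ha, ⟨w, hw, hwx, -, hb⟩, hnb, -⟩ :=
    exists_exit (p := fun z => z ∈ box y (8 * α)) h (box_mono y (by omega) hu) hv
  have hx : 10 * (10 * α) = 100 * α := by ring
  rw [hx] at hwx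
  refine ⟨u, b, hu, hnb, Relation.ReflTransGen.tail ?_ ?_ (b := a)⟩
  · refine Relation.ReflTransGen.mono (fun z z' hz => ?_) _ _ h1
    obtain ⟨⟨w, hw, hwx, -, hb⟩, hz, hz'⟩ := hz
    rw [hx] at hwx
    refine ⟨w, hw, ?_, hR w hwx, hb⟩
    rcases hw with rfl | rfl
    exacts [box_mono y (by omega) hz, box_mono y (by omega) hz']
  · refine ⟨w, hw, ?_, hR w hwx, hb⟩
    rcases hw with rfl | rfl
    · exact box_mono y (by omega) ha
    · have := hR _ hwx
      exact box_mono y (by omega) (mem_box_trans ha hb)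

/-- Rounding down to a grid of mesh `α`. The small crossings are thereby centred at boundedly many
places, and the number of terms in the union bound does not depend on the scale. -/
theorem exists_translate {d : ℕ} {x b : Site d} {α k : ℕ} (hα : 0 < α) (hb : b ∈ box x (k * α)) :
    ∃ j ∈ box (0 : Site d) (k + 1), b ∈ box (x + (α : ℤ) • j) α := by
  have hα' : (0 : ℤ) < α := by exact_mod_cast hα
  refine ⟨fun i => (b i - x i) / α, ?_, ?_⟩
  · rw [mem_box] at *
    intro i
    have h := hb i
    rw [abs_le] at h
    simp only [Pi.zero_apply, sub_zero]
    rw [abs_le]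
    push_cast at *
    constructor
    · rw [Int.le_ediv_iff_mul_le hα']
      nlinarith
    · have : (b i - x i) / (α : ℤ) < k + 1 + 1 := by
        rw [Int.ediv_lt_iff_lt_mul hα']
        nlinarith
      linarith
  · rw [mem_box]
    intro i
    have h1 := Int.emod_nonneg (b i - x i) hα'.ne'
    have h2 := Int.emod_lt_of_pos (b i - x i) hα'
    have h3 := Int.emod_add_mul_ediv (b i - x i) α
    simp only [Pi.add_apply, Pi.smul_apply, smul_eq_mul]
    rw [abs_le]
    constructor <;> linarith

theorem translate_mem_box {d : ℕ} {x j : Site d} {k α : ℕ} (hj : j ∈ box (0 : Site d) k) :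
    x + (α : ℤ) • j ∈ box x (k * α) := by
  rw [mem_box] at *
  intro i
  have := hj i
  simp only [Pi.zero_apply, sub_zero] at this
  simp only [Pi.add_apply, Pi.smul_apply, smul_eq_mul, add_sub_cancel_left, abs_mul, Nat.abs_cast]
  push_cast
  rw [mul_comm]
  exact mul_le_mul_of_nonneg_right this (by positivity)

/-- The path travels from radius `10α` to radius `80α`. If no large ball is near, all its radii are
at most `α`, and a small crossing starts wherever it first leaves a box of intermediate radius `kα`.
Two well separated values of `k` give two crossings that depend on disjoint sets of radii. -/
theorem Crossing.split {d : ℕ} {R : Site d → ℕ} {x : Site d} {α : ℕ} (hα : 0 < α)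
    (h : Crossing R x (10 * α)) : Big R x α ∨
      ∃ j ∈ box (0 : Site d) 12, ∃ j' ∈ box (0 : Site d) 62,
        Disjoint (box (x + (α : ℤ) • j) (10 * α)) (box (x + (α : ℤ) • j') (10 * α)) ∧
        Crossing R (x + (α : ℤ) • j) α ∧ Crossing R (x + (α : ℤ) • j') α := by
  by_cases hbig : Big R x α
  · exact .inl hbig
  right
  have hR : ∀ w ∈ box x (100 * α), R w ≤ α := fun w hw => radius_le_of_not_big hbig hw
  obtain ⟨u, e, hu, he, hp⟩ := h
  have hx : 10 * (10 * α) = 100 * α := by ring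
  have key : ∀ k : ℕ, 10 ≤ k → k + 1 ≤ 61 → ∃ j ∈ box (0 : Site d) (k + 2),
      Crossing R (x + (α : ℤ) • j) α ∧ ∃ b, b ∉ box x (k * α) ∧ b ∈ box (x + (α : ℤ) • j) α := by
    intro k hk hk'
    obtain ⟨a, b, h1, ha, ⟨w, hw, hwx, -, hb⟩, hnb, h2⟩ :=
      exists_exit (p := fun z => z ∈ box x (k * α)) hp
        (box_mono x (Nat.mul_le_mul_right _ hk) hu)
        (fun hc => he (box_mono x (by nlinarith) hc))
    rw [hx] at hwx
    have hb' : b ∈ box x ((k + 1) * α) :=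
      box_mono x (by nlinarith [hR w hwx]) (mem_box_trans ha hb)
    obtain ⟨j, hj, hbj⟩ := exists_translate hα hb'
    refine ⟨j, hj, crossing_of_path hR h2 hbj fun hc => he ?_, b, hnb, hbj⟩
    exact box_mono x (by nlinarith) (mem_box_trans (translate_mem_box hj) hc)
  obtain ⟨j, hj, hc, -⟩ := key 10 le_rfl (by norm_num)
  -- If the two windows met, `b` would lie within `(12 + 10 + 10 + 1)α = 33α` of `x`, although it is
  -- outside the box of radius `60α`.
  obtain ⟨j', hj', hc', b, hb, hbj⟩ := key 60 (by norm_num) (by norm_num)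
  refine ⟨j, hj, j', hj', ?_, hc, hc'⟩
  rw [Finset.disjoint_left]
  intro z hz hz'
  apply hb
  have h1 := mem_box_trans (mem_box_trans (mem_box_trans (translate_mem_box hj) hz)
    (mem_box_comm.1 hz')) hbj
  exact box_mono x (by nlinarith) h1

/-- A path cannot move if all radii near `x` vanish. This starts the recursion over scales. -/
theorem Crossing.big_zero {d : ℕ} {R : Site d → ℕ} {x : Site d}
    (h : Crossing R x 1) : Big R x 0 := by
  by_contra hb
  obtain ⟨u, v, hu, hv, hp⟩ := h
  have : v = u := by
    clear hv
    induction hp with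
    | refl => rfl
    | tail _ h2 ih =>
      obtain ⟨w, _, hw, _, h⟩ := h2
      have : R w = 0 := by
        by_contra h0
        exact hb ⟨w, by omega, box_mono x (by omega) hw⟩
      rw [this, mem_box] at h
      rw [← ih]
      ext i
      have := h i
      simp only [Nat.cast_zero, abs_nonpos_iff] at this
      linarith
  subst this
  exact hv (box_mono x (by omega) hu)

theorem crossing_or_big_of_infinite {d : ℕ} {R : Site d → ℕ} {G : SimpleGraph (Site d)}
    (hG : ∀ y z, G.Adj y z → z ∈ box y (R y) ∨ y ∈ box z (R z)) {x : Site d}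
    (hx : (G.connectedComponentMk x).supp.Infinite) (α : ℕ) :
    Crossing R x α ∨ Big R x α := by
  by_cases hbig : Big R x α
  · exact .inr hbig
  left
  obtain ⟨e, he, hex⟩ := hx.exists_notMem_finset (box x (8 * α))
  have hreach : G.Reachable x e := by
    rw [SimpleGraph.ConnectedComponent.mem_supp_iff, SimpleGraph.ConnectedComponent.eq] at he
    exact he.symm
  rw [SimpleGraph.reachable_iff_reflTransGen] at hreach
  obtain ⟨a, b, h1, ha, hab, hb, -⟩ :=
    exists_exit (p := fun z => z ∈ box x (8 * α)) hreach (mem_box_self x _) hex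
  have hstep : ∀ y z, y ∈ box x (8 * α) → G.Adj y z → Step R x α y z := by
    intro y z hy hyz
    rcases hG y z hyz with h | h
    · exact ⟨y, .inl rfl, box_mono x (by omega) hy,
        radius_le_of_not_big hbig (box_mono x (by omega) hy), h⟩
    -- The ball is centred at the new site `z`, whose distance from `x` is bounded only by `8α + R
    -- z`. If `R z > α` this is at most `9 R z`, so `z` itself witnesses `Big`.
    · have hzy := mem_box_comm.1 h
      have hz := mem_box_trans hy hzy
      have hle : R z ≤ α := by
        by_contra hlt
        exact hbig ⟨z, by omega, box_mono x (by omega) hz⟩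
      exact ⟨z, .inr rfl, box_mono x (by omega) hz, hle, hzy⟩
  exact ⟨x, b, mem_box_self x _, hb,
    (Relation.ReflTransGen.mono (fun y z h => hstep y z h.2.1 h.1) _ _ h1).tail (hstep a b ha hab)⟩

theorem crossing_congr {d : ℕ} {R R' : Site d → ℕ} {x : Site d} {α : ℕ}
    (h : ∀ w ∈ box x (10 * α), R w = R' w) : Crossing R x α ↔ Crossing R' x α := by
  have : Step R x α = Step R' x α := by
    ext u v
    refine exists_congr fun w => and_congr_right fun _ => and_congr_right fun hw => ?_
    rw [h w hw]
  unfold Crossing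
  rw [this]

/-! ### Probabilities of large balls and independence of distant crossings -/

section Probability

variable {d : ℕ} {Ω : Type*} [MeasurableSpace Ω] {P : Measure Ω} {R : Site d → Ω → ℕ}

theorem measure_crossing_inter [IsProbabilityMeasure P] (hR : ∀ x, Measurable (R x))
    (hind : iIndepFun R P) {y z : Site d} {α : ℕ}
    (hyz : Disjoint (box y (10 * α)) (box z (10 * α))) :
    P {ω | Crossing (R · ω) y α ∧ Crossing (R · ω) z α} =
      P {ω | Crossing (R · ω) y α} * P {ω | Crossing (R · ω) z α} := by
  classical
  have hI := hind.indepFun_finset _ _ hyz hR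
  -- The crossing event as a set of radii in the window alone; the filler `0` is never consulted, by
  -- `crossing_congr`. Finite families of naturals form a countable discrete space, so measurability
  -- is automatic.
  let A : (y : Site d) → Set (box y (10 * α) → ℕ) := fun y =>
    {ρ | Crossing (fun w => if h : w ∈ box y (10 * α) then ρ ⟨w, h⟩ else 0) y α}
  have hA : ∀ y, {ω | Crossing (R · ω) y α} =
      (fun ω (i : box y (10 * α)) => R i ω) ⁻¹' A y := by
    intro y
    ext ω
    exact crossing_congr fun w hw => by simp [hw]
  have := hI.measure_inter_preimage_eq_mul (A y) (A z) (.of_discrete) (.of_discrete)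
  rw [← hA, ← hA] at this
  exact this

/-- The tail of the series `∑ j ^ d * s j`. -/
noncomputable def radiusTail (d : ℕ) (s : ℕ → ℝ≥0∞) (α : ℕ) : ℝ≥0∞ :=
  ∑' j : ℕ, if α < j then (j : ℝ≥0∞) ^ d * s j else 0

theorem radiusTail_antitone (d : ℕ) (s : ℕ → ℝ≥0∞) : Antitone (radiusTail d s) := by
  intro a b hab
  refine ENNReal.tsum_le_tsum fun j => ?_
  split_ifs <;> first | omega | simp

theorem tendsto_radiusTail {s : ℕ → ℝ≥0∞} (hs : ∑' j : ℕ, (j : ℝ≥0∞) ^ d * s j ≠ ⊤) :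
    Tendsto (radiusTail d s) atTop (𝓝 0) := by
  have := ENNReal.tendsto_sum_nat_add (fun j : ℕ => (j : ℝ≥0∞) ^ d * s j) hs
  rw [← tendsto_add_atTop_iff_nat 1] at this
  refine tendsto_of_tendsto_of_tendsto_of_le_of_le tendsto_const_nhds this (fun _ => zero_le)
    fun α => ?_
  change radiusTail d s α ≤ ∑' k, ((k + (α + 1) : ℕ) : ℝ≥0∞) ^ d * s (k + (α + 1))
  unfold radiusTail
  rw [← ENNReal.summable.sum_add_tsum_nat_add' (k := α + 1)
    (f := fun j : ℕ => if α < j then (j : ℝ≥0∞) ^ d * s j else 0), Finset.sum_eq_zero, zero_add]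
  · exact ENNReal.tsum_le_tsum fun j => by split_ifs <;> simp
  · intro j hj
    rw [Finset.mem_range] at hj
    rw [if_neg (by omega)]

/-- Union bound over the radius `j > α` and its centre. There are `(200 j + 1)^d ≤ (201 j)^d`
possible centres, and this power of `j` is what the `d`-th moment pays for. -/
theorem measure_big_le {ε : ℝ≥0∞} {s : ℕ → ℝ≥0∞}
    (hs : ∀ x j, j ≠ 0 → P {ω | R x ω = j} ≤ ε * s j) (x : Site d) (α : ℕ) :
    P {ω | Big (R · ω) x α} ≤ ε * (201 ^ d * radiusTail d s α) := by
  have h1 : {ω | Big (R · ω) x α} ⊆ ⋃ j : ℕ, ⋃ w : Site d,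
      {ω | R w ω = j ∧ α < j ∧ w ∈ box x (100 * j)} := by
    rintro ω ⟨w, hw, hw'⟩
    simp only [Set.mem_iUnion]
    exact ⟨R w ω, w, rfl, hw, hw'⟩
  refine (measure_mono h1).trans ((measure_iUnion_le _).trans ?_)
  rw [radiusTail, ← ENNReal.tsum_mul_left, ← ENNReal.tsum_mul_left]
  refine ENNReal.tsum_le_tsum fun j => (measure_iUnion_le _).trans ?_
  by_cases hj : α < j
  · rw [if_pos hj, tsum_eq_sum (s := box x (100 * j))]
    · calc ∑ w ∈ box x (100 * j), P {ω | R w ω = j ∧ α < j ∧ w ∈ box x (100 * j)}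
          ≤ ∑ w ∈ box x (100 * j), ε * s j :=
            Finset.sum_le_sum fun w _ =>
              (measure_mono fun ω h => h.1).trans (hs w j (by omega))
        _ = ((2 * (100 * j) + 1 : ℕ) : ℝ≥0∞) ^ d * (ε * s j) := by
            rw [Finset.sum_const, card_box, nsmul_eq_mul]
            push_cast
            rfl
        _ ≤ ((201 * j : ℕ) : ℝ≥0∞) ^ d * (ε * s j) := by
            gcongr
            omega
        _ = ε * (201 ^ d * ((j : ℝ≥0∞) ^ d * s j)) := by
            push_cast
            rw [mul_pow]
            ring
    · intro w hw
      simp [hw]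
  · simp [hj]

end Probability

/-- The iteration bounding the crossing probabilities from one scale to the next. -/
noncomputable def scaleBound (C a : ℝ≥0∞) (E : ℕ → ℝ≥0∞) : ℕ → ℝ≥0∞
  | 0 => a
  | n + 1 => E n + C * scaleBound C a E n ^ 2

/-- The bound `C q_n ≤ 1/2` propagates, because `1/4 + (1/2)² = 1/2`; it linearizes the recursion to
`q_{n+1} ≤ E_n + q_n / 2`. Of `n + n` steps the first `n` make `E` small and the last `n` contract,
which gives `q_{2n} ≤ 2^{-n} + 2 E_n`. -/
theorem tendsto_scaleBound {C a : ℝ≥0∞} {E : ℕ → ℝ≥0∞} (hC : 1 ≤ C) (hE : Antitone E)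
    (ha : C * a ≤ 1 / 4) (hEa : ∀ n, E n ≤ a) (hE0 : Tendsto E atTop (𝓝 0)) :
    Tendsto (fun n => scaleBound C a E (n + n)) atTop (𝓝 0) := by
  have h4 : (1 / 4 : ℝ≥0∞) + 1 / 2 * (1 / 2) = 1 / 2 := by
    rw [← ENNReal.toReal_eq_toReal_iff' (by norm_num; finiteness) (by norm_num)]
    rw [ENNReal.toReal_add (by norm_num) (by finiteness)]
    simp
    norm_num
  have h2 : (1 / 2 : ℝ≥0∞) + 1 / 2 = 1 := ENNReal.add_halves 1
  have hhalf : ∀ n, C * scaleBound C a E n ≤ 1 / 2 := by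
    intro n
    induction n with
    | zero => exact ha.trans (by rw [← h4]; exact le_self_add)
    | succ n ih =>
      rw [scaleBound, mul_add, ← h4]
      refine add_le_add ((by gcongr; exact hEa n : C * E n ≤ C * a).trans ha) ?_
      calc C * (C * scaleBound C a E n ^ 2)
          = (C * scaleBound C a E n) * (C * scaleBound C a E n) := by ring
        _ ≤ _ := by gcongr
  have hstep : ∀ n, scaleBound C a E (n + 1) ≤ E n + 1 / 2 * scaleBound C a E n := by
    intro n
    rw [scaleBound]
    refine add_le_add le_rfl ?_
    rw [pow_two, ← mul_assoc]
    exact mul_le_mul_left (hhalf n) _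
  have hle : ∀ n, scaleBound C a E n ≤ 1 := fun n =>
    calc scaleBound C a E n = 1 * scaleBound C a E n := (one_mul _).symm
      _ ≤ C * scaleBound C a E n := by gcongr
      _ ≤ 1 / 2 := hhalf n
      _ ≤ 1 := le_self_add.trans h2.le
  have hiter : ∀ n m, scaleBound C a E (n + m) ≤ (1 / 2) ^ m + 2 * E n := by
    intro n m
    induction m with
    | zero => simpa using (hle n).trans le_self_add
    | succ m ih =>
      calc scaleBound C a E (n + m + 1) ≤ E (n + m) + 1 / 2 * scaleBound C a E (n + m) := hstep _
        _ ≤ E n + 1 / 2 * ((1 / 2) ^ m + 2 * E n) := by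
            gcongr
            exact hE (by omega)
        _ = (1 / 2) ^ (m + 1) + (1 + 1 / 2 * 2) * E n := by ring
        _ = _ := by
            congr 2
            rw [mul_two, h2, one_add_one_eq_two]
  refine tendsto_of_tendsto_of_tendsto_of_le_of_le tendsto_const_nhds ?_ (fun _ => zero_le)
    (fun n => hiter n n)
  have := (ENNReal.tendsto_pow_atTop_nhds_zero_of_lt_one
    (show (1 / 2 : ℝ≥0∞) < 1 by simp)).add
    (ENNReal.Tendsto.const_mul (a := 2) hE0 (.inr (by simp)))
  simpa using this

section Probability

variable {d : ℕ} {Ω : Type*} [MeasurableSpace Ω] {P : Measure Ω} [IsProbabilityMeasure P]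
  {R : Site d → Ω → ℕ}

/-- `Crossing.split` read in probability. The factor `25^d * 125^d` counts the pairs `(j, j')` of
grid positions; for each pair independence squares the bound of the smaller scale. -/
theorem measure_crossing_le (hR : ∀ x, Measurable (R x)) (hind : iIndepFun R P)
    {ε : ℝ≥0∞} {s : ℕ → ℝ≥0∞} (hs : ∀ x j, j ≠ 0 → P {ω | R x ω = j} ≤ ε * s j)
    (x : Site d) (n : ℕ) :
    P {ω | Crossing (R · ω) x (10 ^ n)} ≤ scaleBound (25 ^ d * 125 ^ d)
      (ε * (201 ^ d * radiusTail d s 0)) (fun n => ε * (201 ^ d * radiusTail d s (10 ^ n))) n := by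
  classical
  induction n generalizing x with
  | zero =>
    rw [scaleBound, pow_zero]
    exact (measure_mono fun ω h => Crossing.big_zero h).trans (measure_big_le hs x 0)
  | succ n ih =>
    rw [scaleBound]
    set q := scaleBound (25 ^ d * 125 ^ d) (ε * (201 ^ d * radiusTail d s 0))
      (fun n => ε * (201 ^ d * radiusTail d s (10 ^ n))) n
    let Z : Site d → Site d := fun j => x + ((10 ^ n : ℕ) : ℤ) • j
    let A : Site d → Site d → Set Ω := fun j j' => {ω |
      Disjoint (box (Z j) (10 * 10 ^ n)) (box (Z j') (10 * 10 ^ n)) ∧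
        Crossing (R · ω) (Z j) (10 ^ n) ∧ Crossing (R · ω) (Z j') (10 ^ n)}
    have hsub : {ω | Crossing (R · ω) x (10 ^ (n + 1))} ⊆ {ω | Big (R · ω) x (10 ^ n)} ∪
        ⋃ j ∈ box (0 : Site d) 12, ⋃ j' ∈ box (0 : Site d) 62, A j j' := by
      intro ω hω
      have hω' : Crossing (R · ω) x (10 * 10 ^ n) := by
        rw [← pow_succ']
        exact hω
      rcases hω'.split (by positivity) with h | ⟨j, hj, j', hj', h⟩
      · exact .inl h
      · right
        simp only [Set.mem_iUnion]
        exact ⟨j, hj, j', hj', h⟩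
    have hA : ∀ j j', P (A j j') ≤ q ^ 2 := by
      intro j j'
      by_cases hd : Disjoint (box (Z j) (10 * 10 ^ n)) (box (Z j') (10 * 10 ^ n))
      · calc P (A j j') ≤ P {ω | Crossing (R · ω) (Z j) (10 ^ n) ∧
              Crossing (R · ω) (Z j') (10 ^ n)} := measure_mono fun ω h => h.2
          _ = _ := measure_crossing_inter hR hind hd
          _ ≤ q * q := mul_le_mul' (ih _) (ih _)
          _ = q ^ 2 := (pow_two q).symm
      · have : A j j' = ∅ := by
          ext ω
          simp [A, hd]
        simp [this]
    refine (measure_mono hsub).trans ((measure_union_le _ _).trans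
      (add_le_add (measure_big_le hs x _) ?_))
    calc P (⋃ j ∈ box (0 : Site d) 12, ⋃ j' ∈ box (0 : Site d) 62, A j j')
        ≤ ∑ j ∈ box (0 : Site d) 12, ∑ j' ∈ box (0 : Site d) 62, P (A j j') :=
          (measure_biUnion_finset_le _ _).trans
            (Finset.sum_le_sum fun j _ => measure_biUnion_finset_le _ _)
      _ ≤ ∑ j ∈ box (0 : Site d) 12, ∑ j' ∈ box (0 : Site d) 62, q ^ 2 :=
          Finset.sum_le_sum fun j _ => Finset.sum_le_sum fun j' _ => hA j j'
      _ = 25 ^ d * 125 ^ d * q ^ 2 := by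
          simp only [Finset.sum_const, card_box, nsmul_eq_mul]
          push_cast
          ring

/-- In the Boolean model on the lattice with independent radii whose laws are dominated by a small
multiple of a sequence with finite `d`-th moment, all clusters are finite. -/
theorem ae_finite_cluster (hR : ∀ x, Measurable (R x)) (hind : iIndepFun R P)
    {ε : ℝ≥0∞} {s : ℕ → ℝ≥0∞} (hs : ∀ x j, j ≠ 0 → P {ω | R x ω = j} ≤ ε * s j)
    (hsum : ∑' j : ℕ, (j : ℝ≥0∞) ^ d * s j ≠ ⊤) (hε' : ε ≠ ⊤)
    (hε : 25 ^ d * 125 ^ d * (ε * (201 ^ d * ∑' j : ℕ, (j : ℝ≥0∞) ^ d * s j)) ≤ 1 / 4) :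
    ∀ᵐ ω ∂P, ∀ G : SimpleGraph (Site d),
      (∀ y z, G.Adj y z → z ∈ box y (R y ω) ∨ y ∈ box z (R z ω)) →
      ∀ C : G.ConnectedComponent, C.supp.Finite := by
  have hx : ∀ x : Site d, P {ω | ∀ n : ℕ, Crossing (R · ω) x (10 ^ n) ∨
      Big (R · ω) x (10 ^ n)} = 0 := by
    intro x
    set E : ℕ → ℝ≥0∞ := fun n => ε * (201 ^ d * radiusTail d s (10 ^ n)) with hE
    set a := ε * (201 ^ d * radiusTail d s 0)
    have hanti : Antitone E := fun m n hmn => by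
      simp only [hE]
      gcongr
      exact radiusTail_antitone d s (Nat.pow_le_pow_right (by norm_num) hmn)
    have hEa : ∀ n, E n ≤ a := fun n => by
      simp only [hE, a]
      gcongr
      exact radiusTail_antitone d s (Nat.zero_le _)
    have h0 : radiusTail d s 0 ≤ ∑' j : ℕ, (j : ℝ≥0∞) ^ d * s j :=
      ENNReal.tsum_le_tsum fun j => by split_ifs <;> simp
    have hE0 : Tendsto E atTop (𝓝 0) := by
      have h1 : Tendsto (fun n => radiusTail d s (10 ^ n)) atTop (𝓝 0) :=
        (tendsto_radiusTail hsum).comp (tendsto_pow_atTop_atTop_of_one_lt (by norm_num))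
      have h2 := ENNReal.Tendsto.const_mul (a := ε)
        (ENNReal.Tendsto.const_mul (a := 201 ^ d) h1 (.inr (by finiteness))) (.inr hε')
      simpa using h2
    have hC : (1 : ℝ≥0∞) ≤ 25 ^ d * 125 ^ d :=
      one_le_mul (one_le_pow₀ (by norm_num)) (one_le_pow₀ (by norm_num))
    have ha : 25 ^ d * 125 ^ d * a ≤ 1 / 4 := by
      refine le_trans ?_ hε
      simp only [a]
      gcongr
    have hlim := (tendsto_scaleBound hC hanti ha hEa hE0).add
      (hE0.comp (tendsto_atTop_mono (fun n => Nat.le_add_left n n) tendsto_id))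
    rw [add_zero] at hlim
    refine le_antisymm (ge_of_tendsto' hlim fun n => ?_) zero_le
    calc P {ω | ∀ n : ℕ, Crossing (R · ω) x (10 ^ n) ∨ Big (R · ω) x (10 ^ n)}
        ≤ P ({ω | Crossing (R · ω) x (10 ^ (n + n))} ∪ {ω | Big (R · ω) x (10 ^ (n + n))}) :=
          measure_mono fun ω h => h (n + n)
      _ ≤ _ := (measure_union_le _ _).trans
          (add_le_add (measure_crossing_le hR hind hs x _) (measure_big_le hs x _))
  have hall : ∀ᵐ ω ∂P, ∀ x : Site d, ¬ ∀ n : ℕ, Crossing (R · ω) x (10 ^ n) ∨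
      Big (R · ω) x (10 ^ n) := by
    rw [ae_all_iff]
    intro x
    rw [ae_iff]
    simp only [not_not]
    exact hx x
  filter_upwards [hall] with ω hω G hG C
  obtain ⟨x, rfl⟩ := C.exists_rep
  by_contra hinf
  exact hω x fun n => crossing_or_big_of_infinite hG hinf _

end Probability

/-! ### The marked Poisson process of one site -/

/-- The mark attached to one epoch: waiting time, range and uniform variable. -/
abbrev Mark : Type := ℝ × ℕ × ℝ

/-- The sequence `a, m 0, m 1, …`. -/
def seqCons {α : Type*} (a : α) (m : ℕ → α) : ℕ → α
  | 0 => a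
  | n + 1 => m n

theorem measurable_seqCons {α : Type*} [MeasurableSpace α] :
    Measurable (fun p : α × (ℕ → α) => seqCons p.1 p.2) := by
  rw [measurable_pi_iff]
  rintro (_ | n)
  · exact measurable_fst
  · exact (measurable_pi_apply n).comp measurable_snd

/-- An i.i.d. sequence is a first term followed by an independent copy of the sequence. This is what
allows conditioning on the first mark. -/
theorem map_seqCons {α : Type*} [MeasurableSpace α] (ρ : Measure α) [IsProbabilityMeasure ρ] :
    (ρ.prod (Measure.infinitePi fun _ : ℕ => ρ)).map (fun p => seqCons p.1 p.2) =
      Measure.infinitePi fun _ : ℕ => ρ := by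
  classical
  refine Measure.eq_infinitePi _ fun s t ht => ?_
  rw [Measure.map_apply measurable_seqCons (.pi s.countable_toSet fun i _ => ht i)]
  obtain ⟨n, hn⟩ := s.exists_nat_subset_range
  let t' : ℕ → Set α := fun i => if i ∈ s then t i else Set.univ
  have ht' : ∀ i, MeasurableSet (t' i) := fun i => by
    simp only [t']
    split_ifs
    exacts [ht i, .univ]
  have h1 : (fun p : α × (ℕ → α) => seqCons p.1 p.2) ⁻¹' (Set.pi s t) =
      t' 0 ×ˢ Set.pi (Finset.range n) (fun i => t' (i + 1)) := by
    ext ⟨a, m⟩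
    simp only [Set.mem_preimage, Set.mem_pi, Finset.mem_coe, Set.mem_prod, t']
    constructor
    · intro h
      refine ⟨?_, fun i _ => ?_⟩
      · split_ifs with h0
        exacts [h 0 h0, trivial]
      · split_ifs with h0
        exacts [h _ h0, trivial]
    · rintro ⟨h, h'⟩ (_ | i) hi
      · simpa [hi, seqCons] using h
      · have := h' i (by have := hn hi; simp at this ⊢; omega)
        simpa [hi, seqCons] using this
  rw [h1, Measure.prod_prod, Measure.infinitePi_pi _ (fun i _ => ht' _)]
  have h2 : ∏ i ∈ s, ρ (t i) = ∏ i ∈ Finset.range (n + 1), ρ (t' i) := by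
    rw [← Finset.prod_subset (hn.trans (Finset.range_mono (Nat.le_succ n)))]
    · exact Finset.prod_congr rfl fun i hi => by simp [t', hi]
    · intro i _ hi
      simp [t', hi]
  rw [h2, Finset.prod_range_succ', mul_comm]

/-- The `n`-th epoch of a sequence of marks. -/
noncomputable def seqEpoch (m : ℕ → Mark) (n : ℕ) : ℝ := ∑ i ∈ Finset.range (n + 1), (m i).1

theorem measurable_seqEpoch (n : ℕ) : Measurable fun m : ℕ → Mark => seqEpoch m n := by
  unfold seqEpoch
  fun_prop

theorem seqEpoch_seqCons_zero (a : Mark) (m : ℕ → Mark) : seqEpoch (seqCons a m) 0 = a.1 := by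
  simp [seqEpoch, seqCons]

theorem seqEpoch_seqCons_succ (a : Mark) (m : ℕ → Mark) (n : ℕ) :
    seqEpoch (seqCons a m) (n + 1) = a.1 + seqEpoch m n := by
  rw [seqEpoch, Finset.sum_range_succ', add_comm]
  rfl

/-- The first `n` marks of a sequence, followed by copies of a fixed mark `D`. -/
def seqTake (D : Mark) (n : ℕ) (m : ℕ → Mark) : ℕ → Mark := fun k => if k < n then m k else D

/-- The marks of the epochs from the `n`-th on, the first waiting time being counted from `s`. -/
noncomputable def seqDrop (s : ℝ) (n : ℕ) (m : ℕ → Mark) : ℕ → Mark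
  | 0 => (seqEpoch m n - s, (m n).2)
  | k + 1 => m (n + (k + 1))

theorem measurable_seqTake (D : Mark) (n : ℕ) : Measurable (seqTake D n) := by
  rw [measurable_pi_iff]
  intro k
  unfold seqTake
  split_ifs <;> fun_prop

theorem measurable_seqDrop (s : ℝ) (n : ℕ) : Measurable (seqDrop s n) := by
  rw [measurable_pi_iff]
  rintro (_ | k)
  · exact ((measurable_seqEpoch n).sub_const s).prodMk (by fun_prop)
  · exact measurable_pi_apply _

/-- The sequences of marks with exactly `n` epochs up to time `s`. -/
def countEvent (s : ℝ) (n : ℕ) : Set (ℕ → Mark) :=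
  {m | (∀ k < n, seqEpoch m k ≤ s) ∧ s < seqEpoch m n}

theorem measurableSet_countEvent_uncurry (n : ℕ) :
    MeasurableSet {p : ℝ × (ℕ → Mark) | p.2 ∈ countEvent p.1 n} := by
  have h : ∀ k, Measurable fun p : ℝ × (ℕ → Mark) => seqEpoch p.2 k := fun k =>
    (measurable_seqEpoch k).comp measurable_snd
  have : {p : ℝ × (ℕ → Mark) | p.2 ∈ countEvent p.1 n} =
      (⋂ k : ℕ, ⋂ _ : k < n, {p | seqEpoch p.2 k ≤ p.1}) ∩ {p | p.1 < seqEpoch p.2 n} := by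
    ext p
    simp [countEvent]
  rw [this]
  exact (MeasurableSet.iInter fun k => MeasurableSet.iInter fun _ =>
    measurableSet_le (h k) measurable_fst).inter (measurableSet_lt measurable_fst (h n))

theorem measurableSet_countEvent (s : ℝ) (n : ℕ) : MeasurableSet (countEvent s n) :=
  (measurableSet_countEvent_uncurry n).preimage (measurable_prodMk_left (x := s))

theorem seqCons_mem_countEvent_succ {s : ℝ} {n : ℕ} {a : Mark} {m : ℕ → Mark} :
    seqCons a m ∈ countEvent s (n + 1) ↔ a.1 ≤ s ∧ m ∈ countEvent (s - a.1) n := by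
  simp only [countEvent, Set.mem_ofPred_eq, seqEpoch_seqCons_succ]
  constructor
  · rintro ⟨h1, h2⟩
    refine ⟨?_, fun k hk => ?_, by linarith⟩
    · simpa [seqEpoch_seqCons_zero] using h1 0 (Nat.succ_pos n)
    · have := h1 (k + 1) (by omega)
      rw [seqEpoch_seqCons_succ] at this
      linarith
  · rintro ⟨h1, h2, h3⟩
    refine ⟨?_, by linarith⟩
    rintro (_ | k) hk
    · simpa [seqEpoch_seqCons_zero] using h1
    · rw [seqEpoch_seqCons_succ]
      linarith [h2 k (by omega)]

theorem seqTake_seqCons (D a : Mark) (n : ℕ) (m : ℕ → Mark) :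
    seqTake D (n + 1) (seqCons a m) = seqCons a (seqTake D n m) := by
  ext1 k
  cases k <;> simp [seqTake, seqCons]

theorem seqDrop_seqCons (s : ℝ) (a : Mark) (n : ℕ) (m : ℕ → Mark) :
    seqDrop s (n + 1) (seqCons a m) = seqDrop (s - a.1) n m := by
  ext1 k
  rcases k with _ | k
  · simp only [seqDrop, seqEpoch_seqCons_succ, seqCons]
    congr 1
    ring
  · simp only [seqDrop]
    rw [show n + 1 + (k + 1) = (n + (k + 1)) + 1 by ring]
    rfl

theorem expMeasure_Iic {M : ℝ} (hM : 0 < M) (x : ℝ) :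
    expMeasure M (Set.Iic x) = ENNReal.ofReal (if 0 ≤ x then 1 - Real.exp (-(M * x)) else 0) := by
  have := isProbabilityMeasure_expMeasure hM
  rw [← cdf_expMeasure_eq hM, ofReal_cdf]

/-- Memorylessness of the exponential law, checked on distribution functions. -/
theorem map_sub_restrict_expMeasure {M : ℝ} (hM : 0 < M) {s : ℝ} (hs : 0 ≤ s) :
    ((expMeasure M).restrict (Set.Ioi s)).map (fun x => x - s) =
      (expMeasure M (Set.Ioi s)) • expMeasure M := by
  have := isProbabilityMeasure_expMeasure hM
  have hf : Measurable fun x : ℝ => x - s := measurable_id.sub_const s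
  have : IsFiniteMeasure ((expMeasure M (Set.Ioi s)) • expMeasure M) :=
    Measure.smul_finite _ (measure_ne_top _ _)
  refine Measure.ext_of_Iic _ _ fun a => ?_
  rw [Measure.map_apply hf measurableSet_Iic, Measure.restrict_apply (hf measurableSet_Iic),
    Measure.smul_apply, smul_eq_mul]
  have h1 : (fun x : ℝ => x - s) ⁻¹' Set.Iic a ∩ Set.Ioi s = Set.Iic (a + s) \ Set.Iic s := by
    ext x
    simp only [Set.mem_inter_iff, Set.mem_preimage, Set.mem_Iic, Set.mem_Ioi, Set.mem_sdiff, not_le]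
    constructor <;> rintro ⟨h, h'⟩ <;> exact ⟨by linarith, h'⟩
  have h2 : expMeasure M (Set.Ioi s) = ENNReal.ofReal (Real.exp (-(M * s))) := by
    rw [← Set.compl_Iic, prob_compl_eq_one_sub measurableSet_Iic, expMeasure_Iic hM, if_pos hs,
      ← ENNReal.ofReal_one, ← ENNReal.ofReal_sub _ (by
        simp only [sub_nonneg, Real.exp_le_one_iff, neg_nonpos]; positivity)]
    congr 1
    ring
  rw [h1, h2]
  rcases lt_or_ge a 0 with ha | ha
  · rw [Set.sdiff_eq_empty.2 (Set.Iic_subset_Iic.2 (by linarith)), expMeasure_Iic hM a,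
      if_neg (by linarith)]
    simp
  · rw [measure_sdiff (Set.Iic_subset_Iic.2 (by linarith)) measurableSet_Iic.nullMeasurableSet
      (measure_ne_top _ _), expMeasure_Iic hM, expMeasure_Iic hM, expMeasure_Iic hM, if_pos hs,
      if_pos ha, if_pos (by linarith), ← ENNReal.ofReal_sub _ (by
        simp only [sub_nonneg, Real.exp_le_one_iff, neg_nonpos]; positivity),
      ← ENNReal.ofReal_mul (Real.exp_pos _).le]
    congr 1
    rw [mul_sub, ← Real.exp_add]
    ring_nf

/-- The law of one mark, with an arbitrary law `τ` of range and uniform variable. -/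
noncomputable def expMark (M : ℝ) (τ : Measure (ℕ × ℝ)) : Measure Mark := (expMeasure M).prod τ

theorem map_sub_restrict_expMark {M : ℝ} (hM : 0 < M) (τ : Measure (ℕ × ℝ))
    [IsProbabilityMeasure τ] {s : ℝ} (hs : 0 ≤ s) :
    ((expMark M τ).restrict {a | s < a.1}).map (fun a : Mark => (a.1 - s, a.2)) =
      (expMark M τ {a | s < a.1}) • expMark M τ := by
  have := isProbabilityMeasure_expMeasure hM
  have h1 : {a : Mark | s < a.1} = Set.Ioi s ×ˢ Set.univ := by
    ext
    simp
  rw [h1, expMark, ← Measure.prod_restrict, Measure.prod_prod, measure_univ, mul_one,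
    Measure.restrict_univ]
  have : (fun a : Mark => (a.1 - s, a.2)) = Prod.map (fun x => x - s) id := rfl
  rw [this, ← Measure.map_prod_map _ _ (by fun_prop) measurable_id, Measure.map_id,
    map_sub_restrict_expMeasure hM hs, Measure.prod_smul_left]

section OneSite

variable {M : ℝ} {τ : Measure (ℕ × ℝ)} [IsProbabilityMeasure τ] [IsProbabilityMeasure (expMark M τ)]

/-- On the event of exactly `n` epochs up to `s`, the later marks are independent of the earlier
ones and have the original law. Induction on `n`: fixing the first mark `a` removes one epoch and
replaces `s` by `s - a.1`, so `s` and `A` must vary. The case `n = 0` is memorylessness of the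
waiting time in progress at `s`. -/
theorem measure_seqTake_inter_seqDrop (hM : 0 < M) (D : Mark) {s : ℝ} (hs : 0 ≤ s) (n : ℕ)
    {A B : Set (ℕ → Mark)} (hA : MeasurableSet A) (hB : MeasurableSet B) :
    (Measure.infinitePi fun _ : ℕ => expMark M τ)
        (countEvent s n ∩ (seqTake D n ⁻¹' A ∩ seqDrop s n ⁻¹' B)) =
      (Measure.infinitePi fun _ : ℕ => expMark M τ) (countEvent s n ∩ seqTake D n ⁻¹' A) *
        (Measure.infinitePi fun _ : ℕ => expMark M τ) B := by
  set ρ := expMark M τ with hρ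
  set μ := Measure.infinitePi fun _ : ℕ => ρ with hμ
  have hsets : ∀ s n, MeasurableSet (countEvent s n ∩ (seqTake D n ⁻¹' A ∩ seqDrop s n ⁻¹' B)) :=
    fun s n => (measurableSet_countEvent s n).inter
      ((measurable_seqTake D n hA).inter (measurable_seqDrop s n hB))
  have hsets' : ∀ s n, MeasurableSet (countEvent s n ∩ seqTake D n ⁻¹' A) :=
    fun s n => (measurableSet_countEvent s n).inter (measurable_seqTake D n hA)
  induction n generalizing s A with
  | zero =>
    have htake : ∀ m, seqTake D 0 m = fun _ => D := fun m => by ext1 k; simp [seqTake]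
    by_cases hD : (fun _ => D) ∈ A
    · have e1 : countEvent s 0 ∩ (seqTake D 0 ⁻¹' A ∩ seqDrop s 0 ⁻¹' B) =
          countEvent s 0 ∩ seqDrop s 0 ⁻¹' B := by
        ext m
        simp [htake, hD]
      have e2 : countEvent s 0 ∩ seqTake D 0 ⁻¹' A = countEvent s 0 := by
        ext m
        simp [htake, hD]
      rw [e1, e2]
      have hE : MeasurableSet {a : Mark | s < a.1} := measurableSet_lt measurable_const measurable_fst
      have f1 : μ (countEvent s 0) = ρ {a | s < a.1} := by
        rw [hμ, ← map_seqCons, Measure.map_apply measurable_seqCons (measurableSet_countEvent s 0)]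
        have : (fun p : Mark × (ℕ → Mark) => seqCons p.1 p.2) ⁻¹' countEvent s 0 =
            {a : Mark | s < a.1} ×ˢ Set.univ := by
          ext p
          simp [countEvent, seqEpoch_seqCons_zero]
        rw [this, Measure.prod_prod, measure_univ, mul_one]
      rw [f1]
      have f2 : (fun p : Mark × (ℕ → Mark) => seqCons p.1 p.2) ⁻¹'
          (countEvent s 0 ∩ seqDrop s 0 ⁻¹' B) =
          (Prod.map (fun a : Mark => ((a.1 - s, a.2) : Mark)) id ⁻¹'
            ((fun p : Mark × (ℕ → Mark) => seqCons p.1 p.2) ⁻¹' B)) ∩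
            ({a : Mark | s < a.1} ×ˢ Set.univ) := by
        ext ⟨a, m⟩
        have : seqDrop s 0 (seqCons a m) = seqCons ((a.1 - s, a.2) : Mark) m := by
          ext1 k
          rcases k with _ | k
          · simp [seqDrop, seqEpoch_seqCons_zero, seqCons]
          · simp [seqDrop, seqCons]
        simp [countEvent, seqEpoch_seqCons_zero, this, and_comm]
      have hB' := measurable_seqCons hB
      have hm : Measurable (Prod.map (fun a : Mark => ((a.1 - s, a.2) : Mark))
          (id : (ℕ → Mark) → (ℕ → Mark))) := by fun_prop
      conv_lhs => rw [hμ, ← map_seqCons, Measure.map_apply measurable_seqCons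
        ((measurableSet_countEvent s 0).inter (measurable_seqDrop s 0 hB)), f2,
        ← Measure.restrict_apply (hm hB'), ← Measure.prod_restrict, Measure.restrict_univ,
        ← Measure.map_apply hm hB', ← Measure.map_prod_map _ _ (by fun_prop) measurable_id,
        Measure.map_id, map_sub_restrict_expMark hM τ hs, Measure.prod_smul_left,
        Measure.smul_apply, smul_eq_mul, ← Measure.map_apply measurable_seqCons hB, map_seqCons]
    · have e1 : countEvent s 0 ∩ (seqTake D 0 ⁻¹' A ∩ seqDrop s 0 ⁻¹' B) = ∅ := by
        ext m
        simp [htake, hD]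
      have e2 : countEvent s 0 ∩ seqTake D 0 ⁻¹' A = ∅ := by
        ext m
        simp [htake, hD]
      rw [e1, e2]
      simp
  | succ n ih =>
    have key : ∀ C : Set (ℕ → Mark), MeasurableSet C →
        μ C = ∫⁻ a, μ (seqCons a ⁻¹' C) ∂ρ := by
      intro C hC
      conv_lhs => rw [hμ, ← map_seqCons, Measure.map_apply measurable_seqCons hC,
        Measure.prod_apply (measurable_seqCons hC)]
      rfl
    rw [key _ (hsets s (n + 1)), key _ (hsets' s (n + 1)), ← lintegral_mul_const]
    · refine lintegral_congr fun a => ?_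
      by_cases ha : a.1 ≤ s
      · have hcons : Measurable (seqCons a) := measurable_seqCons.comp measurable_prodMk_left
        have h1 : seqCons a ⁻¹' (countEvent s (n + 1) ∩
            (seqTake D (n + 1) ⁻¹' A ∩ seqDrop s (n + 1) ⁻¹' B)) =
            countEvent (s - a.1) n ∩ (seqTake D n ⁻¹' (seqCons a ⁻¹' A) ∩
              seqDrop (s - a.1) n ⁻¹' B) := by
          ext m
          simp [seqCons_mem_countEvent_succ, ha, seqTake_seqCons, seqDrop_seqCons]
        have h2 : seqCons a ⁻¹' (countEvent s (n + 1) ∩ seqTake D (n + 1) ⁻¹' A) =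
            countEvent (s - a.1) n ∩ seqTake D n ⁻¹' (seqCons a ⁻¹' A) := by
          ext m
          simp [seqCons_mem_countEvent_succ, ha, seqTake_seqCons]
        rw [h1, h2]
        exact ih (sub_nonneg.2 ha) (hcons hA)
          (fun s n => (measurableSet_countEvent s n).inter
            ((measurable_seqTake D n (hcons hA)).inter (measurable_seqDrop s n hB)))
          (fun s n => (measurableSet_countEvent s n).inter (measurable_seqTake D n (hcons hA)))
      · have h1 : seqCons a ⁻¹' (countEvent s (n + 1) ∩
            (seqTake D (n + 1) ⁻¹' A ∩ seqDrop s (n + 1) ⁻¹' B)) = ∅ := by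
          ext m
          simp [seqCons_mem_countEvent_succ, ha]
        have h2 : seqCons a ⁻¹' (countEvent s (n + 1) ∩ seqTake D (n + 1) ⁻¹' A) = ∅ := by
          ext m
          simp [seqCons_mem_countEvent_succ, ha]
        rw [h1, h2]
        simp
    · exact measurable_measure_prodMk_left (measurable_seqCons (hsets' s (n + 1)))

end OneSite

theorem measurable_nat_sInf {Ω : Type*} [MeasurableSpace Ω] {p : ℕ → Ω → Prop}
    (hp : ∀ n, MeasurableSet {ω | p n ω}) : Measurable fun ω => sInf {n | p n ω} := by
  refine measurable_to_countable' fun n => ?_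
  have hA : MeasurableSet {ω | p n ω ∧ ∀ k < n, ¬ p k ω} := by
    have : {ω | p n ω ∧ ∀ k < n, ¬ p k ω} = {ω | p n ω} ∩ ⋂ k : ℕ, ⋂ _ : k < n, {ω | p k ω}ᶜ := by
      ext ω
      simp
    rw [this]
    exact (hp n).inter (.iInter fun k => .iInter fun _ => (hp k).compl)
  -- The infimum of the empty set is `0`, so the value `0` is also taken where no `p k` holds.
  have hB : MeasurableSet {ω | n = 0 ∧ ∀ k, ¬ p k ω} := by
    have : {ω | n = 0 ∧ ∀ k, ¬ p k ω} = {ω | n = 0} ∩ ⋂ k : ℕ, {ω | p k ω}ᶜ := by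
      ext ω
      simp
    rw [this]
    exact (MeasurableSet.const _).inter (.iInter fun k => (hp k).compl)
  convert! hA.union hB using 1
  ext ω
  simp only [Set.mem_preimage, Set.mem_singleton_iff, Set.mem_union, Set.mem_ofPred_eq]
  constructor
  · rintro rfl
    by_cases h : {n | p n ω}.Nonempty
    · exact .inl ⟨Nat.sInf_mem h, fun k hk => Nat.notMem_of_lt_sInf hk⟩
    · rw [Set.not_nonempty_iff_eq_empty] at h
      refine .inr ⟨by simp [h], fun k hk => ?_⟩
      exact (Set.ext_iff.1 h k).1 hk
  · rintro (⟨h1, h2⟩ | ⟨rfl, h⟩)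
    · exact le_antisymm (Nat.sInf_le h1) (not_lt.1 fun h =>
        h2 _ h (Nat.sInf_mem (s := {n | p n ω}) ⟨n, h1⟩))
    · have : {n | p n ω} = ∅ := Set.eq_empty_of_forall_notMem h
      simp [this]

/-- The number of epochs up to time `s`. -/
noncomputable def seqCount (s : ℝ) (m : ℕ → Mark) : ℕ := sInf {n | s < seqEpoch m n}

theorem seqCount_eq {s : ℝ} {n : ℕ} {m : ℕ → Mark} (h : m ∈ countEvent s n) :
    seqCount s m = n :=
  le_antisymm (Nat.sInf_le h.2) (le_csInf ⟨n, h.2⟩ fun k hk => by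
    by_contra hlt
    exact absurd (h.1 k (not_le.1 hlt)) (not_le.2 hk))

theorem mem_countEvent_seqCount {s : ℝ} {m : ℕ → Mark} (h : ∃ n, s < seqEpoch m n) :
    m ∈ countEvent s (seqCount s m) :=
  ⟨fun _ hk => not_lt.1 (Nat.notMem_of_lt_sInf hk), Nat.sInf_mem h⟩

theorem measurable_seqCount (s : ℝ) : Measurable (seqCount s) :=
  measurable_nat_sInf fun n => measurableSet_lt measurable_const (measurable_seqEpoch n)

/-- The mark that stands for epochs after time `s`. -/
noncomputable def lateMark (s : ℝ) : Mark := (s + 1, 0, 0)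

theorem measurable_comp_nat {Ω α : Type*} [MeasurableSpace Ω] [MeasurableSpace α]
    {N : Ω → ℕ} (hN : Measurable N) {f : ℕ → Ω → α} (hf : ∀ n, Measurable (f n)) :
    Measurable fun ω => f (N ω) ω :=
  (measurable_from_prod_countable_right (f := fun p : ℕ × Ω => f p.1 p.2) hf).comp
    (hN.prodMk measurable_id)

/-- The marks of the epochs up to time `s`. -/
noncomputable def seqPast (s : ℝ) (m : ℕ → Mark) : ℕ → Mark :=
  seqTake (lateMark s) (seqCount s m) m

/-- The marks of the epochs after time `s`, time being counted from `s`. -/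
noncomputable def seqShift (s : ℝ) (m : ℕ → Mark) : ℕ → Mark := seqDrop s (seqCount s m) m

theorem measurable_seqPast (s : ℝ) : Measurable (seqPast s) :=
  measurable_comp_nat (measurable_seqCount s) (measurable_seqTake _)

theorem measurable_seqShift (s : ℝ) : Measurable (seqShift s) :=
  measurable_comp_nat (measurable_seqCount s) (measurable_seqDrop s)

theorem expMark_Iic {M : ℝ} {τ : Measure (ℕ × ℝ)} [IsProbabilityMeasure τ] (hM : 0 < M) (s : ℝ) (C : Set (ℕ × ℝ)) :
    expMark M τ {a | a.1 ≤ s ∧ a.2 ∈ C} = expMeasure M (Set.Iic s) * τ C := by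
  have := isProbabilityMeasure_expMeasure hM
  have : {a : Mark | a.1 ≤ s ∧ a.2 ∈ C} = Set.Iic s ×ˢ C := by
    ext
    simp
  rw [this, expMark, Measure.prod_prod]

theorem expMeasure_Iic_le {M : ℝ} (hM : 0 < M) {s : ℝ} (hs : 0 ≤ s) :
    expMeasure M (Set.Iic s) ≤ ENNReal.ofReal (M * s) := by
  rw [expMeasure_Iic hM, if_pos hs]
  refine ENNReal.ofReal_le_ofReal ?_
  have := Real.add_one_le_exp (-(M * s))
  linarith

theorem expMeasure_Iic_lt_one {M : ℝ} (hM : 0 < M) (s : ℝ) : expMeasure M (Set.Iic s) < 1 := by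
  rw [expMeasure_Iic hM, ← ENNReal.ofReal_one, ENNReal.ofReal_lt_ofReal_iff one_pos]
  split_ifs
  · have := Real.exp_pos (-(M * s))
    linarith
  · exact one_pos

section OneSite

variable {M : ℝ} {τ : Measure (ℕ × ℝ)} [IsProbabilityMeasure τ] [IsProbabilityMeasure (expMark M τ)]

theorem ae_waiting_pos (hM : 0 < M) :
    ∀ᵐ m ∂(Measure.infinitePi fun _ : ℕ => expMark M τ), ∀ n, 0 < (m n).1 := by
  rw [ae_all_iff]
  intro n
  have h : ∀ᵐ a ∂(expMark M τ), 0 < a.1 := by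
    rw [ae_iff]
    have := expMark_Iic (τ := τ) hM 0 Set.univ
    simp only [Set.mem_univ, and_true] at this
    simp only [not_lt, this, expMeasure_Iic hM]
    simp
  exact (measurePreserving_eval_infinitePi (fun _ : ℕ => expMark M τ) n).quasiMeasurePreserving.ae h

theorem waiting_le_of_seqEpoch_le {m : ℕ → Mark} (hm : ∀ n, 0 < (m n).1) {n : ℕ} {s : ℝ}
    (h : seqEpoch m n ≤ s) {i : ℕ} (hi : i ≤ n) : (m i).1 ≤ s :=
  (Finset.single_le_sum (f := fun i => (m i).1) (fun i _ => (hm i).le)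
    (Finset.mem_range.2 (Nat.lt_succ_of_le hi))).trans h

/-- Positive waiting times that add up to at most `s` are each at most `s`. This cruder event has a
product probability, geometric in `n`, so the law of the sums themselves is never needed. -/
theorem measure_waiting_le (hM : 0 < M) (s : ℝ) (n : ℕ) {C : Set (ℕ × ℝ)}
    (hC : MeasurableSet C) :
    (Measure.infinitePi fun _ : ℕ => expMark M τ)
        {m | (∀ i ≤ n, (m i).1 ≤ s) ∧ (m n).2 ∈ C} = expMeasure M (Set.Iic s) ^ (n + 1) * τ C := by
  let t : ℕ → Set Mark := fun i => {a | a.1 ≤ s ∧ a.2 ∈ if i = n then C else Set.univ}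
  have ht : ∀ i, MeasurableSet (t i) := fun i => by
    have hC' : MeasurableSet (if i = n then C else Set.univ) := by
      split_ifs
      exacts [hC, .univ]
    exact (measurableSet_le measurable_fst measurable_const).inter (measurable_snd hC')
  have : {m : ℕ → Mark | (∀ i ≤ n, (m i).1 ≤ s) ∧ (m n).2 ∈ C} =
      Set.pi (Finset.range (n + 1)) t := by
    ext m
    simp only [Set.mem_ofPred_eq, Set.mem_pi, Finset.coe_range, Set.mem_Iio, Nat.lt_succ_iff, t]
    constructor
    · rintro ⟨h1, h2⟩ i hi
      refine ⟨h1 i hi, ?_⟩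
      split_ifs with h
      exacts [h ▸ h2, trivial]
    · intro h
      exact ⟨fun i hi => (h i hi).1, by simpa using (h n le_rfl).2⟩
  rw [this, Measure.infinitePi_pi _ (fun i _ => ht i), Finset.prod_range_succ]
  simp only [t, expMark_Iic hM, if_true]
  rw [Finset.prod_congr rfl (g := fun _ => expMeasure M (Set.Iic s)), Finset.prod_const,
    Finset.card_range, pow_succ, mul_assoc]
  intro i hi
  rw [if_neg (by simp at hi; omega), measure_univ, mul_one]

/-- If all epochs stayed below `k`, then all waiting times would be at most `k`; the first `n + 1`
of them are so with probability `p^(n+1)` for some `p < 1`. -/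
theorem ae_exists_lt_seqEpoch (hM : 0 < M) :
    ∀ᵐ m ∂(Measure.infinitePi fun _ : ℕ => expMark M τ), ∀ s, ∃ n, s < seqEpoch m n := by
  have h : ∀ᵐ m ∂(Measure.infinitePi fun _ : ℕ => expMark M τ), ∀ k : ℕ,
      ¬ ∀ n : ℕ, ∀ i ≤ n, (m i).1 ≤ (k : ℝ) := by
    rw [ae_all_iff]
    intro k
    rw [ae_iff]
    simp only [not_not]
    have hlim := (ENNReal.tendsto_pow_atTop_nhds_zero_of_lt_one
      (expMeasure_Iic_lt_one hM k)).comp (tendsto_add_atTop_nat 1)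
    refine le_antisymm (ge_of_tendsto' hlim fun n => ?_) zero_le
    have := measure_waiting_le (τ := τ) hM k n (C := Set.univ) .univ
    simp only [Set.mem_univ, and_true, measure_univ, mul_one] at this
    rw [Function.comp, ← this]
    exact measure_mono fun m hm => hm n
  filter_upwards [h, ae_waiting_pos (τ := τ) hM] with m hm hpos s
  obtain ⟨k, hk⟩ := exists_nat_ge s
  by_contra! hcon
  exact hm k fun n i hi => waiting_le_of_seqEpoch_le hpos ((hcon n).trans hk) hi

/-- Almost surely exactly one count event occurs; sum the fixed-count factorization over the number
of epochs up to `s`. -/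
theorem measure_seqPast_inter_seqShift (hM : 0 < M) {s : ℝ} (hs : 0 ≤ s)
    {A B : Set (ℕ → Mark)} (hA : MeasurableSet A) (hB : MeasurableSet B) :
    (Measure.infinitePi fun _ : ℕ => expMark M τ) (seqPast s ⁻¹' A ∩ seqShift s ⁻¹' B) =
      (Measure.infinitePi fun _ : ℕ => expMark M τ) (seqPast s ⁻¹' A) *
        (Measure.infinitePi fun _ : ℕ => expMark M τ) B := by
  set μ := Measure.infinitePi fun _ : ℕ => expMark M τ
  have hunion : μ (⋃ n, countEvent s n)ᶜ = 0 := by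
    have h := ae_exists_lt_seqEpoch (τ := τ) hM
    rw [← mem_ae_iff]
    filter_upwards [h] with m hm
    exact Set.mem_iUnion.2 ⟨_, mem_countEvent_seqCount (hm s)⟩
  have hdisj : Pairwise fun i j => Disjoint (countEvent s i) (countEvent s j) := by
    intro i j hij
    rw [Set.disjoint_left]
    intro m hi hj
    exact hij (by rw [← seqCount_eq hi, seqCount_eq hj])
  have hsum : ∀ C, MeasurableSet C → μ C = ∑' n, μ (countEvent s n ∩ C) := by
    intro C hC
    have h1 : μ C = μ ((⋃ n, countEvent s n) ∩ C) := by
      refine measure_congr ?_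
      have : ∀ᵐ m ∂μ, m ∈ ⋃ n, countEvent s n := by
        rw [ae_iff]
        exact hunion
      filter_upwards [this] with m hm
      exact propext ⟨fun h => ⟨hm, h⟩, fun h => h.2⟩
    rw [h1, Set.iUnion_inter, measure_iUnion]
    · exact fun i j hij => (hdisj hij).mono Set.inter_subset_left Set.inter_subset_left
    · exact fun n => (measurableSet_countEvent s n).inter hC
  rw [hsum _ ((measurable_seqPast s hA).inter (measurable_seqShift s hB)),
    hsum _ (measurable_seqPast s hA), ← ENNReal.tsum_mul_right]
  refine tsum_congr fun n => ?_
  have e1 : countEvent s n ∩ (seqPast s ⁻¹' A ∩ seqShift s ⁻¹' B) =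
      countEvent s n ∩ (seqTake (lateMark s) n ⁻¹' A ∩ seqDrop s n ⁻¹' B) := by
    ext m
    refine and_congr_right fun hm => ?_
    simp only [Set.mem_inter_iff, Set.mem_preimage, seqPast, seqShift, seqCount_eq hm]
  have e2 : countEvent s n ∩ seqPast s ⁻¹' A = countEvent s n ∩ seqTake (lateMark s) n ⁻¹' A := by
    ext m
    refine and_congr_right fun hm => ?_
    simp only [Set.mem_preimage, seqPast, seqCount_eq hm]
  rw [e1, e2]
  exact measure_seqTake_inter_seqDrop hM (lateMark s) hs n hA hB

theorem map_seqShift (hM : 0 < M) {s : ℝ} (hs : 0 ≤ s) :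
    (Measure.infinitePi fun _ : ℕ => expMark M τ).map (seqShift s) =
      Measure.infinitePi fun _ : ℕ => expMark M τ := by
  ext B hB
  rw [Measure.map_apply (measurable_seqShift s) hB]
  simpa using measure_seqPast_inter_seqShift (τ := τ) hM hs .univ hB

theorem indepFun_seqPast_seqShift (hM : 0 < M) {s : ℝ} (hs : 0 ≤ s) :
    IndepFun (seqPast s) (seqShift s) (Measure.infinitePi fun _ : ℕ => expMark M τ) := by
  rw [indepFun_iff_measure_inter_preimage_eq_mul]
  intro A B hA hB
  rw [measure_seqPast_inter_seqShift hM hs hA hB, ← Measure.map_apply (measurable_seqShift s) hB,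
    map_seqShift hM hs]

end OneSite

/-- Lifts the independence of past and future from one site to the whole lattice. On cylinder sets,
which generate, both sides are finite products over the sites involved. -/
theorem indepFun_infinitePi_pi {ι : Type*} {X Y Z : ι → Type*} [∀ i, MeasurableSpace (X i)]
    [∀ i, MeasurableSpace (Y i)] [∀ i, MeasurableSpace (Z i)] {μ : ∀ i, Measure (X i)}
    [∀ i, IsProbabilityMeasure (μ i)] {p : ∀ i, X i → Y i} {q : ∀ i, X i → Z i}
    (hp : ∀ i, Measurable (p i)) (hq : ∀ i, Measurable (q i))
    (hpq : ∀ i, IndepFun (p i) (q i) (μ i)) :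
    IndepFun (fun x i => p i (x i)) (fun x i => q i (x i)) (Measure.infinitePi μ) := by
  classical
  have hP : Measurable fun (x : ∀ i, X i) i => p i (x i) := by fun_prop
  have hQ : Measurable fun (x : ∀ i, X i) i => q i (x i) := by fun_prop
  rw [IndepFun_iff_Indep]
  have hY : IsPiSystem (squareCylinders fun i => {s : Set (Y i) | MeasurableSet s}) :=
    isPiSystem_squareCylinders (fun i => MeasurableSpace.isPiSystem_measurableSet)
      fun i => MeasurableSet.univ
  have hZ : IsPiSystem (squareCylinders fun i => {s : Set (Z i) | MeasurableSet s}) :=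
    isPiSystem_squareCylinders (fun i => MeasurableSpace.isPiSystem_measurableSet)
      fun i => MeasurableSet.univ
  refine IndepSets.indep hP.comap_le hQ.comap_le (hY.comap fun (x : ∀ i, X i) i => p i (x i))
    (hZ.comap fun (x : ∀ i, X i) i => q i (x i))
    (by rw [← generateFrom_squareCylinders, MeasurableSpace.comap_generateFrom]; rfl)
    (by rw [← generateFrom_squareCylinders, MeasurableSpace.comap_generateFrom]; rfl) ?_
  rw [IndepSets_iff]
  rintro _ _ ⟨_, ⟨I, s, hs, rfl⟩, rfl⟩ ⟨_, ⟨J, t, ht, rfl⟩, rfl⟩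
  simp only [Set.mem_pi, Set.mem_univ, Set.mem_ofPred_eq, true_imp_iff] at hs ht
  let s' : ∀ i, Set (Y i) := fun i => if i ∈ I then s i else Set.univ
  let t' : ∀ i, Set (Z i) := fun i => if i ∈ J then t i else Set.univ
  have hs' : ∀ i, MeasurableSet (s' i) := fun i => by
    simp only [s']
    split_ifs
    exacts [hs i, .univ]
  have ht' : ∀ i, MeasurableSet (t' i) := fun i => by
    simp only [t']
    split_ifs
    exacts [ht i, .univ]
  have e1 : (fun (x : ∀ i, X i) i => p i (x i)) ⁻¹' (Set.pi I s) =
      Set.pi (I ∪ J : Finset ι) fun i => p i ⁻¹' s' i := by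
    ext x
    simp only [Set.mem_preimage, Set.mem_pi, Finset.mem_coe, Finset.mem_union, s']
    constructor
    · intro h i _
      split_ifs with hi
      exacts [h i hi, trivial]
    · intro h i hi
      simpa [hi] using h i (.inl hi)
  have e2 : (fun (x : ∀ i, X i) i => q i (x i)) ⁻¹' (Set.pi J t) =
      Set.pi (I ∪ J : Finset ι) fun i => q i ⁻¹' t' i := by
    ext x
    simp only [Set.mem_preimage, Set.mem_pi, Finset.mem_coe, Finset.mem_union, t']
    constructor
    · intro h i _
      split_ifs with hi
      exacts [h i hi, trivial]
    · intro h i hi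
      simpa [hi] using h i (.inr hi)
  rw [e1, e2, ← Set.pi_inter_distrib, Measure.infinitePi_pi _ fun i _ => (hp i (hs' i)).inter
    (hq i (ht' i)), Measure.infinitePi_pi _ fun i _ => hp i (hs' i),
    Measure.infinitePi_pi _ fun i _ => hq i (ht' i), ← Finset.prod_mul_distrib]
  exact Finset.prod_congr rfl fun i _ => (hpq i).measure_inter_preimage_eq_mul _ _ (hs' i) (ht' i)

/-! ### The Harris system -/

/-- The sequence of marks of one site. -/
def siteMarks {d : ℕ} (ω : Marks d) (x : Site d) : ℕ → Mark := fun n => ω (x, n)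

theorem measurable_siteMarks {d : ℕ} (x : Site d) : Measurable fun ω : Marks d => siteMarks ω x := by
  unfold siteMarks
  fun_prop

theorem measurable_epoch {d : ℕ} (x : Site d) (n : ℕ) :
    Measurable fun ω : Marks d => epoch ω x n := by
  unfold epoch
  fun_prop

theorem measurable_range {d : ℕ} (x : Site d) (n : ℕ) :
    Measurable fun ω : Marks d => range ω x n := by
  unfold range
  fun_prop

theorem measurable_unif {d : ℕ} (x : Site d) (n : ℕ) :
    Measurable fun ω : Marks d => unif ω x n := by
  unfold unif
  fun_prop

/-- The number of epochs at `x` up to time `s`. -/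
noncomputable def count {d : ℕ} (ω : Marks d) (x : Site d) (s : ℝ) : ℕ := sInf {n | s < epoch ω x n}

/-- The number of epochs at `x` before time `s`. -/
noncomputable def countBefore {d : ℕ} (ω : Marks d) (x : Site d) (s : ℝ) : ℕ :=
  sInf {n | s ≤ epoch ω x n}

/-- The marks of all epochs up to time `s`. -/
noncomputable def pastMarks {d : ℕ} (s : ℝ) (ω : Marks d) : Marks d :=
  fun i => seqPast s (siteMarks ω i.1) i.2

/-- The marks of all epochs after time `s`, time being counted from `s`. -/
noncomputable def shiftMarks {d : ℕ} (s : ℝ) (ω : Marks d) : Marks d :=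
  fun i => seqShift s (siteMarks ω i.1) i.2

theorem measurable_pastMarks {d : ℕ} (s : ℝ) : Measurable (pastMarks (d := d) s) :=
  measurable_pi_iff.2 fun i => (measurable_pi_apply i.2).comp
    ((measurable_seqPast s).comp (measurable_siteMarks i.1))

theorem measurable_shiftMarks {d : ℕ} (s : ℝ) : Measurable (shiftMarks (d := d) s) :=
  measurable_pi_iff.2 fun i => (measurable_pi_apply i.2).comp
    ((measurable_seqShift s).comp (measurable_siteMarks i.1))

/-- Waiting times are positive and epochs do not accumulate. -/
structure Regular {d : ℕ} (ω : Marks d) : Prop where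
  pos : ∀ x n, 0 < (ω (x, n)).1
  unbounded : ∀ x s, ∃ n, s < epoch ω x n

namespace Regular

variable {d : ℕ} {ω : Marks d}

theorem epoch_strictMono (h : Regular ω) (x : Site d) : StrictMono (epoch ω x) := by
  refine strictMono_nat_of_lt_succ fun n => ?_
  rw [epoch, epoch, Finset.sum_range_succ _ (n + 1)]
  linarith [h.pos x (n + 1)]

theorem epoch_pos (h : Regular ω) (x : Site d) (n : ℕ) : 0 < epoch ω x n :=
  Finset.sum_pos (fun i _ => h.pos x i) ⟨0, by simp⟩

theorem lt_epoch_iff (h : Regular ω) {x : Site d} {s : ℝ} {n : ℕ} : s < epoch ω x n ↔ count ω x s ≤ n := by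
  constructor
  · intro hn
    exact Nat.sInf_le hn
  · intro hn
    have : s < epoch ω x (count ω x s) := Nat.sInf_mem (h.unbounded x s)
    exact this.trans_le ((h.epoch_strictMono x).monotone hn)

theorem epoch_le_iff (h : Regular ω) {x : Site d} {s : ℝ} {n : ℕ} : epoch ω x n ≤ s ↔ n < count ω x s := by
  rw [← not_lt, h.lt_epoch_iff, not_le]

theorem le_epoch_iff (h : Regular ω) {x : Site d} {s : ℝ} {n : ℕ} : s ≤ epoch ω x n ↔ countBefore ω x s ≤ n := by
  constructor
  · intro hn
    exact Nat.sInf_le hn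
  · intro hn
    have : s ≤ epoch ω x (countBefore ω x s) :=
      Nat.sInf_mem ((h.unbounded x s).imp fun n hn => le_of_lt hn)
    exact this.trans ((h.epoch_strictMono x).monotone hn)

theorem epoch_lt_iff (h : Regular ω) {x : Site d} {s : ℝ} {n : ℕ} : epoch ω x n < s ↔ n < countBefore ω x s := by
  rw [← not_le, h.le_epoch_iff, not_le]

theorem epoch_shiftMarks (s : ℝ) (x : Site d) (n : ℕ) :
    epoch (shiftMarks s ω) x n = epoch ω x (count ω x s + n) - s := by
  induction n with
  | zero =>
    simp only [epoch, zero_add, Finset.range_one, Finset.sum_singleton, add_zero]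
    rfl
  | succ n ih =>
    have h1 : epoch (shiftMarks s ω) x (n + 1) =
        epoch (shiftMarks s ω) x n + (shiftMarks s ω (x, n + 1)).1 := by
      rw [epoch, Finset.sum_range_succ]
      rfl
    have h2 : epoch ω x (count ω x s + (n + 1)) =
        epoch ω x (count ω x s + n) + (ω (x, count ω x s + (n + 1))).1 := by
      rw [epoch, ← add_assoc, Finset.sum_range_succ]
      rfl
    rw [h1, ih, h2]
    have : shiftMarks s ω (x, n + 1) = ω (x, count ω x s + (n + 1)) := rfl
    rw [this]
    ring

theorem range_shiftMarks (s : ℝ) (x : Site d) (n : ℕ) :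
    range (shiftMarks s ω) x n = range ω x (count ω x s + n) := by
  cases n <;> rfl

theorem unif_shiftMarks (s : ℝ) (x : Site d) (n : ℕ) :
    unif (shiftMarks s ω) x n = unif ω x (count ω x s + n) := by
  cases n <;> rfl

theorem pastMarks_of_lt {s : ℝ} {x : Site d} {n : ℕ} (hn : n < count ω x s) :
    pastMarks s ω (x, n) = ω (x, n) := if_pos hn

theorem epoch_pastMarks_of_lt {s : ℝ} {x : Site d} {n : ℕ} (hn : n < count ω x s) :
    epoch (pastMarks s ω) x n = epoch ω x n := by
  refine Finset.sum_congr rfl fun i hi => ?_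
  rw [pastMarks_of_lt]
  simp at hi
  omega

/-- The filler waiting time `s + 1` is positive and bounded away from `0`, so the erased future is
replaced by epochs that still diverge; being larger than `s`, it also keeps them out of `[0, s]`. -/
theorem regular_pastMarks (h : Regular ω) {s : ℝ} (hs : 0 ≤ s) : Regular (pastMarks s ω) := by
  have hpos : ∀ x n, 0 < (pastMarks s ω (x, n)).1 := by
    intro x n
    by_cases hn : n < count ω x s
    · rw [pastMarks_of_lt hn]
      exact h.pos x n
    · have : pastMarks s ω (x, n) = lateMark s := if_neg hn
      rw [this]
      change 0 < s + 1
      linarith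
  refine ⟨hpos, fun x r => ?_⟩
  obtain ⟨k, hk⟩ := exists_nat_gt r
  refine ⟨count ω x s + k, ?_⟩
  rw [epoch, show count ω x s + k + 1 = count ω x s + (k + 1) by ring,
    Finset.sum_range_add]
  have h1 : ∀ i, (pastMarks s ω (x, count ω x s + i)).1 = s + 1 := fun i => by
    have : pastMarks s ω (x, count ω x s + i) = lateMark s := if_neg (by simp [siteMarks, count,
      seqCount, epoch, seqEpoch])
    rw [this]
    rfl
  simp only [h1, Finset.sum_const, Finset.card_range, nsmul_eq_mul]
  have h2 : 0 ≤ ∑ i ∈ Finset.range (count ω x s), (pastMarks s ω (x, i)).1 :=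
    Finset.sum_nonneg fun i _ => (hpos x i).le
  push_cast
  nlinarith [(Nat.cast_nonneg k : (0 : ℝ) ≤ k)]

theorem lt_epoch_pastMarks (h : Regular ω) {s : ℝ} (hs : 0 ≤ s) {x : Site d} {n : ℕ} (hn : count ω x s ≤ n) :
    s < epoch (pastMarks s ω) x n := by
  have hreg := h.regular_pastMarks hs
  have h1 : (pastMarks s ω (x, n)).1 = s + 1 := by
    have : pastMarks s ω (x, n) = lateMark s := if_neg (not_lt.2 hn)
    rw [this]
    rfl
  rw [epoch, Finset.sum_range_succ, h1]
  have h2 : 0 ≤ ∑ i ∈ Finset.range n, (pastMarks s ω (x, i)).1 :=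
    Finset.sum_nonneg fun i _ => (hreg.pos x i).le
  linarith

end Regular

/-! ### Stationarity of the Harris system and independence of its past and future -/

section Law

variable {d : ℕ} {S : Type*} {c : Site d → S → Config d S → ℝ} (D : KalikowDecomposition c)

/-- The law of the range and the uniform variable of a mark. -/
noncomputable def KalikowDecomposition.rangeUnifLaw (x : Site d) : Measure (ℕ × ℝ) :=
  (D.ν x).toMeasure.prod (volume.restrict (Set.Icc (0 : ℝ) 1))

instance KalikowDecomposition.isProbabilityMeasure_rangeUnifLaw (x : Site d) :
    IsProbabilityMeasure (D.rangeUnifLaw x) := by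
  have h2 : IsProbabilityMeasure (volume.restrict (Set.Icc (0 : ℝ) 1)) := ⟨by simp⟩
  unfold KalikowDecomposition.rangeUnifLaw
  infer_instance

theorem KalikowDecomposition.markLaw_eq (x : Site d) :
    D.markLaw x = expMark (D.M x) (D.rangeUnifLaw x) := rfl

instance KalikowDecomposition.isProbabilityMeasure_expMark (x : Site d) :
    IsProbabilityMeasure (expMark (D.M x) (D.rangeUnifLaw x)) :=
  D.isProbabilityMeasure_markLaw x

/-- The law of the marks of one site. -/
noncomputable def KalikowDecomposition.siteLaw (x : Site d) : Measure (ℕ → Mark) :=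
  Measure.infinitePi fun _ : ℕ => expMark (D.M x) (D.rangeUnifLaw x)

instance KalikowDecomposition.isProbabilityMeasure_siteLaw (x : Site d) :
    IsProbabilityMeasure (D.siteLaw x) := by
  unfold KalikowDecomposition.siteLaw
  infer_instance

theorem KalikowDecomposition.map_siteMarks :
    D.harrisMeasure.map siteMarks = Measure.infinitePi D.siteLaw :=
  Measure.infinitePi_map_curry fun (x : Site d) (_ : ℕ) => D.markLaw x

theorem measurable_siteMarks' : Measurable (siteMarks (d := d)) :=
  measurable_pi_iff.2 measurable_siteMarks

theorem KalikowDecomposition.map_siteMarks_apply (x : Site d) :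
    D.harrisMeasure.map (fun ω => siteMarks ω x) = D.siteLaw x := by
  have : (fun ω : Marks d => siteMarks ω x) = (fun m => m x) ∘ siteMarks := rfl
  rw [this, ← Measure.map_map (measurable_pi_apply x) measurable_siteMarks', D.map_siteMarks,
    Measure.infinitePi_map_eval]

theorem KalikowDecomposition.ae_regular : ∀ᵐ ω ∂D.harrisMeasure, Regular ω := by
  have h : ∀ᵐ ω ∂D.harrisMeasure, ∀ x : Site d, (∀ n, 0 < (siteMarks ω x n).1) ∧
      ∀ s, ∃ n, s < seqEpoch (siteMarks ω x) n := by
    rw [ae_all_iff]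
    intro x
    have h1 := (ae_waiting_pos (τ := D.rangeUnifLaw x) (D.M_pos x)).and
      (ae_exists_lt_seqEpoch (τ := D.rangeUnifLaw x) (D.M_pos x))
    have h2 : ∀ᵐ m ∂(D.harrisMeasure.map (fun ω => siteMarks ω x)),
        (∀ n, 0 < (m n).1) ∧ ∀ s, ∃ n, s < seqEpoch m n := by
      rw [D.map_siteMarks_apply]
      exact h1
    exact ae_of_ae_map (measurable_siteMarks x).aemeasurable h2
  filter_upwards [h] with ω hω
  exact ⟨fun x n => (hω x).1 n, fun x s => (hω x).2 s⟩

/-- Configurations of mark sequences and families of marks are the same thing. -/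
theorem KalikowDecomposition.map_uncurry :
    (Measure.infinitePi D.siteLaw).map (fun m (i : Site d × ℕ) => m i.1 i.2) = D.harrisMeasure :=
  Measure.infinitePi_map_curry_symm fun (x : Site d) (_ : ℕ) => D.markLaw x

/-- The sites are independent, and at each of them the shift preserves the law by memorylessness. -/
theorem KalikowDecomposition.map_shiftMarks {s : ℝ} (hs : 0 ≤ s) :
    D.harrisMeasure.map (shiftMarks s) = D.harrisMeasure := by
  have h1 : shiftMarks (d := d) s = (fun m (i : Site d × ℕ) => m i.1 i.2) ∘
      (fun (m : Site d → ℕ → Mark) x => seqShift s (m x)) ∘ siteMarks := rfl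
  have hm : Measurable fun (m : Site d → ℕ → Mark) x => seqShift s (m x) :=
    measurable_pi_iff.2 fun x => (measurable_seqShift s).comp (measurable_pi_apply x)
  rw [h1, ← Measure.map_map (by fun_prop) (hm.comp measurable_siteMarks'),
    ← Measure.map_map hm measurable_siteMarks', D.map_siteMarks,
    Measure.infinitePi_map_pi _ fun _ => measurable_seqShift s]
  conv_rhs => rw [← D.map_uncurry]
  congr 2
  ext1 x
  exact map_seqShift (D.M_pos x) hs

theorem KalikowDecomposition.indepFun_pastMarks_shiftMarks {s : ℝ} (hs : 0 ≤ s) :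
    IndepFun (pastMarks s) (shiftMarks s) D.harrisMeasure := by
  have h := indepFun_infinitePi_pi (μ := D.siteLaw) (fun _ => measurable_seqPast s)
    (fun _ => measurable_seqShift s) (fun x => indepFun_seqPast_seqShift (D.M_pos x) hs)
  rw [← D.map_siteMarks] at h
  have hm : Measurable fun (m : Site d → ℕ → Mark) x => seqShift s (m x) :=
    measurable_pi_iff.2 fun x => (measurable_seqShift s).comp (measurable_pi_apply x)
  have hm' : Measurable fun (m : Site d → ℕ → Mark) x => seqPast s (m x) :=
    measurable_pi_iff.2 fun x => (measurable_seqPast s).comp (measurable_pi_apply x)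
  have hunc : Measurable fun (m : Site d → ℕ → Mark) (i : Site d × ℕ) => m i.1 i.2 := by fun_prop
  have h' : IndepFun ((fun (m : Site d → ℕ → Mark) x => seqPast s (m x)) ∘ siteMarks)
      ((fun (m : Site d → ℕ → Mark) x => seqShift s (m x)) ∘ siteMarks) D.harrisMeasure := by
    rw [indepFun_iff_measure_inter_preimage_eq_mul] at h ⊢
    intro A B hA hB
    have := h A B hA hB
    rwa [Measure.map_apply measurable_siteMarks' ((hm' hA).inter (hm hB)),
      Measure.map_apply measurable_siteMarks' (hm' hA),
      Measure.map_apply measurable_siteMarks' (hm hB)] at this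
  exact h'.comp hunc hunc

end Law

/-! ### Finite islands -/

/-- All islands of the intervals `(k t₀, (k + 1) t₀]` are finite. -/
def FiniteIslands {d : ℕ} (t₀ : ℝ≥0) (ω : Marks d) : Prop :=
  ∀ k : ℕ, ∀ C : (harrisGraph ω (k * t₀) ((k + 1) * t₀)).ConnectedComponent, C.supp.Finite

/-- The largest range used by a sequence of marks up to time `t`. -/
noncomputable def seqRadius (t : ℝ) (m : ℕ → Mark) : ℕ :=
  sInf {j | ∀ n, seqEpoch m n ≤ t → (m n).2.1 ≤ j}

theorem measurable_seqRadius (t : ℝ) : Measurable (seqRadius t) := by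
  refine measurable_nat_sInf fun j => ?_
  have : {m : ℕ → Mark | ∀ n, seqEpoch m n ≤ t → (m n).2.1 ≤ j} =
      ⋂ n : ℕ, {m | seqEpoch m n ≤ t}ᶜ ∪ {m | (m n).2.1 ≤ j} := by
    ext m
    simp [imp_iff_not_or]
  rw [this]
  exact .iInter fun n => ((measurableSet_le (measurable_seqEpoch n) measurable_const).compl).union
    (measurableSet_le (by fun_prop) measurable_const)

/-- A positive radius cannot be the default infimum `0` of the empty set, so it is a genuine least
upper bound of ranges and is attained: otherwise `j - 1` would be a bound as well. -/
theorem exists_of_seqRadius_eq {t : ℝ} {m : ℕ → Mark} {j : ℕ} (hj : j ≠ 0)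
    (h : seqRadius t m = j) : ∃ n, seqEpoch m n ≤ t ∧ (m n).2.1 = j := by
  have hne : {j | ∀ n, seqEpoch m n ≤ t → (m n).2.1 ≤ j}.Nonempty := by
    by_contra hcon
    rw [Set.not_nonempty_iff_eq_empty] at hcon
    rw [seqRadius, hcon, Nat.sInf_empty] at h
    exact hj h.symm
  have h1 : ∀ n, seqEpoch m n ≤ t → (m n).2.1 ≤ j := h ▸ Nat.sInf_mem hne
  by_contra! hcon
  have h2 : seqRadius t m ≤ j - 1 := Nat.sInf_le fun n hn => by
    have := h1 n hn
    have := hcon n hn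
    omega
  omega

theorem Regular.range_le_seqRadius {d : ℕ} {ω : Marks d} (h : Regular ω) {t : ℝ} {x : Site d}
    {n : ℕ} (hn : epoch ω x n ≤ t) : range ω x n ≤ seqRadius t (siteMarks ω x) := by
  have hne : {j | ∀ n, seqEpoch (siteMarks ω x) n ≤ t → (siteMarks ω x n).2.1 ≤ j}.Nonempty := by
    refine ⟨(Finset.range (count ω x t)).sup fun n => range ω x n, fun n hn => ?_⟩
    exact Finset.le_sup (f := fun n => range ω x n) (Finset.mem_range.2 (h.epoch_le_iff.1 hn))
  exact Nat.sInf_mem hne n hn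

theorem harrisGraph_shiftMarks {d : ℕ} {ω : Marks d} (h : Regular ω) (s t : ℝ≥0) :
    harrisGraph (shiftMarks s ω) 0 t = harrisGraph ω s (s + t) := by
  have key : ∀ x y : Site d, (∃ n, epoch (shiftMarks s ω) x n ∈ Set.Ioc ((0 : ℝ≥0) : ℝ) t ∧
      y ∈ ball x (range (shiftMarks s ω) x n)) ↔
      ∃ n, epoch ω x n ∈ Set.Ioc (s : ℝ) ((s + t : ℝ≥0) : ℝ) ∧ y ∈ ball x (range ω x n) := by
    intro x y
    simp only [Regular.epoch_shiftMarks, Regular.range_shiftMarks, Set.mem_Ioc, NNReal.coe_zero,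
      NNReal.coe_add]
    constructor
    · rintro ⟨n, ⟨h1, h2⟩, h3⟩
      exact ⟨_, ⟨by linarith, by linarith⟩, h3⟩
    · rintro ⟨n, ⟨h1, h2⟩, h3⟩
      obtain ⟨k, rfl⟩ := Nat.exists_eq_add_of_le (h.lt_epoch_iff.1 h1)
      exact ⟨k, ⟨by linarith, by linarith⟩, h3⟩
  ext x y
  simp only [harrisGraph, key]

/-! ### Comparison of the Harris graph with a Boolean model -/

section Law

variable {d : ℕ} {S : Type*} {c : Site d → S → Config d S → ℝ} (D : KalikowDecomposition c)

theorem KalikowDecomposition.rangeUnifLaw_singleton (x : Site d) (j : ℕ) :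
    D.rangeUnifLaw x {p | p.1 = j} = D.ν x j := by
  have h2 : IsProbabilityMeasure (volume.restrict (Set.Icc (0 : ℝ) 1)) := ⟨by simp⟩
  have : {p : ℕ × ℝ | p.1 = j} = {j} ×ˢ Set.univ := by
    ext
    simp
  rw [this, rangeUnifLaw, Measure.prod_prod, measure_univ, mul_one,
    PMF.toMeasure_apply_singleton _ _ (measurableSet_singleton j)]

/-- Some epoch `n` up to `t` carries the range `j`, which costs at most `(M_x t)^(n+1) ν_x(j)`. For
`M_x t ≤ 1/2` the geometric series adds up to at most `2 M_x t ν_x(j)`: a small multiple of a law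
with finite `d`-th moment. -/
theorem KalikowDecomposition.measure_seqRadius_le (x : Site d) {t : ℝ} (ht : 0 ≤ t) {j : ℕ}
    (hj : j ≠ 0) (hsmall : ENNReal.ofReal (D.M x * t) ≤ 1 / 2) :
    D.harrisMeasure {ω | seqRadius t (siteMarks ω x) = j} ≤
      2 * ENNReal.ofReal (D.M x * t) * D.ν x j := by
  set b := ENNReal.ofReal (D.M x * t)
  have hset : MeasurableSet {m : ℕ → Mark | seqRadius t m = j} :=
    measurable_seqRadius t (measurableSet_singleton j)
  have h1 : D.harrisMeasure {ω | seqRadius t (siteMarks ω x) = j} =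
      D.siteLaw x {m | seqRadius t m = j} := by
    rw [← D.map_siteMarks_apply, Measure.map_apply (measurable_siteMarks x) hset]
    rfl
  have h2 : D.siteLaw x {m | seqRadius t m = j} ≤
      D.siteLaw x (⋃ n, {m | (∀ i ≤ n, (m i).1 ≤ t) ∧ (m n).2 ∈ {p : ℕ × ℝ | p.1 = j}}) := by
    refine measure_mono_ae ?_
    filter_upwards [ae_waiting_pos (τ := D.rangeUnifLaw x) (D.M_pos x)] with m hm hmj
    obtain ⟨n, hn, hn'⟩ := exists_of_seqRadius_eq hj hmj
    exact Set.mem_iUnion.2 ⟨n, fun i hi => waiting_le_of_seqEpoch_le hm hn hi, hn'⟩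
  have hC : MeasurableSet {p : ℕ × ℝ | p.1 = j} := measurable_fst (measurableSet_singleton j)
  rw [h1]
  refine h2.trans ((measure_iUnion_le _).trans ?_)
  calc ∑' n, D.siteLaw x {m | (∀ i ≤ n, (m i).1 ≤ t) ∧ (m n).2 ∈ {p : ℕ × ℝ | p.1 = j}}
      = ∑' n : ℕ, expMeasure (D.M x) (Set.Iic t) ^ (n + 1) * D.ν x j := by
        refine tsum_congr fun n => ?_
        rw [siteLaw, measure_waiting_le (D.M_pos x) t n hC, D.rangeUnifLaw_singleton]
    _ ≤ ∑' n : ℕ, b * (1 / 2) ^ n * D.ν x j := by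
        refine ENNReal.tsum_le_tsum fun n => ?_
        gcongr
        rw [pow_succ']
        gcongr
        · exact expMeasure_Iic_le (D.M_pos x) ht
        · exact (expMeasure_Iic_le (D.M_pos x) ht).trans hsmall
    _ = 2 * b * D.ν x j := by
        rw [ENNReal.tsum_mul_right, ENNReal.tsum_mul_left, ENNReal.tsum_geometric]
        simp [mul_comm]

theorem KalikowDecomposition.iIndepFun_seqRadius (t : ℝ) :
    iIndepFun (fun (x : Site d) ω => seqRadius t (siteMarks ω x)) D.harrisMeasure := by
  have h := iIndepFun_infinitePi (P := D.siteLaw) (X := fun _ => seqRadius t)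
    (fun _ => measurable_seqRadius t)
  have hm : ∀ x : Site d, Measurable fun m : Site d → ℕ → Mark => seqRadius t (m x) := fun x =>
    (measurable_seqRadius t).comp (measurable_pi_apply x)
  rw [iIndepFun_iff_map_fun_eq_infinitePi_map hm, ← D.map_siteMarks,
    Measure.map_map (measurable_pi_iff.2 hm) measurable_siteMarks'] at h
  have hm' : ∀ x : Site d, Measurable fun ω : Marks d => seqRadius t (siteMarks ω x) := fun x =>
    (measurable_seqRadius t).comp (measurable_siteMarks x)
  rw [iIndepFun_iff_map_fun_eq_infinitePi_map hm']
  refine h.trans ?_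
  congr 1
  ext1 x
  rw [Measure.map_map (hm x) measurable_siteMarks']
  rfl

/-- Every edge of the Harris graph lies inside a ball of the Boolean model with radii `seqRadius
t₀`, so its islands lie inside clusters of that model. The two smallness assumptions are those of
the radius estimate and of the scale recursion. -/
theorem KalikowDecomposition.ae_finite_first {s : ℕ → ℝ≥0∞} (hs : ∀ x j, D.ν x j ≤ s j)
    (hsum : ∑' j : ℕ, (j : ℝ≥0∞) ^ d * s j ≠ ⊤) {K : ℝ} (hK : ∀ x, D.M x ≤ K) {t₀ : ℝ≥0}
    (h1 : ENNReal.ofReal (K * t₀) ≤ 1 / 2)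
    (h2 : 25 ^ d * 125 ^ d * (2 * ENNReal.ofReal (K * t₀) *
      (201 ^ d * ∑' j : ℕ, (j : ℝ≥0∞) ^ d * s j)) ≤ 1 / 4) :
    ∀ᵐ ω ∂D.harrisMeasure, ∀ C : (harrisGraph ω 0 t₀).ConnectedComponent, C.supp.Finite := by
  have hle : ∀ x, ENNReal.ofReal (D.M x * t₀) ≤ ENNReal.ofReal (K * t₀) := fun x =>
    ENNReal.ofReal_le_ofReal (mul_le_mul_of_nonneg_right (hK x) t₀.2)
  have h := ae_finite_cluster (P := D.harrisMeasure)
    (R := fun (x : Site d) ω => seqRadius t₀ (siteMarks ω x))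
    (fun x => (measurable_seqRadius _).comp (measurable_siteMarks x)) (D.iIndepFun_seqRadius _)
    (ε := 2 * ENNReal.ofReal (K * t₀)) (s := s) (fun x j hj =>
      (D.measure_seqRadius_le x t₀.2 hj ((hle x).trans h1)).trans (by
        exact mul_le_mul' (mul_le_mul' le_rfl (hle x)) (hs x j))) hsum (by finiteness) h2
  filter_upwards [h, D.ae_regular] with ω hω hreg C
  refine hω _ ?_ C
  rintro y z ⟨-, ⟨n, hn, hz⟩ | ⟨n, hn, hy⟩⟩
  · exact .inl (box_mono y (hreg.range_le_seqRadius hn.2) (ball_subset_box _ _ hz))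
  · exact .inr (box_mono z (hreg.range_le_seqRadius hn.2) (ball_subset_box _ _ hy))

theorem KalikowDecomposition.exists_finiteIslands (hsup : BddAbove (Set.range D.M))
    (hmoment : (∑' r : ℕ, (r : ℝ≥0∞) ^ d * (⨆ x, D.ν x r)) ≠ ⊤) :
    ∃ t₀ : ℝ≥0, 0 < t₀ ∧ ∀ᵐ ω ∂D.harrisMeasure, FiniteIslands t₀ ω := by
  obtain ⟨K, hK⟩ := hsup
  have hK' : ∀ x, D.M x ≤ K := fun x => hK ⟨x, rfl⟩
  set A : ℝ≥0∞ := 25 ^ d * 125 ^ d * (201 ^ d * ∑' r : ℕ, (r : ℝ≥0∞) ^ d * (⨆ x, D.ν x r)) with hA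
  have hAtop : A ≠ ⊤ := by finiteness
  have hlim : Tendsto (fun t : ℝ≥0 => ENNReal.ofReal (K * t)) (𝓝 0) (𝓝 0) := by
    have : Continuous fun t : ℝ≥0 => ENNReal.ofReal (K * t) :=
      ENNReal.continuous_ofReal.comp (by fun_prop)
    simpa using this.tendsto 0
  have hlim2 : Tendsto (fun t : ℝ≥0 => 2 * A * ENNReal.ofReal (K * t)) (𝓝 0) (𝓝 0) := by
    simpa using ENNReal.Tendsto.const_mul hlim (.inr (by finiteness : 2 * A ≠ ⊤))
  have hev : ∀ᶠ t : ℝ≥0 in 𝓝[>] 0, ENNReal.ofReal (K * t) ≤ 1 / 2 ∧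
      2 * A * ENNReal.ofReal (K * t) ≤ 1 / 4 ∧ 0 < t := by
    filter_upwards [nhdsWithin_le_nhds (hlim.eventually_le_const (show (0 : ℝ≥0∞) < 1 / 2 by simp)),
      nhdsWithin_le_nhds (hlim2.eventually_le_const (show (0 : ℝ≥0∞) < 1 / 4 by simp)),
      self_mem_nhdsWithin] with t h1 h2 h3 using ⟨h1, h2, h3⟩
  obtain ⟨t₀, h1, h2, h3⟩ := hev.exists
  refine ⟨t₀, h3, ?_⟩
  have hfirst := D.ae_finite_first (fun x j => le_iSup (fun x => D.ν x j) x) hmoment hK' h1 (by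
    refine le_trans (le_of_eq ?_) h2
    rw [hA]
    ring)
  have hall : ∀ᵐ ω ∂D.harrisMeasure, ∀ k : ℕ,
      ∀ C : (harrisGraph (shiftMarks ((k * t₀ : ℝ≥0) : ℝ) ω) 0 t₀).ConnectedComponent,
        C.supp.Finite := by
    rw [ae_all_iff]
    intro k
    -- The slab number `k` is the first slab of the shifted marks, and these have the same law.
    rw [← D.map_shiftMarks (k * t₀ : ℝ≥0).2] at hfirst
    exact ae_of_ae_map (measurable_shiftMarks _).aemeasurable hfirst
  filter_upwards [hall, D.ae_regular] with ω hω hreg k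
  have := hω k
  rwa [harrisGraph_shiftMarks hreg, ← add_one_mul] at this

end Law

/-! ### Paths driven by the Harris system -/

/-- A realization of the marks in which every epoch is determined by finitely many earlier ones, in
the form of an induction principle. -/
structure Good {d : ℕ} (ω : Marks d) : Prop extends Regular ω where
  induction : ∀ Q : Site d → ℕ → Prop, (∀ x n, (∀ y ∈ ball x (range ω x n), ∀ m,
    epoch ω y m < epoch ω x n → Q y m) → Q x n) → ∀ x n, Q x n

theorem mem_supp_of_mem_ball {d : ℕ} {ω : Marks d} {τ t : ℝ≥0}
    {C : (harrisGraph ω τ t).ConnectedComponent} {x y : Site d} {n : ℕ} (hx : x ∈ C.supp)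
    (hn : epoch ω x n ∈ Set.Ioc (τ : ℝ) t) (hy : y ∈ ball x (range ω x n)) : y ∈ C.supp := by
  by_cases hxy : x = y
  · exact hxy ▸ hx
  · have hadj : (harrisGraph ω τ t).Adj x y := ⟨hxy, .inl ⟨n, hn, hy⟩⟩
    exact C.mem_supp_of_adj_mem_supp hx hadj

/-- Induction over the slabs. Inside a slab an island is finite and has finitely many epochs, so a
failure of `Q` would have an earliest instance there. The earlier epochs in the ball of that
instance lie in the same island, or in previous slabs, hence satisfy `Q`, a contradiction. -/
theorem Regular.good {d : ℕ} {ω : Marks d} (h : Regular ω) {t₀ : ℝ≥0} (ht₀ : 0 < t₀)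
    (hI : FiniteIslands t₀ ω) : Good ω := by
  refine ⟨h, fun Q hQ => ?_⟩
  have key : ∀ k : ℕ, ∀ x n, epoch ω x n ≤ ((k * t₀ : ℝ≥0) : ℝ) → Q x n := by
    intro k
    induction k with
    | zero =>
      intro x n hn
      have := h.epoch_pos x n
      simp at hn
      linarith
    | succ k ih =>
      intro x n hn
      rw [Nat.cast_succ] at hn
      by_contra hQx
      set G := harrisGraph ω (k * t₀) ((k + 1) * t₀)
      set C := G.connectedComponentMk x
      let B : Set (Site d × ℕ) := {p | p.1 ∈ C.supp ∧
        epoch ω p.1 p.2 ≤ (((k + 1) * t₀ : ℝ≥0) : ℝ) ∧ ¬ Q p.1 p.2}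
      have hB : B.Finite := by
        refine ((hI k C).biUnion (t := fun y => (fun m => (y, m)) ''
          (Set.Iio (count ω y (((k + 1) * t₀ : ℝ≥0) : ℝ)))) fun y _ =>
            (Set.finite_Iio _).image _).subset ?_
        rintro ⟨y, m⟩ ⟨hy, hm, -⟩
        simp only [Set.mem_iUnion]
        exact ⟨y, hy, m, h.epoch_le_iff.1 hm, rfl⟩
      obtain ⟨⟨y, m⟩, ⟨hy, hm, hQy⟩, hmin⟩ := Set.exists_min_image B
        (fun p => epoch ω p.1 p.2) hB ⟨(x, n), rfl, hn, hQx⟩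
      refine hQy (hQ y m fun z hz j hj => ?_)
      by_contra hQz
      have hzm : epoch ω y m ∈ Set.Ioc ((k * t₀ : ℝ≥0) : ℝ) (((k + 1) * t₀ : ℝ≥0) : ℝ) :=
        ⟨by
          by_contra hle
          exact hQy (ih y m (not_lt.1 hle)), hm⟩
      have := hmin (z, j) ⟨mem_supp_of_mem_ball hy hzm hz, hj.le.trans hm, hQz⟩
      exact absurd hj (not_lt.2 this)
  intro x n
  obtain ⟨k, hk⟩ := exists_nat_ge (epoch ω x n / t₀)
  refine key k x n ?_
  rw [div_le_iff₀ (by exact_mod_cast ht₀)] at hk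
  exact_mod_cast hk

section Construction

variable {d : ℕ} {S : Type*} (W : Site d → ℕ → Config d S → ℝ → S)

/-- The spin at `x` after the first `n` epochs at `x`, computed by following the dependence on
earlier epochs up to a given depth. -/
noncomputable def spin (η : Config d S) (ω : Marks d) : ℕ → Site d → ℕ → S
  | 0, x, _ => η x
  | _ + 1, x, 0 => η x
  | f + 1, x, n + 1 => W x (range ω x n)
      (fun y => spin η ω f y (countBefore ω y (epoch ω x n))) (unif ω x n)

/-- The spin at `x` after the first `n` epochs at `x`. -/
noncomputable def limitSpin (η : Config d S) (ω : Marks d) (x : Site d) (n : ℕ) : S :=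
  spin W η ω (sInf {f | ∀ g ≥ f, spin W η ω g x n = spin W η ω f x n}) x n

/-- The path driven by the marks `ω` from the initial configuration `η`. -/
noncomputable def harrisPath (η : Config d S) (ω : Marks d) (t : ℝ≥0) : Config d S :=
  fun x => limitSpin W η ω x (count ω x t)

/-- The update rule `W` uses only the spins in the ball of the given range. -/
def IsLocal : Prop := ∀ x r, DependsOn (W x r) (ball x r)

variable {W} {η : Config d S} {ω : Marks d}

theorem spin_zero (f : ℕ) (x : Site d) : spin W η ω f x 0 = η x := by cases f <;> rfl

theorem limitSpin_zero (x : Site d) : limitSpin W η ω x 0 = η x := spin_zero _ x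

theorem limitSpin_eq_of_stable {x : Site d} {n f : ℕ}
    (h : ∀ g ≥ f, spin W η ω g x n = spin W η ω f x n) {g : ℕ} (hg : f ≤ g) :
    spin W η ω g x n = limitSpin W η ω x n := by
  have hmem : sInf {f | ∀ g ≥ f, spin W η ω g x n = spin W η ω f x n} ∈
    {f | ∀ g ≥ f, spin W η ω g x n = spin W η ω f x n} := Nat.sInf_mem ⟨f, h⟩
  exact hmem g ((Nat.sInf_le (s := {f | ∀ g ≥ f, spin W η ω g x n = spin W η ω f x n}) h).trans hg)

/-- The recursion stabilizes: an update reads only finitely many sites, the value at each stabilizes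
at some depth by induction, and one level more than the largest of these depths suffices. -/
theorem exists_limitSpin (hW : IsLocal W) (h : Good ω) (x : Site d) (n : ℕ) :
    ∃ f, ∀ g ≥ f, spin W η ω g x n = limitSpin W η ω x n := by
  rcases n with _ | n
  · exact ⟨0, fun g _ => by rw [spin_zero, limitSpin_zero]⟩
  · refine h.induction (fun x n => ∃ f, ∀ g ≥ f,
      spin W η ω g x (n + 1) = limitSpin W η ω x (n + 1)) (fun x n ih => ?_) x n
    have hchild : ∀ y ∈ ball x (range ω x n), ∃ f, ∀ g ≥ f,
        spin W η ω g y (countBefore ω y (epoch ω x n)) =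
          limitSpin W η ω y (countBefore ω y (epoch ω x n)) := by
      intro y hy
      rcases hm : countBefore ω y (epoch ω x n) with _ | m
      · exact ⟨0, fun g _ => by rw [spin_zero, limitSpin_zero]⟩
      · exact ih y hy m (h.epoch_lt_iff.2 (by omega))
    choose! F hF using hchild
    obtain ⟨N, hN⟩ := ((finite_ball x (range ω x n)).image F).bddAbove
    have hN' : ∀ y ∈ ball x (range ω x n), F y ≤ N := fun y hy => hN ⟨y, hy, rfl⟩
    have hstab : ∀ g ≥ N + 1, spin W η ω g x (n + 1) = spin W η ω (N + 1) x (n + 1) := by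
      intro g hg
      obtain ⟨g, rfl⟩ : ∃ k, g = k + 1 := ⟨g - 1, by omega⟩
      rw [spin, spin]
      refine congrFun (hW x _ fun y hy => ?_) _
      rw [hF y hy g ((hN' y hy).trans (by omega)), hF y hy N (hN' y hy)]
    exact ⟨N + 1, fun g hg => limitSpin_eq_of_stable hstab hg⟩

/-- The recursion without its depth parameter: evaluate at a depth beyond the stabilization of the
spin and of all spins it reads. -/
theorem limitSpin_succ (hW : IsLocal W) (h : Good ω) (x : Site d) (n : ℕ) :
    limitSpin W η ω x (n + 1) = W x (range ω x n)
      (fun y => limitSpin W η ω y (countBefore ω y (epoch ω x n))) (unif ω x n) := by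
  obtain ⟨f, hf⟩ := exists_limitSpin (η := η) hW h x (n + 1)
  choose F hF using fun y => exists_limitSpin (η := η) hW h y (countBefore ω y (epoch ω x n))
  obtain ⟨N, hN⟩ := ((finite_ball x (range ω x n)).image F).bddAbove
  rw [← hf (max f N + 1) (by omega), spin]
  refine congrFun (hW x _ fun y hy => ?_) _
  exact hF y _ ((hN ⟨y, hy, rfl⟩).trans (le_max_right _ _))

theorem count_eq_count {x : Site d} {s t : ℝ} (hst : s ≤ t)
    (hn : ∀ n, epoch ω x n ∉ Set.Ioc s t) : count ω x t = count ω x s := by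
  have : {n | t < epoch ω x n} = {n | s < epoch ω x n} := by
    ext n
    constructor
    · exact fun hlt => lt_of_le_of_lt hst hlt
    · intro hlt
      by_contra hcon
      exact hn n ⟨hlt, not_lt.1 hcon⟩
  unfold count
  rw [this]

theorem Regular.eventually_count_right (h : Regular ω) (x : Site d) (t : ℝ≥0) :
    ∀ᶠ s : ℝ≥0 in 𝓝[≥] t, count ω x s = count ω x t := by
  have hlt : (t : ℝ) < epoch ω x (count ω x t) := h.lt_epoch_iff.2 le_rfl
  have hev : ∀ᶠ s : ℝ≥0 in 𝓝 t, (s : ℝ) < epoch ω x (count ω x t) :=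
    (NNReal.continuous_coe.tendsto t).eventually_lt_const hlt
  filter_upwards [nhdsWithin_le_nhds hev, self_mem_nhdsWithin] with s hs hts
  refine count_eq_count (by exact_mod_cast hts) fun n hn => ?_
  have h1 := h.lt_epoch_iff.1 hn.1
  have h2 := h.lt_epoch_iff.1 hs
  have h3 := h.epoch_le_iff.1 hn.2
  omega

theorem Regular.eventually_count_left (h : Regular ω) (x : Site d) (t : ℝ≥0) :
    ∀ᶠ s : ℝ≥0 in 𝓝[<] t, count ω x s = countBefore ω x t := by
  have hev : ∀ᶠ s : ℝ≥0 in 𝓝 t, ∀ m ∈ Finset.range (countBefore ω x t),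
      epoch ω x m < (s : ℝ) := by
    rw [Filter.eventually_all_finset]
    intro m hm
    exact (NNReal.continuous_coe.tendsto t).eventually_const_lt
      (h.epoch_lt_iff.2 (Finset.mem_range.1 hm))
  filter_upwards [nhdsWithin_le_nhds hev, self_mem_nhdsWithin] with s hs hst
  have hst' : (s : ℝ) < t := by exact_mod_cast hst
  refine le_antisymm ?_ ?_
  · rw [← h.lt_epoch_iff]
    exact hst'.trans_le (h.le_epoch_iff.2 le_rfl)
  · by_contra hlt
    rw [not_le] at hlt
    have h1 := hs _ (Finset.mem_range.2 hlt)
    have h2 := h.lt_epoch_iff.2 (le_refl (count ω x s))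
    linarith

theorem Regular.count_epoch (h : Regular ω) (x : Site d) (n : ℕ) :
    count ω x (epoch ω x n) = n + 1 := by
  refine le_antisymm ?_ ?_
  · rw [← h.lt_epoch_iff]
    exact h.epoch_strictMono x (Nat.lt_succ_self n)
  · exact h.epoch_le_iff.1 le_rfl

theorem Regular.count_zero (h : Regular ω) (x : Site d) : count ω x 0 = 0 :=
  Nat.le_zero.1 (h.lt_epoch_iff.1 (h.epoch_pos x 0))

theorem nhdsLT_neBot_of_pos {t : ℝ≥0} (ht : 0 < t) : (𝓝[<] t).NeBot := nhdsLT_neBot_of_exists_lt ⟨0, ht⟩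

variable [TopologicalSpace S]

/-- Just before `t` exactly the epochs strictly earlier than `t` have been used. So the recursion
through `countBefore` is the update rule applied to the left limit. -/
theorem Regular.tendsto_harrisPath_left (h : Regular ω) (t : ℝ≥0) :
    Tendsto (harrisPath W η ω) (𝓝[<] t)
      (𝓝 fun x => limitSpin W η ω x (countBefore ω x t)) := by
  rw [tendsto_pi_nhds]
  intro x
  refine tendsto_const_nhds.congr' ?_
  filter_upwards [h.eventually_count_left x t] with s hs
  rw [harrisPath, hs]

theorem isHarrisPath_harrisPath [T2Space S] (hW : IsLocal W) (h : Good ω) :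
    IsHarrisPath W ω η (harrisPath W η ω) where
  start := by
    ext x
    rw [harrisPath, NNReal.coe_zero, h.count_zero, limitSpin_zero]
  cadlag t := by
    refine ⟨?_, _, h.tendsto_harrisPath_left t⟩
    change Tendsto _ _ _
    rw [tendsto_pi_nhds]
    intro x
    refine tendsto_const_nhds.congr' ?_
    filter_upwards [h.eventually_count_right x t] with s hs
    rw [harrisPath, harrisPath, hs]
  constant x s t hst hn := by
    rw [harrisPath, harrisPath, count_eq_count (by exact_mod_cast hst) hn]
  update x n t ht l hl := by
    have htpos : 0 < t := by
      have := h.epoch_pos x n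
      rw [← ht] at this
      exact_mod_cast this
    have := nhdsLT_neBot_of_pos htpos
    rw [tendsto_nhds_unique hl (h.tendsto_harrisPath_left t), harrisPath, ht, h.count_epoch,
      limitSpin_succ hW h]

/-- Updates at sites of `U` during `(a, b]` read only sites of `U`, so no disagreement can enter.
Formally, agreement just after each epoch of `U` is proved by the induction principle of `Good`.
With `U` an island this is non-interaction; with `U` the whole lattice it is uniqueness of the path.
-/
theorem Good.eq_of_eq_on [T2Space S] (hW : IsLocal W) (h : Good ω) {η' : Config d S}
    {π π' : ℝ≥0 → Config d S} (hπ : IsHarrisPath W ω η π) (hπ' : IsHarrisPath W ω η' π')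
    {U : Set (Site d)} {a b : ℝ≥0}
    (hU : ∀ x ∈ U, ∀ n, epoch ω x n ∈ Set.Ioc (a : ℝ) b → ball x (range ω x n) ⊆ U)
    (ha : ∀ x ∈ U, π a x = π' a x) {t : ℝ≥0} (ht : t ∈ Set.Icc a b) {x : Site d} (hx : x ∈ U) :
    π t x = π' t x := by
  let Q : Site d → ℕ → Prop := fun x n => x ∈ U → epoch ω x n ∈ Set.Ioc (a : ℝ) b →
    ∀ t : ℝ≥0, (t : ℝ) = epoch ω x n → π t x = π' t x
  -- The spin at time `s` was set at the last epoch in `(a, s]`, whose index is `count ω y s - 1`;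
  -- without such an epoch it is still the spin at time `a`.
  have hlast : ∀ s ∈ Set.Icc a b, ∀ y ∈ U, (∀ m, epoch ω y m ≤ s → Q y m) →
      π s y = π' s y := by
    intro s hs y hy hQ
    by_cases hex : ∃ n, epoch ω y n ∈ Set.Ioc (a : ℝ) s
    · obtain ⟨n, hn1, hn2⟩ := hex
      have hn : n < count ω y s := h.epoch_le_iff.1 hn2
      set m := count ω y s - 1 with hm
      have hms : epoch ω y m ≤ s := h.epoch_le_iff.2 (by omega)
      have ham : (a : ℝ) < epoch ω y m :=
        hn1.trans_le ((h.epoch_strictMono y).monotone (by omega))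
      set e : ℝ≥0 := ⟨epoch ω y m, (h.epoch_pos y m).le⟩ with he
      have hes : e ≤ s := by exact_mod_cast hms
      have hno : ∀ k, epoch ω y k ∉ Set.Ioc (e : ℝ) s := by
        rintro k ⟨hk1, hk2⟩
        have h1 := h.epoch_le_iff.1 hk2
        have h2 := (h.epoch_strictMono y).lt_iff_lt.1 (show epoch ω y m < epoch ω y k from hk1)
        omega
      rw [hπ.constant y e s hes hno, hπ'.constant y e s hes hno]
      exact hQ m hms hy ⟨ham, hms.trans (by exact_mod_cast hs.2)⟩ e rfl
    · push Not at hex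
      rw [hπ.constant y a s hs.1 hex, hπ'.constant y a s hs.1 hex]
      exact ha y hy
  have hall : ∀ x n, Q x n := by
    refine h.induction Q fun x n ih hx hn t ht => ?_
    have htpos : 0 < t := by
      have := h.epoch_pos x n
      rw [← ht] at this
      exact_mod_cast this
    have hne := nhdsLT_neBot_of_pos htpos
    obtain ⟨-, l, hl⟩ := hπ.cadlag t
    obtain ⟨-, l', hl'⟩ := hπ'.cadlag t
    rw [hπ.update x n t ht l hl, hπ'.update x n t ht l' hl']
    refine congrFun (hW x _ fun y hy => ?_) _
    have hat : a < t := by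
      rw [← ht] at hn
      exact_mod_cast hn.1
    have htb : t ≤ b := by
      rw [← ht] at hn
      exact_mod_cast hn.2
    refine tendsto_nhds_unique_of_eventuallyEq ((tendsto_pi_nhds.1 hl) y)
      ((tendsto_pi_nhds.1 hl') y) ?_
    have hev : ∀ᶠ s in 𝓝[<] t, a < s := nhdsWithin_le_nhds (eventually_gt_nhds hat)
    filter_upwards [hev, self_mem_nhdsWithin] with s has hst
    have hst' : (s : ℝ) < t := by exact_mod_cast hst
    refine hlast s ⟨has.le, (le_of_lt hst).trans htb⟩ y (hU x hx n hn hy) fun m hm => ?_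
    exact ih y hy m (by rw [← ht]; exact hm.trans_lt hst')
  exact hlast t ht x hx fun m _ => hall x m

theorem Good.eq_harrisPath [T2Space S] (hW : IsLocal W) (h : Good ω) {π : ℝ≥0 → Config d S}
    (hπ : IsHarrisPath W ω η π) : π = harrisPath W η ω := by
  ext t x
  refine h.eq_of_eq_on hW hπ (isHarrisPath_harrisPath hW h) (U := Set.univ) (a := 0) (b := t)
    (fun _ _ _ _ => Set.subset_univ _) (fun x _ => ?_) ⟨zero_le, le_rfl⟩ (Set.mem_univ x)
  rw [hπ.start, (isHarrisPath_harrisPath hW h).start]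

theorem Regular.isHarrisPath_shift [T2Space S] (h : Regular ω) {π : ℝ≥0 → Config d S}
    (hπ : IsHarrisPath W ω η π) (s : ℝ≥0) :
    IsHarrisPath W (shiftMarks s ω) (π s) (fun t => π (s + t)) where
  start := by rw [add_zero]
  cadlag t := by
    obtain ⟨h1, l, hl⟩ := hπ.cadlag (s + t)
    refine ⟨?_, l, ?_⟩
    · refine ContinuousWithinAt.comp (t := Set.Ici (s + t)) h1 (by fun_prop) ?_
      intro u hu
      exact add_le_add_right hu s
    · refine hl.comp (tendsto_nhdsWithin_iff.2 ⟨?_, ?_⟩)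
      · exact tendsto_nhdsWithin_of_tendsto_nhds ((continuous_const.add continuous_id).tendsto t)
      · filter_upwards [self_mem_nhdsWithin] with u hu
        exact add_lt_add_right hu s
  constant x a b hab hn := by
    refine hπ.constant x (s + a) (s + b) (add_le_add_right hab s) fun n hmem => ?_
    rw [NNReal.coe_add, NNReal.coe_add] at hmem
    have hs : (s : ℝ) < epoch ω x n := by
      have := a.2
      have := hmem.1
      simp only [NNReal.val_eq_coe] at *
      linarith
    obtain ⟨k, rfl⟩ := Nat.exists_eq_add_of_le (h.lt_epoch_iff.1 hs)
    refine hn k ?_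
    rw [Regular.epoch_shiftMarks]
    exact ⟨by linarith [hmem.1], by linarith [hmem.2]⟩
  update x n t ht l hl := by
    rw [Regular.range_shiftMarks, Regular.unif_shiftMarks]
    rw [Regular.epoch_shiftMarks] at ht
    refine hπ.update x _ (s + t) (by rw [NNReal.coe_add]; linarith) l ?_
    have htpos : 0 < t := by
      have : (s : ℝ) < epoch ω x (count ω x s + n) := h.lt_epoch_iff.2 (by omega)
      have : (0 : ℝ) < t := by linarith
      exact_mod_cast this
    have hne := nhdsLT_neBot_of_pos htpos
    obtain ⟨-, l', hl'⟩ := hπ.cadlag (s + t)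
    have hl'' : Tendsto (fun u => π (s + u)) (𝓝[<] t) (𝓝 l') := by
      refine hl'.comp (tendsto_nhdsWithin_iff.2 ⟨?_, ?_⟩)
      · exact tendsto_nhdsWithin_of_tendsto_nhds ((continuous_const.add continuous_id).tendsto t)
      · filter_upwards [self_mem_nhdsWithin] with u hu
        exact add_lt_add_right hu s
    rw [tendsto_nhds_unique hl hl'']
    exact hl'

/-- Flow property: after time `s` the path is driven by the shifted marks from its position at time
`s`, and only one path is. -/
theorem Good.harrisPath_add [T2Space S] (hW : IsLocal W) (h : Good ω) {s : ℝ≥0}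
    (hs : Good (shiftMarks s ω)) (t : ℝ≥0) :
    harrisPath W η ω (s + t) = harrisPath W (harrisPath W η ω s) (shiftMarks s ω) t :=
  congrFun (hs.eq_harrisPath hW (h.isHarrisPath_shift (isHarrisPath_harrisPath hW h) s)) t

end Construction

/-! ### Measurability and dependence on the past -/

section Past

variable {d : ℕ} {S : Type*} {W : Site d → ℕ → Config d S → ℝ → S} {η : Config d S} {ω : Marks d}

theorem Regular.countBefore_pastMarks (h : Regular ω) {s : ℝ} (hs : 0 ≤ s) {y : Site d} {e : ℝ}
    (he : e ≤ s) : countBefore (pastMarks s ω) y e = countBefore ω y e := by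
  have : {n | e ≤ epoch (pastMarks s ω) y n} = {n | e ≤ epoch ω y n} := by
    ext n
    by_cases hn : n < count ω y s
    · simp only [Set.mem_ofPred_eq, Regular.epoch_pastMarks_of_lt hn]
    · have h1 := h.lt_epoch_pastMarks hs (not_lt.1 hn)
      have h2 := h.lt_epoch_iff.2 (not_lt.1 hn)
      simp only [Set.mem_ofPred_eq, (he.trans h1.le), (he.trans h2.le)]
  unfold countBefore
  rw [this]

theorem Regular.count_pastMarks (h : Regular ω) {s : ℝ} (hs : 0 ≤ s) {y : Site d} {e : ℝ}
    (he : e ≤ s) : count (pastMarks s ω) y e = count ω y e := by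
  have : {n | e < epoch (pastMarks s ω) y n} = {n | e < epoch ω y n} := by
    ext n
    by_cases hn : n < count ω y s
    · simp only [Set.mem_ofPred_eq, Regular.epoch_pastMarks_of_lt hn]
    · have h1 := h.lt_epoch_pastMarks hs (not_lt.1 hn)
      have h2 := h.lt_epoch_iff.2 (not_lt.1 hn)
      simp only [Set.mem_ofPred_eq, (he.trans_lt h1), (he.trans_lt h2)]
  unfold count
  rw [this]

theorem Regular.count_mono (h : Regular ω) (x : Site d) {s t : ℝ} (hst : s ≤ t) :
    count ω x s ≤ count ω x t := by
  rw [← h.lt_epoch_iff]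
  exact hst.trans_lt (h.lt_epoch_iff.2 le_rfl)

theorem Regular.countBefore_le_count (h : Regular ω) (x : Site d) {s t : ℝ} (hst : s ≤ t) :
    countBefore ω x s ≤ count ω x t := by
  rw [← h.le_epoch_iff]
  exact (hst.trans_lt (h.lt_epoch_iff.2 le_rfl)).le

/-- Tracing back from an epoch up to `s` meets only earlier epochs, and `pastMarks` retains all of
these. -/
theorem Regular.spin_pastMarks (h : Regular ω) {s : ℝ} (hs : 0 ≤ s) (f : ℕ) {x : Site d} {n : ℕ}
    (hn : n ≤ count ω x s) : spin W η (pastMarks s ω) f x n = spin W η ω f x n := by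
  induction f generalizing x n with
  | zero => rfl
  | succ f ih =>
    rcases n with _ | n
    · rfl
    · have hep := Regular.epoch_pastMarks_of_lt (ω := ω) (Nat.lt_of_succ_le hn)
      have hmk := Regular.pastMarks_of_lt (ω := ω) (Nat.lt_of_succ_le hn)
      have hle : epoch ω x n ≤ s := h.epoch_le_iff.2 hn
      rw [spin, spin, hep, range, unif, hmk]
      congr 1
      ext1 y
      rw [h.countBefore_pastMarks hs hle, ih (h.countBefore_le_count y hle)]

theorem Regular.harrisPath_pastMarks (h : Regular ω) {s u : ℝ≥0} (hu : u ≤ s) :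
    harrisPath W η (pastMarks s ω) u = harrisPath W η ω u := by
  have hu' : (u : ℝ) ≤ s := by exact_mod_cast hu
  ext x
  have := h.count_mono x hu'
  have e := h.count_pastMarks (y := x) s.coe_nonneg hu'
  simp only [harrisPath, limitSpin]
  rw [e]
  simp only [h.spin_pastMarks s.coe_nonneg _ this]

end Past

section Measurability

variable {d : ℕ} {S : Type*} [Countable S] [MeasurableSpace S] [DiscreteMeasurableSpace S]

/-- Joint measurability from separate measurability: through finitely many sites of a countable spin
space only countably many configurations are distinguished. The spin `s₀` fills the other sites, so
the empty spin space is treated apart. -/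
theorem measurable_of_dependsOn {α : Type*} [MeasurableSpace α] {β : Type*} [MeasurableSpace β]
    {F : Config d S → α → β} {Λ : Set (Site d)} (hΛ : Λ.Finite)
    (hF : ∀ σ, Measurable (F σ)) (hdep : DependsOn F Λ) :
    Measurable fun p : Config d S × α => F p.1 p.2 := by
  classical
  rcases isEmpty_or_nonempty S with hS | ⟨⟨s₀⟩⟩
  · have : IsEmpty (Config d S) := ⟨fun σ => hS.elim (σ 0)⟩
    exact measurable_of_empty _
  · have := hΛ.to_subtype
    let ext : (Λ → S) → Config d S := fun ρ y => if h : y ∈ Λ then ρ ⟨y, h⟩ else s₀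
    have h1 : ∀ σ, F σ = F (ext fun y => σ y) := fun σ => hdep fun y hy => by simp [ext, hy]
    have h2 : (fun p : Config d S × α => F p.1 p.2) =
        (fun q : (Λ → S) × α => F (ext q.1) q.2) ∘ fun p => (fun y : Λ => p.1 y, p.2) := by
      ext1 p
      exact congrFun (h1 p.1) p.2
    rw [h2]
    exact (measurable_from_prod_countable_right fun ρ => hF (ext ρ)).comp (by fun_prop)

theorem measurable_countBefore_epoch (x y : Site d) (n : ℕ) :
    Measurable fun ω : Marks d => countBefore ω y (epoch ω x n) :=
  measurable_nat_sInf fun k => measurableSet_le (measurable_epoch x n) (measurable_epoch y k)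

theorem measurable_count (x : Site d) (t : ℝ) : Measurable fun ω : Marks d => count ω x t :=
  measurable_nat_sInf fun k => measurableSet_lt measurable_const (measurable_epoch x k)

variable {W : Site d → ℕ → Config d S → ℝ → S}

theorem measurable_spin (hW : ∀ x r σ, Measurable (W x r σ)) (hloc : IsLocal W) (f : ℕ)
    (x : Site d) (n : ℕ) :
    Measurable fun p : Config d S × Marks d => spin W p.1 p.2 f x n := by
  induction f generalizing x n with
  | zero => exact (measurable_pi_apply x).comp measurable_fst
  | succ f ih =>
    rcases n with _ | n
    · exact (measurable_pi_apply x).comp measurable_fst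
    · refine measurable_comp_nat (N := fun p : Config d S × Marks d => range p.2 x n)
        (f := fun r p => W x r (fun y => spin W p.1 p.2 f y (countBefore p.2 y (epoch p.2 x n)))
          (unif p.2 x n)) ((measurable_range x n).comp measurable_snd) fun r => ?_
      refine (measurable_of_dependsOn (finite_ball x r) (hW x r) (hloc x r)).comp
        (Measurable.prodMk (measurable_pi_iff.2 fun y => ?_)
          ((measurable_unif x n).comp measurable_snd))
      exact measurable_comp_nat (N := fun p : Config d S × Marks d =>
        countBefore p.2 y (epoch p.2 x n)) (f := fun m p => spin W p.1 p.2 f y m)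
        ((measurable_countBefore_epoch x y n).comp measurable_snd) fun m => ih y m

theorem measurable_limitSpin (hW : ∀ x r σ, Measurable (W x r σ)) (hloc : IsLocal W)
    (x : Site d) (n : ℕ) :
    Measurable fun p : Config d S × Marks d => limitSpin W p.1 p.2 x n := by
  refine measurable_comp_nat (N := fun p : Config d S × Marks d =>
    sInf {f | ∀ g ≥ f, spin W p.1 p.2 g x n = spin W p.1 p.2 f x n})
    (f := fun f p => spin W p.1 p.2 f x n) (measurable_nat_sInf fun f => ?_)
    fun f => measurable_spin hW hloc f x n
  have : {p : Config d S × Marks d | ∀ g ≥ f, spin W p.1 p.2 g x n = spin W p.1 p.2 f x n} =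
      ⋂ g : ℕ, ⋂ _ : g ≥ f, {p | spin W p.1 p.2 g x n = spin W p.1 p.2 f x n} := by
    ext p
    simp
  rw [this]
  exact .iInter fun g => .iInter fun _ =>
    measurableSet_eq_fun (measurable_spin hW hloc g x n) (measurable_spin hW hloc f x n)

theorem measurable_harrisPath (hW : ∀ x r σ, Measurable (W x r σ)) (hloc : IsLocal W) (t : ℝ≥0) :
    Measurable fun p : Config d S × Marks d => harrisPath W p.1 p.2 t :=
  measurable_pi_iff.2 fun x => measurable_comp_nat
    (N := fun p : Config d S × Marks d => count p.2 x t)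
    (f := fun n p => limitSpin W p.1 p.2 x n) ((measurable_count x t).comp measurable_snd)
    fun n => measurable_limitSpin hW hloc x n

end Measurability

/-! ### The Markov property of the Harris process -/

theorem history_eq_comap {Ω E : Type*} [MeasurableSpace E] (σ : ℝ≥0 → Ω → E) (s : ℝ≥0) :
    history σ s = MeasurableSpace.comap (fun ω (u : Set.Iic s) => σ u ω) MeasurableSpace.pi := by
  simp only [history, MeasurableSpace.pi, MeasurableSpace.comap_iSup, MeasurableSpace.comap_comp]
  rfl

theorem history_le {Ω E : Type*} [MeasurableSpace Ω] [MeasurableSpace E] {σ : ℝ≥0 → Ω → E}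
    (hσ : ∀ t, Measurable (σ t)) (s : ℝ≥0) : history σ s ≤ ‹MeasurableSpace Ω› :=
  iSup_le fun u => (hσ u).comap_le

theorem KalikowDecomposition.ae_good_shift {d : ℕ} {S : Type*}
    {c : Site d → S → Config d S → ℝ} (D : KalikowDecomposition c)
    (hgood : ∀ᵐ ω ∂D.harrisMeasure, Good ω) (s : ℝ≥0) :
    ∀ᵐ ω ∂D.harrisMeasure, Good (shiftMarks s ω) := by
  rw [← D.map_shiftMarks s.2] at hgood
  exact ae_of_ae_map (measurable_shiftMarks _).aemeasurable hgood

section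

variable {d : ℕ} {S : Type*} [Countable S] [MeasurableSpace S] [DiscreteMeasurableSpace S]
  {c : Site d → S → Config d S → ℝ} {D : KalikowDecomposition c}
  {W : Site d → ℕ → Config d S → ℝ → S}

theorem KalikowDecomposition.IsUpdateRule.measurable_path (hW : D.IsUpdateRule W) (t : ℝ≥0) :
    Measurable fun p : Config d S × Marks d => harrisPath W p.1 p.2 t :=
  measurable_harrisPath hW.measurable hW.dependsOn t

theorem KalikowDecomposition.IsUpdateRule.measurable_path_right (hW : D.IsUpdateRule W)
    (ζ : Config d S) (t : ℝ≥0) : Measurable fun ω : Marks d => harrisPath W ζ ω t :=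
  (hW.measurable_path t).comp measurable_prodMk_left

/-- The transition kernels of the Harris process. -/
noncomputable def KalikowDecomposition.IsUpdateRule.kernel (hW : D.IsUpdateRule W) (t : ℝ≥0) :
    Kernel (Config d S) (Config d S) where
  toFun ζ := D.harrisMeasure.map fun ω => harrisPath W ζ ω t
  measurable' := by
    refine Measure.measurable_of_measurable_coe _ fun A hA => ?_
    simp_rw [Measure.map_apply (hW.measurable_path_right _ t) hA]
    exact measurable_measure_prodMk_left (hW.measurable_path t hA)

theorem KalikowDecomposition.IsUpdateRule.kernel_apply (hW : D.IsUpdateRule W) (t : ℝ≥0)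
    (ζ : Config d S) : hW.kernel t ζ = D.harrisMeasure.map fun ω => harrisPath W ζ ω t := rfl

theorem KalikowDecomposition.IsUpdateRule.isMarkovKernel (hW : D.IsUpdateRule W) (t : ℝ≥0) :
    IsMarkovKernel (hW.kernel t) :=
  ⟨fun ζ => Measure.isProbabilityMeasure_map (hW.measurable_path_right ζ t).aemeasurable⟩

variable [TopologicalSpace S] [T2Space S]

/-- The Markov property in integrated form. By the flow property the configuration at `s + t` is a
function of the configuration at `s`, which the past marks determine, and of the shifted marks.
These are independent and the latter have the original law, so Fubini applies. -/
theorem KalikowDecomposition.IsUpdateRule.measure_past_inter (hW : D.IsUpdateRule W)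
    (hgood : ∀ᵐ ω ∂D.harrisMeasure, Good ω) (η : Config d S) (s t : ℝ≥0) {E : Set (Marks d)}
    (hE : MeasurableSet E) {A : Set (Config d S)} (hA : MeasurableSet A) :
    D.harrisMeasure (pastMarks s ⁻¹' E ∩ {ω | harrisPath W η ω (s + t) ∈ A}) =
      ∫⁻ ω in pastMarks s ⁻¹' E, hW.kernel t (harrisPath W η ω s) A ∂D.harrisMeasure := by
  have hp := measurable_pastMarks (d := d) s
  have hq := measurable_shiftMarks (d := d) s
  have hlaw : D.harrisMeasure.map (fun ω => (pastMarks s ω, shiftMarks s ω)) =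
      (D.harrisMeasure.map (pastMarks s)).prod D.harrisMeasure := by
    rw [(indepFun_iff_map_prod_eq_prod_map_map hp.aemeasurable hq.aemeasurable).1
      (D.indepFun_pastMarks_shiftMarks s.coe_nonneg), D.map_shiftMarks s.coe_nonneg]
  have hF : Measurable fun p : Marks d × Marks d =>
      harrisPath W (harrisPath W η p.1 s) p.2 t :=
    (hW.measurable_path t).comp (((hW.measurable_path_right η s).comp measurable_fst).prodMk
      measurable_snd)
  let G : Set (Marks d × Marks d) :=
    {p | p.1 ∈ E ∧ harrisPath W (harrisPath W η p.1 s) p.2 t ∈ A}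
  have hG : MeasurableSet G := (measurable_fst hE).inter (hF hA)
  have hκ : Measurable fun p : Marks d => hW.kernel t (harrisPath W η p s) A :=
    ((hW.kernel t).measurable_coe hA).comp (hW.measurable_path_right η s)
  calc D.harrisMeasure (pastMarks s ⁻¹' E ∩ {ω | harrisPath W η ω (s + t) ∈ A})
      = D.harrisMeasure ((fun ω => (pastMarks s ω, shiftMarks s ω)) ⁻¹' G) := by
        refine measure_congr ?_
        filter_upwards [hgood, D.ae_good_shift hgood s] with ω hω hωs
        refine propext (and_congr_right fun _ => ?_)
        change harrisPath W η ω (s + t) ∈ A ↔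
          harrisPath W (harrisPath W η (pastMarks s ω) s) (shiftMarks s ω) t ∈ A
        rw [hω.harrisPath_pastMarks le_rfl, hω.harrisPath_add hW.dependsOn hωs t]
    _ = ∫⁻ p, D.harrisMeasure (Prod.mk p ⁻¹' G) ∂(D.harrisMeasure.map (pastMarks s)) := by
        rw [← Measure.map_apply (hp.prodMk hq) hG, hlaw, Measure.prod_apply hG]
    _ = ∫⁻ p, E.indicator (fun p => hW.kernel t (harrisPath W η p s) A) p
          ∂(D.harrisMeasure.map (pastMarks s)) := by
        refine lintegral_congr fun p => ?_
        by_cases hpE : p ∈ E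
        · rw [Set.indicator_of_mem hpE, hW.kernel_apply,
            Measure.map_apply (hW.measurable_path_right _ t) hA]
          congr 1
          ext q
          simp [G, hpE]
        · rw [Set.indicator_of_notMem hpE]
          have : Prod.mk p ⁻¹' G = ∅ := by
            ext q
            simp [G, hpE]
          rw [this, measure_empty]
    _ = ∫⁻ ω in pastMarks s ⁻¹' E, hW.kernel t (harrisPath W η (pastMarks s ω) s) A
          ∂D.harrisMeasure := by
        rw [lintegral_indicator hE, setLIntegral_map hE hκ hp]
    _ = _ := by
        refine lintegral_congr_ae (ae_restrict_of_ae ?_)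
        filter_upwards [hgood] with ω hω
        rw [hω.harrisPath_pastMarks le_rfl]

theorem KalikowDecomposition.IsUpdateRule.isTransitionSemigroup (hW : D.IsUpdateRule W)
    (hgood : ∀ᵐ ω ∂D.harrisMeasure, Good ω) : IsTransitionSemigroup hW.kernel where
  isMarkov := hW.isMarkovKernel
  zero := by
    ext1 ζ
    rw [hW.kernel_apply, Kernel.id_apply]
    have : (fun ω => harrisPath W ζ ω 0) =ᵐ[D.harrisMeasure] fun _ => ζ := by
      filter_upwards [hgood] with ω hω
      exact (isHarrisPath_harrisPath hW.dependsOn hω).start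
    rw [Measure.map_congr this, Measure.map_const, measure_univ, one_smul]
  add s t := by
    ext ζ A hA
    -- Chapman–Kolmogorov is the Markov property without any condition on the past.
    have h := hW.measure_past_inter hgood ζ s t (E := Set.univ) .univ hA
    rw [Set.preimage_univ, Set.univ_inter, Measure.restrict_univ] at h
    rw [hW.kernel_apply, Measure.map_apply (hW.measurable_path_right _ _) hA,
      Kernel.comp_apply' _ _ _ hA, hW.kernel_apply s, lintegral_map
        ((hW.kernel t).measurable_coe hA) (hW.measurable_path_right _ _), ← h]
    rfl

theorem KalikowDecomposition.IsUpdateRule.markov (hW : D.IsUpdateRule W)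
    (hgood : ∀ᵐ ω ∂D.harrisMeasure, Good ω) (η : Config d S) (s t : ℝ≥0) {A : Set (Config d S)}
    (hA : MeasurableSet A) :
    D.harrisMeasure⟦(fun ω => harrisPath W η ω (s + t)) ⁻¹' A |
      history (fun t ω => harrisPath W η ω t) s⟧ =ᵐ[D.harrisMeasure]
        fun ω => (hW.kernel t (harrisPath W η ω s)).real A := by
  have hmeas : ∀ t, Measurable fun ω => harrisPath W η ω t := hW.measurable_path_right η
  have hle := history_le hmeas s
  have := hW.isMarkovKernel t
  have hκ : Measurable fun ξ => (hW.kernel t ξ).real A :=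
    ((hW.kernel t).measurable_coe hA).ennreal_toReal
  have hint : Integrable (fun ω => (hW.kernel t (harrisPath W η ω s)).real A) D.harrisMeasure := by
    refine Integrable.of_bound (hκ.comp (hmeas s)).aestronglyMeasurable 1 (ae_of_all _ fun ω => ?_)
    rw [Real.norm_of_nonneg measureReal_nonneg]
    exact measureReal_le_one
  refine (ae_eq_condExp_of_forall_setIntegral_eq hle ?_ ?_ ?_ ?_).symm
  · exact (integrable_const (1 : ℝ)).indicator (hmeas _ hA)
  · exact fun E _ _ => hint.integrableOn
  · intro E hE _
    rw [history_eq_comap] at hE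
    obtain ⟨B, hB, rfl⟩ := hE
    set Ψ : Marks d → Set.Iic s → Config d S := fun ω u => harrisPath W η ω u with hΨ
    have hΨm : Measurable Ψ := measurable_pi_iff.2 fun u => hmeas u
    -- The path up to `s` is unchanged when the future marks are erased, so an event of the history
    -- is, up to a null set, an event of the past marks.
    have hEae : (Ψ ⁻¹' B : Set (Marks d)) =ᵐ[D.harrisMeasure] pastMarks s ⁻¹' (Ψ ⁻¹' B) := by
      filter_upwards [hgood] with ω hω
      have : Ψ (pastMarks s ω) = Ψ ω := by
        ext1 u
        exact hω.harrisPath_pastMarks u.2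
      refine propext ?_
      change Ψ ω ∈ B ↔ Ψ (pastMarks s ω) ∈ B
      rw [this]
    have h := hW.measure_past_inter hgood η s t (hΨm hB) hA
    rw [setIntegral_congr_set hEae, setIntegral_congr_set hEae,
      integral_indicator (hmeas _ hA), setIntegral_const, smul_eq_mul, mul_one,
      measureReal_restrict_apply (hmeas _ hA), measureReal_def, Set.inter_comm]
    have h' : D.harrisMeasure (pastMarks s ⁻¹' (Ψ ⁻¹' B) ∩
      (fun ω => harrisPath W η ω (s + t)) ⁻¹' A) = _ := h
    rw [h', integral_eq_lintegral_of_nonneg_ae (ae_of_all _ fun _ => measureReal_nonneg)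
      (hκ.comp (hmeas s)).aestronglyMeasurable]
    congr 1
    refine lintegral_congr fun ω => ?_
    rw [measureReal_def, ENNReal.ofReal_toReal (measure_ne_top _ _)]
  · refine StronglyMeasurable.aestronglyMeasurable (Measurable.stronglyMeasurable ?_)
    have h1 : Measurable[history (fun t ω => harrisPath W η ω t) s]
        fun ω => harrisPath W η ω s := by
      refine Measurable.mono (comap_measurable _) ?_ le_rfl
      exact le_iSup (fun u : Set.Iic s => MeasurableSpace.comap
        (fun ω => harrisPath W η ω u) inferInstance) ⟨s, Set.self_mem_Iic⟩
    exact hκ.comp h1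

end

/-! ### The generator in terms of an update rule -/

/-- The mean increment of `f` when the site `x` is updated with range `r`. -/
noncomputable def increment {d : ℕ} {S : Type*} (W : Site d → ℕ → Config d S → ℝ → S)
    (f : Config d S → ℝ) (x : Site d) (r : ℕ) (σ : Config d S) : ℝ :=
  ∫ u in Set.Icc (0 : ℝ) 1, (f (Function.update σ x (W x r σ u)) - f σ)

theorem abs_sub_le_two_mul {a b B : ℝ} (ha : |a| ≤ B) (hb : |b| ≤ B) : |a - b| ≤ 2 * B :=
  (abs_sub _ _).trans (by linarith)

theorem update_eq_of_notMem {d : ℕ} {S : Type*} {f : Config d S → ℝ} {Λ : Set (Site d)}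
    (hf : DependsOn f Λ) {x : Site d} (hx : x ∉ Λ) (σ : Config d S) (s : S) :
    f (Function.update σ x s) = f σ :=
  hf fun y hy => Function.update_of_ne (fun h : y = x => hx (h ▸ hy)) _ _

theorem increment_eq_zero {d : ℕ} {S : Type*} {W : Site d → ℕ → Config d S → ℝ → S}
    {f : Config d S → ℝ} {Λ : Set (Site d)} (hf : DependsOn f Λ) {x : Site d} (hx : x ∉ Λ) (r : ℕ)
    (σ : Config d S) : increment W f x r σ = 0 := by
  simp [increment, update_eq_of_notMem hf hx]

theorem norm_setIntegral_unit_le {g : ℝ → ℝ} {C : ℝ} (hg : ∀ u, |g u| ≤ C) :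
    |∫ u in Set.Icc (0 : ℝ) 1, g u| ≤ C := by
  have := norm_setIntegral_le_of_norm_le_const (μ := volume) (s := Set.Icc (0 : ℝ) 1) (f := g)
    (C := C) (by simp) (fun u _ => hg u)
  simpa using this

theorem abs_increment_le {d : ℕ} {S : Type*} {W : Site d → ℕ → Config d S → ℝ → S}
    {f : Config d S → ℝ} {B : ℝ} (hf : ∀ σ, |f σ| ≤ B) (x : Site d) (r : ℕ) (σ : Config d S) :
    |increment W f x r σ| ≤ 2 * B :=
  norm_setIntegral_unit_le fun _ => abs_sub_le_two_mul (hf _) (hf _)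

theorem PMF.summable_toReal {α : Type*} (p : PMF α) : Summable fun a => (p a).toReal :=
  ENNReal.summable_toReal p.tsum_coe_ne_top

theorem PMF.tsum_toReal {α : Type*} (p : PMF α) : ∑' a, (p a).toReal = 1 := by
  rw [← ENNReal.tsum_toReal_eq p.apply_ne_top, p.tsum_coe, ENNReal.toReal_one]

section

variable {d : ℕ} {S : Type*} [Countable S] [MeasurableSpace S] [DiscreteMeasurableSpace S]
  {c : Site d → S → Config d S → ℝ} {D : KalikowDecomposition c}
  {W : Site d → ℕ → Config d S → ℝ → S}

theorem KalikowDecomposition.IsUpdateRule.increment_eq (hW : D.IsUpdateRule W)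
    {f : Config d S → ℝ} {B : ℝ} (hf : ∀ σ, |f σ| ≤ B) (x : Site d) (r : ℕ) (σ : Config d S) :
    increment W f x r σ = ∑' s, (D.p x r σ s).toReal * (f (Function.update σ x s) - f σ) := by
  have hm : Measurable fun s => f (Function.update σ x s) - f σ := .of_discrete
  have h1 : increment W f x r σ =
      ∫ s, (f (Function.update σ x s) - f σ) ∂((volume.restrict (Set.Icc (0 : ℝ) 1)).map
        (W x r σ)) := by
    rw [integral_map (hW.measurable x r σ).aemeasurable hm.aestronglyMeasurable]
    rfl
  rw [h1, hW.law, PMF.integral_eq_tsum]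
  · rfl
  · exact Integrable.of_bound hm.aestronglyMeasurable (2 * B)
      (ae_of_all _ fun s => abs_sub_le_two_mul (hf _) (hf _))

theorem abs_tsum_range_mul_le (ν : PMF ℕ) {g : ℕ → ℝ} {C : ℝ} (hg : ∀ r, |g r| ≤ C) :
    |∑' r, (ν r).toReal * g r| ≤ C := by
  have h := tsum_of_norm_bounded ((PMF.summable_toReal ν).mul_right C).hasSum
    (f := fun r => (ν r).toReal * g r) fun r => by
      rw [norm_mul, Real.norm_of_nonneg ENNReal.toReal_nonneg]
      exact mul_le_mul_of_nonneg_left (hg r) ENNReal.toReal_nonneg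
  rwa [tsum_mul_right, PMF.tsum_toReal, one_mul] at h

theorem KalikowDecomposition.IsUpdateRule.generator_eq_sum (hW : D.IsUpdateRule W)
    {f : Config d S → ℝ} {B : ℝ} (hf : ∀ σ, |f σ| ≤ B) {Λ : Finset (Site d)}
    (hΛ : DependsOn f (Λ : Set (Site d))) (σ : Config d S) :
    generator c f σ = ∑ x ∈ Λ, D.M x * ∑' r, (D.ν x r).toReal * increment W f x r σ := by
  unfold generator
  rw [tsum_eq_sum (s := Λ)]
  · refine Finset.sum_congr rfl fun x _ => ?_
    -- Absolute summability over ranges and spins together, needed to exchange the two sums below.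
    have hsum : Summable fun q : ℕ × S => (D.ν x q.1).toReal * (D.p x q.1 σ q.2).toReal *
        (f (Function.update σ x q.2) - f σ) := by
      have h1 : Summable fun q : ℕ × S => (D.ν x q.1 * D.p x q.1 σ q.2).toReal := by
        refine ENNReal.summable_toReal ?_
        rw [ENNReal.tsum_prod (f := fun r s => D.ν x r * D.p x r σ s)]
        simp_rw [ENNReal.tsum_mul_left, PMF.tsum_coe, mul_one]
        exact (D.ν x).tsum_coe_ne_top
      refine Summable.of_norm_bounded (h1.mul_right (2 * B)) fun q => ?_
      rw [ENNReal.toReal_mul, norm_mul, Real.norm_of_nonneg (by positivity)]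
      exact mul_le_mul_of_nonneg_left (abs_sub_le_two_mul (hf _) (hf _)) (by positivity)
    calc ∑' s, c x s σ * (f (Function.update σ x s) - f σ)
        = ∑' s, D.M x * ∑' r, (D.ν x r).toReal * (D.p x r σ s).toReal *
            (f (Function.update σ x s) - f σ) := by
          refine tsum_congr fun s => ?_
          rw [D.rates, mul_assoc, tsum_mul_right]
      _ = D.M x * ∑' s, ∑' r, (D.ν x r).toReal * (D.p x r σ s).toReal *
            (f (Function.update σ x s) - f σ) := tsum_mul_left
      _ = D.M x * ∑' r, ∑' s, (D.ν x r).toReal * (D.p x r σ s).toReal *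
            (f (Function.update σ x s) - f σ) := by
          congr 1
          exact Summable.tsum_comm (f := fun r s => (D.ν x r).toReal * (D.p x r σ s).toReal *
            (f (Function.update σ x s) - f σ)) hsum
      _ = _ := by
          congr 1
          refine tsum_congr fun r => ?_
          rw [hW.increment_eq hf, ← tsum_mul_left]
          exact tsum_congr fun s => mul_assoc _ _ _
  · intro x hx
    have : ∀ s, f (Function.update σ x s) - f σ = 0 := fun s => by
      rw [update_eq_of_notMem hΛ (by exact_mod_cast hx), sub_self]
    simp [this]

theorem measurable_of_dependsOn_finite {β : Type*} [MeasurableSpace β] {f : Config d S → β}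
    {Λ : Set (Site d)} (hΛ : Λ.Finite) (hf : DependsOn f Λ) : Measurable f := by
  have h := measurable_of_dependsOn (α := Unit) (F := fun σ (_ : Unit) => f σ) hΛ
    (fun σ => measurable_const) (fun σ σ' h => funext fun _ => hf h)
  exact h.comp (g := fun p : Config d S × Unit => f p.1) (f := fun σ => (σ, ()))
    (measurable_id.prodMk measurable_const)

end

/-! ### The generator of the Harris process -/

/-- For `r ≥ 1` use `2 r + 1 ≤ 3 r`. The weight `r^d` does not control the term `r = 0` when `d >
0`, hence the separate assumption on it. -/
theorem tsum_card_box_mul_ne_top {d : ℕ} {s : ℕ → ℝ≥0∞} (hs0 : s 0 ≠ ⊤)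
    (hs : ∑' r : ℕ, (r : ℝ≥0∞) ^ d * s r ≠ ⊤) :
    ∑' r : ℕ, ((2 * r + 1 : ℕ) : ℝ≥0∞) ^ d * s r ≠ ⊤ := by
  have hle : ∑' r : ℕ, ((2 * r + 1 : ℕ) : ℝ≥0∞) ^ d * s r ≤
      s 0 + 3 ^ d * ∑' r : ℕ, (r : ℝ≥0∞) ^ d * s r := by
    have h0 : s 0 = ∑' r : ℕ, if r = 0 then s r else 0 := by simp
    rw [h0, ← ENNReal.tsum_mul_left, ← ENNReal.tsum_add]
    refine ENNReal.tsum_le_tsum fun r => ?_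
    rcases Nat.eq_zero_or_pos r with rfl | hr
    · simp
    · rw [if_neg hr.ne', zero_add, ← mul_assoc, ← mul_pow]
      gcongr
      have : 2 * r + 1 ≤ 3 * r := by omega
      exact_mod_cast this
  exact ne_top_of_le_ne_top (by finiteness) hle

/-! ### Two interacting epochs within a short time -/

section Law

variable {d : ℕ} {S : Type*} {c : Site d → S → Config d S → ℝ} (D : KalikowDecomposition c)

theorem KalikowDecomposition.map_eval (i : Site d × ℕ) :
    D.harrisMeasure.map (fun ω => ω i) = expMark (D.M i.1) (D.rangeUnifLaw i.1) :=
  Measure.infinitePi_map_eval (fun i : Site d × ℕ => D.markLaw i.1) i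

theorem KalikowDecomposition.measure_two_marks {i j : Site d × ℕ} (hij : i ≠ j) (t : ℝ)
    {C : Set (ℕ × ℝ)} (hC : MeasurableSet C) :
    D.harrisMeasure {ω | ((ω i).1 ≤ t ∧ (ω i).2 ∈ C) ∧ (ω j).1 ≤ t} =
      expMeasure (D.M i.1) (Set.Iic t) * D.rangeUnifLaw i.1 C *
        expMeasure (D.M j.1) (Set.Iic t) := by
  have h := Measure.infinitePi_map_eval_prod (P := fun i : Site d × ℕ => D.markLaw i.1) hij
  have hset1 : MeasurableSet {a : Mark | a.1 ≤ t ∧ a.2 ∈ C} :=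
    (measurableSet_le measurable_fst measurable_const).inter (measurable_snd hC)
  have hset2 : MeasurableSet {a : Mark | a.1 ≤ t} := measurableSet_le measurable_fst measurable_const
  have e : {ω : Marks d | ((ω i).1 ≤ t ∧ (ω i).2 ∈ C) ∧ (ω j).1 ≤ t} =
      (fun ω => (ω i, ω j)) ⁻¹' ({a : Mark | a.1 ≤ t ∧ a.2 ∈ C} ×ˢ {a : Mark | a.1 ≤ t}) := rfl
  rw [e, ← Measure.map_apply (by fun_prop) (hset1.prod hset2), harrisMeasure, h,
    Measure.prod_prod, D.markLaw_eq, D.markLaw_eq, expMark_Iic (D.M_pos _)]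
  congr 1
  have := expMark_Iic (τ := D.rangeUnifLaw j.1) (D.M_pos j.1) t Set.univ
  simpa using this

/-- Two epochs near `Λ` up to time `t` that may influence each other. -/
def badEvent (Λ : Finset (Site d)) (t : ℝ) : Set (Marks d) :=
  {ω | ∃ x ∈ Λ, (ω (x, 0)).1 ≤ t ∧ ((ω (x, 1)).1 ≤ t ∨
    ∃ y ≠ x, (y ∈ Λ ∨ y ∈ box x (range ω x 0)) ∧ (ω (y, 0)).1 ≤ t)}

/-- Each way to be bad requires two different waiting times to be at most `t`, which costs `b²` by
independence. If the second site lies in the range of the first update, sum over that range as well;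
the number of candidates is integrable by the moment condition. -/
theorem KalikowDecomposition.measure_badEvent_le (Λ : Finset (Site d)) {t : ℝ} {b : ℝ≥0∞}
    (hb : ∀ x, expMeasure (D.M x) (Set.Iic t) ≤ b) :
    D.harrisMeasure (badEvent Λ t) ≤
      b ^ 2 * ∑ x ∈ Λ, (1 + Λ.card + ∑' r : ℕ, ((2 * r + 1 : ℕ) : ℝ≥0∞) ^ d * D.ν x r) := by
  classical
  have two : ∀ i j : Site d × ℕ, i ≠ j → ∀ C : Set (ℕ × ℝ), MeasurableSet C →
      D.harrisMeasure {ω | ((ω i).1 ≤ t ∧ (ω i).2 ∈ C) ∧ (ω j).1 ≤ t} ≤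
        b ^ 2 * D.rangeUnifLaw i.1 C := by
    intro i j hij C hC
    rw [D.measure_two_marks hij t hC, pow_two, mul_right_comm]
    gcongr
    exacts [hb _, hb _]
  let A1 : Site d → Set (Marks d) := fun x =>
    {ω | ((ω (x, 0)).1 ≤ t ∧ (ω (x, 0)).2 ∈ Set.univ) ∧ (ω (x, 1)).1 ≤ t}
  let A2 : Site d → Site d → Set (Marks d) := fun x y =>
    {ω | x ≠ y ∧ ((ω (x, 0)).1 ≤ t ∧ (ω (x, 0)).2 ∈ Set.univ) ∧ (ω (y, 0)).1 ≤ t}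
  let A3 : Site d → ℕ → Site d → Set (Marks d) := fun x r y =>
    {ω | x ≠ y ∧ ((ω (x, 0)).1 ≤ t ∧ (ω (x, 0)).2 ∈ {p : ℕ × ℝ | p.1 = r}) ∧ (ω (y, 0)).1 ≤ t}
  have hsub : badEvent Λ t ⊆ ⋃ x ∈ Λ, (A1 x ∪ (⋃ y ∈ Λ, A2 x y)) ∪
      ⋃ r : ℕ, ⋃ y ∈ box x r, A3 x r y := by
    rintro ω ⟨x, hx, h0, h1 | ⟨y, hyx, hy | hy, hyt⟩⟩ <;> simp only [Set.mem_iUnion]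
    · exact ⟨x, hx, .inl (.inl ⟨⟨h0, trivial⟩, h1⟩)⟩
    · exact ⟨x, hx, .inl (.inr (Set.mem_biUnion hy ⟨hyx.symm, ⟨h0, trivial⟩, hyt⟩))⟩
    · exact ⟨x, hx, .inr (Set.mem_iUnion.2 ⟨range ω x 0, Set.mem_biUnion hy
        ⟨hyx.symm, ⟨h0, rfl⟩, hyt⟩⟩)⟩
  have h1 : ∀ x, D.harrisMeasure (A1 x) ≤ b ^ 2 * 1 := fun x => by
    refine (two (x, 0) (x, 1) (by simp) Set.univ .univ).trans ?_
    rw [measure_univ]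
  have h2 : ∀ x y, D.harrisMeasure (A2 x y) ≤ b ^ 2 * 1 := fun x y => by
    by_cases hxy : x = y
    · simp [A2, hxy]
    · refine (measure_mono fun ω h => h.2).trans ((two (x, 0) (y, 0) (by simpa using hxy)
        Set.univ .univ).trans ?_)
      rw [measure_univ]
  have h3 : ∀ x r y, D.harrisMeasure (A3 x r y) ≤ b ^ 2 * D.ν x r := fun x r y => by
    by_cases hxy : x = y
    · simp [A3, hxy]
    · refine (measure_mono fun ω h => h.2).trans ((two (x, 0) (y, 0) (by simpa using hxy) _
        (measurable_fst (measurableSet_singleton r))).trans ?_)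
      rw [← D.rangeUnifLaw_singleton x r]
      rfl
  refine (measure_mono hsub).trans ((measure_biUnion_finset_le _ _).trans ?_)
  rw [Finset.mul_sum]
  refine Finset.sum_le_sum fun x _ => ?_
  rw [mul_add, mul_add]
  refine (measure_union_le _ _).trans (add_le_add ((measure_union_le _ _).trans
    (add_le_add (h1 x) ?_)) ?_)
  · refine (measure_biUnion_finset_le _ _).trans ((Finset.sum_le_sum fun y _ => h2 x y).trans ?_)
    rw [Finset.sum_const, nsmul_eq_mul, mul_one, mul_comm]
  · refine (measure_iUnion_le _).trans ?_
    rw [← ENNReal.tsum_mul_left]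
    refine ENNReal.tsum_le_tsum fun r => (measure_biUnion_finset_le _ _).trans
      ((Finset.sum_le_sum fun y _ => h3 x r y).trans ?_)
    rw [Finset.sum_const, nsmul_eq_mul, card_box]
    push_cast
    exact le_of_eq (by ring)

end Law

/-! ### First-order expansion of the Harris semigroup -/

section

variable {d : ℕ} {S : Type*} {W : Site d → ℕ → Config d S → ℝ → S}

/-- The change of `f` caused by the first epoch at `x`, if it occurs up to time `t`, when all other
spins still have their initial values. -/
noncomputable def firstChange (W : Site d → ℕ → Config d S → ℝ → S) (f : Config d S → ℝ)
    (ζ : Config d S) (x : Site d) (t : ℝ) (ω : Marks d) : ℝ :=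
  (Set.Iic t).indicator 1 (ω (x, 0)).1 *
    (f (Function.update ζ x (W x (ω (x, 0)).2.1 ζ (ω (x, 0)).2.2)) - f ζ)

theorem abs_firstChange_le {f : Config d S → ℝ} {B : ℝ} (hf : ∀ σ, |f σ| ≤ B) (ζ : Config d S)
    (x : Site d) (t : ℝ) (ω : Marks d) : |firstChange W f ζ x t ω| ≤ 2 * B := by
  rw [firstChange, abs_mul]
  have h1 : |(Set.Iic t).indicator (1 : ℝ → ℝ) (ω (x, 0)).1| ≤ 1 := by
    by_cases h : (ω (x, 0)).1 ≤ t <;> simp [Set.indicator, h]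
  calc _ ≤ 1 * (2 * B) := mul_le_mul h1 (abs_sub_le_two_mul (hf _) (hf _)) (abs_nonneg _) one_pos.le
    _ = 2 * B := one_mul _

variable [MeasurableSpace S] {c : Site d → S → Config d S → ℝ} {D : KalikowDecomposition c}

/-- Off the bad event at most one site of `Λ` is updated up to `t`, only once, and no other site it
reads has changed before. So at most one summand is nonzero, and it is computed from the initial
configuration. -/
theorem KalikowDecomposition.IsUpdateRule.apply_harrisPath_eq (hW : D.IsUpdateRule W)
    {f : Config d S → ℝ} {Λ : Finset (Site d)} (hΛ : DependsOn f (Λ : Set (Site d)))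
    (ζ : Config d S) {t : ℝ≥0} {ω : Marks d} (hω : Good ω) (hbad : ω ∉ badEvent Λ t) :
    f (harrisPath W ζ ω t) = f ζ + ∑ x ∈ Λ, firstChange W f ζ x t ω := by
  have hep : ∀ x, epoch ω x 0 = (ω (x, 0)).1 := fun x => by simp [epoch]
  have hnone : ∀ x, ¬ (ω (x, 0)).1 ≤ t → harrisPath W ζ ω t x = ζ x := by
    intro x hx
    have : count ω x t = 0 := Nat.le_zero.1 (hω.lt_epoch_iff.1 (by rw [hep]; exact not_le.1 hx))
    rw [harrisPath, this, limitSpin_zero]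
  have hzero : ∀ x, ¬ (ω (x, 0)).1 ≤ t → firstChange W f ζ x t ω = 0 := fun x hx => by
    simp [firstChange, Set.indicator, hx]
  by_cases hex : ∃ x ∈ Λ, (ω (x, 0)).1 ≤ t
  · obtain ⟨x, hx, hxt⟩ := hex
    have hothers : ∀ y ≠ x, (y ∈ Λ ∨ y ∈ box x (range ω x 0)) → ¬ (ω (y, 0)).1 ≤ t :=
      fun y hyx hy hyt => hbad ⟨x, hx, hxt, .inr ⟨y, hyx, hy, hyt⟩⟩
    rw [Finset.sum_eq_single_of_mem x hx fun y hy hyx => hzero y (hothers y hyx (.inl hy))]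
    have hcount : count ω x t = 1 := by
      refine le_antisymm (hω.lt_epoch_iff.1 ?_) (hω.epoch_le_iff.1 (by rw [hep]; exact hxt))
      by_contra hle
      refine hbad ⟨x, hx, hxt, .inl ?_⟩
      have : epoch ω x 1 = (ω (x, 0)).1 + (ω (x, 1)).1 := by
        simp [epoch, Finset.sum_range_succ]
      have := hω.pos x 0
      linarith
    have hxval : harrisPath W ζ ω t x = W x (range ω x 0) ζ (unif ω x 0) := by
      rw [harrisPath, hcount, limitSpin_succ hW.dependsOn hω]
      refine congrFun (hW.dependsOn x _ fun y hy => ?_) _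
      have : countBefore ω y (epoch ω x 0) = 0 := by
        refine Nat.le_zero.1 (hω.le_epoch_iff.1 ?_)
        by_cases hyx : y = x
        · rw [hyx]
        · have h1 := not_le.1 (hothers y hyx (.inr (ball_subset_box _ _ hy)))
          rw [hep, hep]
          linarith
      rw [this, limitSpin_zero]
    have hupd : f (harrisPath W ζ ω t) =
        f (Function.update ζ x (W x (range ω x 0) ζ (unif ω x 0))) := by
      refine hΛ fun y hy => ?_
      by_cases hyx : y = x
      · rw [hyx, Function.update_self, hxval]
      · rw [Function.update_of_ne hyx, hnone y (hothers y hyx (.inl (by exact_mod_cast hy)))]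
    rw [hupd]
    simp [firstChange, Set.indicator, hxt, range, unif]
  · push Not at hex
    rw [Finset.sum_eq_zero fun x hx => hzero x (not_le.2 (hex x hx)), add_zero]
    exact hΛ fun y hy => hnone y (not_le.2 (hex y (by exact_mod_cast hy)))

theorem KalikowDecomposition.IsUpdateRule.measurable_mark [DiscreteMeasurableSpace S]
    (hW : D.IsUpdateRule W)
    (f : Config d S → ℝ) (ζ : Config d S) (x : Site d) :
    Measurable fun p : ℕ × ℝ => f (Function.update ζ x (W x p.1 ζ p.2)) - f ζ := by
  refine measurable_from_prod_countable_right fun r => ?_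
  have h : Measurable fun s : S => f (Function.update ζ x s) - f ζ := .of_discrete
  exact h.comp (hW.measurable x r ζ)

end

section

variable {d : ℕ} {S : Type*} [MeasurableSpace S] [DiscreteMeasurableSpace S]
  {c : Site d → S → Config d S → ℝ} {D : KalikowDecomposition c}
  {W : Site d → ℕ → Config d S → ℝ → S}

theorem KalikowDecomposition.IsUpdateRule.measurable_firstChange (hW : D.IsUpdateRule W)
    (f : Config d S → ℝ) (ζ : Config d S) (x : Site d) (t : ℝ) :
    Measurable (firstChange W f ζ x t) := by
  have h1 : Measurable ((Set.Iic t).indicator (1 : ℝ → ℝ)) :=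
    measurable_one.indicator measurableSet_Iic
  exact (h1.comp (by fun_prop)).mul ((hW.measurable_mark f ζ x).comp (by fun_prop))

theorem KalikowDecomposition.IsUpdateRule.integral_firstChange (hW : D.IsUpdateRule W)
    {f : Config d S → ℝ} {B : ℝ} (hf : ∀ σ, |f σ| ≤ B) (ζ : Config d S) (x : Site d) (t : ℝ) :
    ∫ ω, firstChange W f ζ x t ω ∂D.harrisMeasure =
      (expMeasure (D.M x)).real (Set.Iic t) *
        ∑' r, (D.ν x r).toReal * increment W f x r ζ := by
  have hexp := isProbabilityMeasure_expMeasure (D.M_pos x)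
  have hprob : IsProbabilityMeasure (volume.restrict (Set.Icc (0 : ℝ) 1)) := ⟨by simp⟩
  set g : ℕ × ℝ → ℝ := fun p => f (Function.update ζ x (W x p.1 ζ p.2)) - f ζ with hg
  have hgm : Measurable g := hW.measurable_mark f ζ x
  have hi : Measurable ((Set.Iic t).indicator (1 : ℝ → ℝ)) :=
    measurable_one.indicator measurableSet_Iic
  have h1 : ∫ ω, firstChange W f ζ x t ω ∂D.harrisMeasure =
      ∫ a, (Set.Iic t).indicator (1 : ℝ → ℝ) a.1 * g a.2
        ∂(D.harrisMeasure.map fun ω => ω (x, 0)) := by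
    have hev : Measurable fun ω : Marks d => ω (x, 0) := measurable_pi_apply _
    have hme : AEStronglyMeasurable (fun a : Mark => (Set.Iic t).indicator (1 : ℝ → ℝ) a.1 * g a.2)
        (D.harrisMeasure.map fun ω => ω (x, 0)) :=
      ((hi.comp measurable_fst).mul (hgm.comp measurable_snd)).aestronglyMeasurable
    exact (integral_map hev.aemeasurable hme).symm
  rw [h1, D.map_eval, expMark, integral_prod_mul, integral_indicator_one measurableSet_Iic]
  congr 1
  have hint : Integrable g (D.rangeUnifLaw x) :=
    Integrable.of_bound hgm.aestronglyMeasurable (2 * B)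
      (ae_of_all _ fun p => abs_sub_le_two_mul (hf _) (hf _))
  rw [rangeUnifLaw] at hint ⊢
  rw [integral_prod _ hint, PMF.integral_eq_tsum _ _ hint.integral_prod_left]
  rfl

variable [Countable S]

theorem KalikowDecomposition.IsUpdateRule.abs_integral_kernel_sub_le (hW : D.IsUpdateRule W)
    (hgood : ∀ᵐ ω ∂D.harrisMeasure, Good ω) {f : Config d S → ℝ} {B : ℝ} (hf : ∀ σ, |f σ| ≤ B)
    {Λ : Finset (Site d)} (hΛ : DependsOn f (Λ : Set (Site d))) (ζ : Config d S) (t : ℝ≥0) :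
    |∫ ξ, f ξ ∂(hW.kernel t ζ) - (f ζ + ∑ x ∈ Λ, (expMeasure (D.M x)).real (Set.Iic (t : ℝ)) *
        ∑' r, (D.ν x r).toReal * increment W f x r ζ)| ≤
      (2 * B + Λ.card * (2 * B)) * D.harrisMeasure.real (badEvent Λ t) := by
  have hB : 0 ≤ B := (abs_nonneg _).trans (hf ζ)
  have hfm : Measurable f := measurable_of_dependsOn_finite Λ.finite_toSet hΛ
  have hp := hW.measurable_path_right ζ t
  have hint1 : Integrable (fun ω => f (harrisPath W ζ ω t)) D.harrisMeasure :=
    Integrable.of_bound (hfm.comp hp).aestronglyMeasurable B (ae_of_all _ fun ω => hf _)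
  have hint2 : ∀ x, Integrable (firstChange W f ζ x t) D.harrisMeasure := fun x =>
    Integrable.of_bound (hW.measurable_firstChange f ζ x t).aestronglyMeasurable (2 * B)
      (ae_of_all _ fun ω => abs_firstChange_le hf ζ x t ω)
  have hint3 : Integrable (fun ω => f ζ + ∑ x ∈ Λ, firstChange W f ζ x t ω) D.harrisMeasure :=
    (integrable_const _).add (integrable_finsetSum _ fun x _ => hint2 x)
  have e1 : ∫ ξ, f ξ ∂(hW.kernel t ζ) = ∫ ω, f (harrisPath W ζ ω t) ∂D.harrisMeasure := by
    rw [hW.kernel_apply, integral_map hp.aemeasurable hfm.aestronglyMeasurable]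
  have e2 : f ζ + ∑ x ∈ Λ, (expMeasure (D.M x)).real (Set.Iic (t : ℝ)) *
      ∑' r, (D.ν x r).toReal * increment W f x r ζ =
      ∫ ω, (f ζ + ∑ x ∈ Λ, firstChange W f ζ x t ω) ∂D.harrisMeasure := by
    rw [integral_add (integrable_const _) (integrable_finsetSum _ fun x _ => hint2 x),
      integral_finsetSum _ fun x _ => hint2 x]
    simp [hW.integral_firstChange hf]
  -- A measurable hull of the bad event has the same measure, so measurability of the event itself
  -- is not needed.
  have hbadm : MeasurableSet (toMeasurable D.harrisMeasure (badEvent Λ (t : ℝ))) :=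
    measurableSet_toMeasurable _ _
  rw [e1, e2, ← integral_sub hint1 hint3]
  refine (abs_integral_le_integral_abs).trans ?_
  have hle : ∀ᵐ ω ∂D.harrisMeasure,
      |f (harrisPath W ζ ω t) - (f ζ + ∑ x ∈ Λ, firstChange W f ζ x t ω)| ≤
      (toMeasurable D.harrisMeasure (badEvent Λ (t : ℝ))).indicator
        (fun _ => 2 * B + Λ.card * (2 * B)) ω := by
    filter_upwards [hgood] with ω hω
    by_cases hbad : ω ∈ badEvent Λ (t : ℝ)
    · rw [Set.indicator_of_mem (subset_toMeasurable _ _ hbad), ← sub_sub]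
      refine (abs_sub _ _).trans (add_le_add (abs_sub_le_two_mul (hf _) (hf _)) ?_)
      refine (Finset.abs_sum_le_sum_abs _ _).trans ?_
      refine (Finset.sum_le_sum fun x _ => abs_firstChange_le hf ζ x t ω).trans ?_
      rw [Finset.sum_const, nsmul_eq_mul]
    · rw [hW.apply_harrisPath_eq hΛ ζ hω hbad, sub_self, abs_zero]
      exact Set.indicator_nonneg (fun _ _ => by positivity) _
  refine (integral_mono_ae (hint1.sub hint3).abs
    ((integrable_const _).indicator hbadm) hle).trans ?_
  rw [integral_indicator_const _ hbadm, smul_eq_mul, mul_comm, measureReal_def,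
    measure_toMeasurable]
  rfl

theorem one_sub_exp_sub_abs_le {y : ℝ} (hy : 0 ≤ y) : |1 - Real.exp (-y) - y| ≤ y ^ 2 := by
  have h1 := Real.add_one_le_exp (-y)
  rw [abs_le]
  refine ⟨?_, by nlinarith [sq_nonneg y]⟩
  rcases le_or_gt y 1 with h | h
  · have := Real.abs_exp_sub_one_sub_id_le (x := -y) (by rwa [abs_neg, abs_of_nonneg hy])
    rw [abs_le] at this
    nlinarith [this.2]
  · have : Real.exp (-y) ≤ 1 := Real.exp_le_one_iff.2 (by linarith)
    nlinarith

/-- The deviation of `κ_t f` from `f + t L f` is at most `R t²` with `R` independent of the initial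
configuration; divide by `t`. -/
theorem KalikowDecomposition.IsUpdateRule.hasGenerator (hW : D.IsUpdateRule W)
    (hgood : ∀ᵐ ω ∂D.harrisMeasure, Good ω) (hsup : BddAbove (Set.range D.M))
    (hmoment : (∑' r : ℕ, (r : ℝ≥0∞) ^ d * (⨆ x, D.ν x r)) ≠ ⊤) :
    HasGenerator hW.kernel c := by
  rintro f ⟨⟨Λ, hΛ⟩, B, hf⟩
  obtain ⟨K, hK⟩ := hsup
  have hK' : ∀ x, D.M x ≤ K := fun x => hK ⟨x, rfl⟩
  have hK0 : 0 ≤ K := (D.M_pos 0).le.trans (hK' 0)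
  rcases isEmpty_or_nonempty (Config d S) with hemp | ⟨⟨ζ₀⟩⟩
  · rw [Metric.tendstoUniformly_iff]
    exact fun ε _ => .of_forall fun t ζ => hemp.elim ζ
  have hB : 0 ≤ B := (abs_nonneg _).trans (hf ζ₀)
  set A : ℝ≥0∞ := ∑ x ∈ Λ, (1 + Λ.card + ∑' r : ℕ, ((2 * r + 1 : ℕ) : ℝ≥0∞) ^ d * D.ν x r) with hA
  have hAtop : A ≠ ⊤ := by
    refine ENNReal.sum_ne_top.2 fun x _ => ?_
    have h1 : ∑' r : ℕ, ((2 * r + 1 : ℕ) : ℝ≥0∞) ^ d * D.ν x r ≠ ⊤ :=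
      ne_top_of_le_ne_top (tsum_card_box_mul_ne_top
        (ne_top_of_le_ne_top ENNReal.one_ne_top (iSup_le fun x => (D.ν x).coe_le_one 0)) hmoment)
        (ENNReal.tsum_le_tsum fun r => by
          gcongr
          exact le_iSup (fun x => D.ν x r) x)
    finiteness
  -- The first summand pays for the bad event, the second for replacing `1 - exp (-M_x t)` by `M_x
  -- t` at each site of `Λ`.
  set R : ℝ := (2 * B + Λ.card * (2 * B)) * (K ^ 2 * A.toReal) + Λ.card * (K ^ 2 * (2 * B)) with hR
  have hmain : ∀ (t : ℝ≥0) (ζ : Config d S),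
      |∫ ξ, f ξ ∂(hW.kernel t ζ) - f ζ - t * generator c f ζ| ≤ R * t ^ 2 := by
    intro t ζ
    have h1 := hW.abs_integral_kernel_sub_le hgood hf hΛ ζ t
    have h2 : D.harrisMeasure.real (badEvent Λ (t : ℝ)) ≤ K ^ 2 * A.toReal * t ^ 2 := by
      have := D.measure_badEvent_le Λ (t := t) (b := ENNReal.ofReal (K * t)) fun x =>
        (expMeasure_Iic_le (D.M_pos x) t.coe_nonneg).trans
          (ENNReal.ofReal_le_ofReal (mul_le_mul_of_nonneg_right (hK' x) t.coe_nonneg))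
      have h3 := ENNReal.toReal_mono (by finiteness) this
      rw [ENNReal.toReal_mul, ENNReal.toReal_pow, ENNReal.toReal_ofReal (by positivity)] at h3
      refine h3.trans (le_of_eq ?_)
      ring
    have h4 : |∑ x ∈ Λ, (expMeasure (D.M x)).real (Set.Iic (t : ℝ)) *
        (∑' r, (D.ν x r).toReal * increment W f x r ζ) - t * generator c f ζ| ≤
        Λ.card * (K ^ 2 * (2 * B)) * t ^ 2 := by
      rw [hW.generator_eq_sum hf hΛ, Finset.mul_sum, ← Finset.sum_sub_distrib]
      refine (Finset.abs_sum_le_sum_abs _ _).trans ?_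
      rw [mul_assoc, ← nsmul_eq_mul]
      refine Finset.sum_le_card_nsmul _ _ _ fun x _ => ?_
      have h5 : (expMeasure (D.M x)).real (Set.Iic (t : ℝ)) = 1 - Real.exp (-(D.M x * t)) := by
        rw [measureReal_def, expMeasure_Iic (D.M_pos x), if_pos t.coe_nonneg,
          ENNReal.toReal_ofReal]
        have : Real.exp (-(D.M x * t)) ≤ 1 := Real.exp_le_one_iff.2 (by
          have := mul_nonneg (D.M_pos x).le t.coe_nonneg
          linarith)
        linarith
      rw [h5, show ∀ a J : ℝ, a * J - t * (D.M x * J) = (a - D.M x * t) * J by intros; ring, abs_mul]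
      have h6 := one_sub_exp_sub_abs_le (mul_nonneg (D.M_pos x).le t.coe_nonneg)
      have h7 := abs_tsum_range_mul_le (D.ν x) fun r => abs_increment_le (W := W) hf x r ζ
      calc _ ≤ (D.M x * t) ^ 2 * (2 * B) := mul_le_mul h6 h7 (abs_nonneg _) (sq_nonneg _)
        _ ≤ (K * t) ^ 2 * (2 * B) := by
            have := (D.M_pos x).le
            have := hK' x
            gcongr
        _ = _ := by ring
    have h8 : (2 * B + Λ.card * (2 * B)) * D.harrisMeasure.real (badEvent Λ (t : ℝ)) ≤
        (2 * B + Λ.card * (2 * B)) * (K ^ 2 * A.toReal * t ^ 2) := by gcongr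
    have h9 := (abs_sub_le_iff.1 (h1.trans h8))
    have h10 := (abs_sub_le_iff.1 h4)
    rw [abs_le, hR]
    constructor <;> nlinarith [h9.1, h9.2, h10.1, h10.2]
  have hR0 : 0 ≤ R := by positivity
  rw [Metric.tendstoUniformly_iff]
  intro ε hε
  have hev : ∀ᶠ t : ℝ≥0 in 𝓝[>] 0, R * (t : ℝ) < ε := by
    refine nhdsWithin_le_nhds ?_
    have : Tendsto (fun t : ℝ≥0 => R * (t : ℝ)) (𝓝 0) (𝓝 0) := by
      have h : Continuous fun t : ℝ≥0 => R * (t : ℝ) := by fun_prop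
      simpa using h.tendsto 0
    exact this.eventually_lt_const hε
  filter_upwards [hev, self_mem_nhdsWithin] with t ht ht0 ζ
  have ht0' : (0 : ℝ) < t := by exact_mod_cast ht0
  rw [dist_comm, Real.dist_eq]
  refine lt_of_le_of_lt ?_ ht
  have : (∫ ξ, f ξ ∂(hW.kernel t ζ) - f ζ) / (t : ℝ) - generator c f ζ =
      (∫ ξ, f ξ ∂(hW.kernel t ζ) - f ζ - t * generator c f ζ) / t := by
    field_simp
  rw [this, abs_div, abs_of_pos ht0', div_le_iff₀ ht0']
  refine (hmain t ζ).trans (le_of_eq ?_)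
  ring

end

/-! ### Short-time expansion of a semigroup -/

section Kernel

variable {E : Type*} [MeasurableSpace E] {κ : ℝ≥0 → Kernel E E}

theorem integrable_kernel (hκ : IsTransitionSemigroup κ) {g : E → ℝ} (hg : Measurable g) {B : ℝ}
    (hB : ∀ ζ, |g ζ| ≤ B) (t : ℝ≥0) (ζ : E) : Integrable g (κ t ζ) := by
  have := hκ.isMarkov t
  exact Integrable.of_bound hg.aestronglyMeasurable B (ae_of_all _ hB)

theorem abs_integral_kernel_sub_le (hκ : IsTransitionSemigroup κ) {g g' : E → ℝ}
    (hg : Measurable g) {B : ℝ} (hB : ∀ ζ, |g ζ| ≤ B) (hg' : Measurable g') {B' : ℝ}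
    (hB' : ∀ ζ, |g' ζ| ≤ B') {e : ℝ} (he : ∀ ζ, |g ζ - g' ζ| ≤ e) (t : ℝ≥0) (ζ : E) :
    |∫ ξ, g ξ ∂(κ t ζ) - ∫ ξ, g' ξ ∂(κ t ζ)| ≤ e := by
  have := hκ.isMarkov t
  rw [← integral_sub (integrable_kernel hκ hg hB t ζ) (integrable_kernel hκ hg' hB' t ζ)]
  have := norm_integral_le_of_norm_le_const (μ := κ t ζ) (f := fun ξ => g ξ - g' ξ) (C := e)
    (ae_of_all _ he)
  simpa using this

theorem abs_integral_kernel_le (hκ : IsTransitionSemigroup κ) {g : E → ℝ} {B : ℝ}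
    (hB : ∀ ζ, |g ζ| ≤ B) (t : ℝ≥0) (ζ : E) : |∫ ξ, g ξ ∂(κ t ζ)| ≤ B := by
  have := hκ.isMarkov t
  have := norm_integral_le_of_norm_le_const (μ := κ t ζ) (f := g) (C := B) (ae_of_all _ hB)
  simpa using this

theorem measurable_integral_kernel {g : E → ℝ} (hg : Measurable g) (t : ℝ≥0) :
    Measurable fun ζ => ∫ ξ, g ξ ∂(κ t ζ) :=
  (StronglyMeasurable.integral_kernel hg.stronglyMeasurable).measurable

theorem integral_kernel_add (hκ : IsTransitionSemigroup κ) {g : E → ℝ} (hg : Measurable g) {B : ℝ}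
    (hB : ∀ ζ, |g ζ| ≤ B) (s t : ℝ≥0) (ζ : E) :
    ∫ ξ, g ξ ∂(κ (s + t) ζ) = ∫ ξ, ∫ ξ', g ξ' ∂(κ t ξ) ∂(κ s ζ) := by
  have h := integrable_kernel hκ hg hB (s + t) ζ
  rw [hκ.add] at h ⊢
  exact Kernel.integral_comp h

theorem integral_kernel_zero (hκ : IsTransitionSemigroup κ) {g : E → ℝ} (hg : Measurable g)
    (ζ : E) : ∫ ξ, g ξ ∂(κ 0 ζ) = g ζ := by
  rw [hκ.zero, Kernel.id_apply, integral_dirac' _ _ hg.stronglyMeasurable]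

end Kernel

theorem isBoundedCylinder_zero {d : ℕ} {S : Type*} : IsBoundedCylinder (0 : Config d S → ℝ) :=
  ⟨⟨∅, fun _ _ _ => rfl⟩, 0, fun _ => by simp⟩

section Expansion

variable {d : ℕ} {S : Type*} [Countable S] [MeasurableSpace S] [DiscreteMeasurableSpace S]
  {c : Site d → S → Config d S → ℝ} {κ : ℝ≥0 → Kernel (Config d S) (Config d S)}

theorem IsBoundedCylinder.measurable {g : Config d S → ℝ} (hg : IsBoundedCylinder g) :
    Measurable g := by
  obtain ⟨⟨Λ, hΛ⟩, -⟩ := hg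
  exact measurable_of_dependsOn_finite Λ.finite_toSet hΛ

theorem exists_nat_div_lt (t : ℝ≥0) {δ : ℝ≥0} (hδ : 0 < δ) :
    ∃ N : ℕ, 0 < N ∧ ∀ n ≥ N, t / n < δ := by
  obtain ⟨N, hN⟩ := exists_nat_gt (t / δ)
  refine ⟨N + 1, by omega, fun n hn => ?_⟩
  have hn' : t / δ < n := hN.trans (by exact_mod_cast hn)
  have hn0 : (0 : ℝ≥0) < n := lt_of_le_of_lt zero_le hn'
  rw [div_lt_iff₀ hδ] at hn'
  rw [div_lt_iff₀ hn0, mul_comm]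
  exact hn'

/-- If `H` approximates the generator on `g` and moves little, then `g + t H` approximates the
semigroup on `g` up to time `t`. -/
theorem abs_integral_sub_sub_le_of_generator (hκ : IsTransitionSemigroup κ) (hgen : HasGenerator κ c)
    {g H : Config d S → ℝ} (hg : IsBoundedCylinder g) (hH : IsBoundedCylinder H) {ε e : ℝ}
    (hε : ∀ ζ, |generator c g ζ - H ζ| ≤ ε) {t : ℝ≥0}
    (he : ∀ s ≤ t, ∀ ζ, |∫ ξ, H ξ ∂(κ s ζ) - H ζ| ≤ e) (ζ : Config d S) :
    |∫ ξ, g ξ ∂(κ t ζ) - g ζ - t * H ζ| ≤ t * (ε + e) := by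
  have hgm := hg.measurable
  have hHm := hH.measurable
  obtain ⟨B, hB⟩ := hg.2
  obtain ⟨B', hB'⟩ := hH.2
  rcases eq_or_ne t 0 with rfl | ht
  · rw [integral_kernel_zero hκ hgm]
    simp
  have ht0 : (0 : ℝ) < t := by exact_mod_cast pos_iff_ne_zero.2 ht
  -- The generator is given as a limit without a rate. Cutting `[0, t]` into `N` steps so short that
  -- the limit is reached up to `δ / t` gives a bound at the fixed time `t`, and `δ` is arbitrary.
  refine le_of_forall_pos_le_add fun δ hδ => ?_
  have hδ' : 0 < δ / t := div_pos hδ ht0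
  have hunif := Metric.tendstoUniformly_iff.1 (hgen g hg) (δ / t) hδ'
  rw [eventually_nhdsWithin_iff, Metric.eventually_nhds_iff] at hunif
  obtain ⟨η, hη, hη'⟩ := hunif
  obtain ⟨N, hN, hNh⟩ := exists_nat_div_lt t (δ := ⟨η, hη.le⟩) hη
  set h : ℝ≥0 := t / N with hh
  have hN0 : (N : ℝ≥0) ≠ 0 := by exact_mod_cast hN.ne'
  have hh0 : 0 < h := div_pos (pos_iff_ne_zero.2 ht) (pos_iff_ne_zero.2 hN0)
  have hh0' : (0 : ℝ) < h := by exact_mod_cast hh0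
  have hNt : (N : ℝ≥0) * h = t := mul_div_cancel₀ t hN0
  have hstep : ∀ ζ, |∫ ξ, g ξ ∂(κ h ζ) - (g ζ + h * H ζ)| ≤ h * (ε + δ / t) := by
    intro ζ
    have h1 := hη' (y := h) (by
      rw [NNReal.dist_eq, NNReal.coe_zero, sub_zero, abs_of_pos hh0']
      exact_mod_cast hNh N le_rfl) hh0 ζ
    rw [Real.dist_eq, abs_sub_comm] at h1
    have h2 : |(∫ ξ, g ξ ∂(κ h ζ) - g ζ) / h - H ζ| ≤ ε + δ / t := by
      calc _ = |((∫ ξ, g ξ ∂(κ h ζ) - g ζ) / h - generator c g ζ) +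
            (generator c g ζ - H ζ)| := by ring_nf
        _ ≤ _ := (abs_add_le _ _).trans (by linarith [hε ζ])
    have h3 : ∫ ξ, g ξ ∂(κ h ζ) - (g ζ + h * H ζ) =
        h * ((∫ ξ, g ξ ∂(κ h ζ) - g ζ) / h - H ζ) := by
      field_simp
      ring
    rw [h3, abs_mul, abs_of_pos hh0']
    exact mul_le_mul_of_nonneg_left h2 hh0'.le
  -- By the semigroup property, apply `κ_{jh}` to the one-step expansion of `κ_h g`; replacing
  -- `κ_{jh} H` by `H` costs `h * e` per step.
  have hiter : ∀ j ≤ N, ∀ ζ, |∫ ξ, g ξ ∂(κ (j * h) ζ) - g ζ - j * h * H ζ| ≤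
      j * h * (ε + δ / t + e) := by
    intro j
    induction j with
    | zero =>
      intro _ ζ
      rw [Nat.cast_zero, zero_mul, integral_kernel_zero hκ hgm]
      simp
    | succ j ih =>
      intro hj ζ
      have hjt : (j : ℝ≥0) * h ≤ t := by
        rw [← hNt]
        gcongr
        omega
      have h1 := ih (by omega) ζ
      have h2 := he _ hjt ζ
      have e1 : ((j + 1 : ℕ) : ℝ≥0) * h = j * h + h := by
        push_cast
        ring
      have hbd : ∀ ζ, |g ζ + h * H ζ| ≤ B + h * B' := fun ζ =>
        (abs_add_le _ _).trans (add_le_add (hB ζ) (by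
          rw [abs_mul, abs_of_pos hh0']
          exact mul_le_mul_of_nonneg_left (hB' ζ) hh0'.le))
      have h3 := abs_integral_kernel_sub_le hκ (measurable_integral_kernel (κ := κ) hgm h)
        (abs_integral_kernel_le hκ hB h) (hgm.add (hHm.const_mul (h : ℝ))) hbd hstep (j * h) ζ
      rw [← integral_kernel_add hκ hgm hB, ← e1] at h3
      simp only [Pi.add_apply] at h3
      rw [integral_add (integrable_kernel hκ hgm hB _ _)
        ((integrable_kernel hκ hHm hB' _ _).const_mul _), integral_const_mul] at h3
      push_cast
      have h4 : |(h : ℝ) * (∫ ξ, H ξ ∂(κ (j * h) ζ)) - h * H ζ| ≤ h * e := by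
        rw [← mul_sub, abs_mul, abs_of_pos hh0']
        exact mul_le_mul_of_nonneg_left h2 hh0'.le
      rw [abs_le] at *
      push_cast at *
      constructor <;> nlinarith [h1.1, h1.2, h3.1, h3.2, h4.1, h4.2]
  have := hiter N le_rfl ζ
  rw [hNt] at this
  have hNt' : (N : ℝ) * h = t := by exact_mod_cast hNt
  rw [hNt'] at this
  refine this.trans (le_of_eq ?_)
  field_simp
  ring

theorem abs_integral_sub_le_of_generator (hκ : IsTransitionSemigroup κ) (hgen : HasGenerator κ c)
    {g : Config d S → ℝ} (hg : IsBoundedCylinder g) {K : ℝ} (hK : ∀ ζ, |generator c g ζ| ≤ K)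
    (t : ℝ≥0) (ζ : Config d S) : |∫ ξ, g ξ ∂(κ t ζ) - g ζ| ≤ t * K := by
  have := abs_integral_sub_sub_le_of_generator hκ hgen hg isBoundedCylinder_zero (ε := K) (e := 0)
    (t := t) (by simpa using hK) (by simp) ζ
  simpa using this

/-- A one-step error of second order. The movement of `H` up to `t` is controlled by applying the
first-order bound to `H`, which is why `H` has to be a cylinder function. -/
theorem abs_integral_sub_sub_le (hκ : IsTransitionSemigroup κ) (hgen : HasGenerator κ c)
    {g H : Config d S → ℝ} (hg : IsBoundedCylinder g) (hH : IsBoundedCylinder H) {ε K : ℝ}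
    (hε : ∀ ζ, |generator c g ζ - H ζ| ≤ ε) (hK : ∀ ζ, |generator c H ζ| ≤ K) (t : ℝ≥0)
    (ζ : Config d S) : |∫ ξ, g ξ ∂(κ t ζ) - g ζ - t * H ζ| ≤ t * (ε + t * K) := by
  have hK0 : 0 ≤ K := (abs_nonneg _).trans (hK ζ)
  refine abs_integral_sub_sub_le_of_generator hκ hgen hg hH hε (fun s hs ζ => ?_) ζ
  refine (abs_integral_sub_le_of_generator hκ hgen hH hK s ζ).trans ?_
  gcongr

end Expansion

/-! ### Oscillations and Euler steps -/

section Oscillation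

variable {d : ℕ} {S : Type*}

/-- `a x` bounds the oscillation of `g` at the site `x`. -/
def OscillationLE (g : Config d S → ℝ) (a : Site d → ℝ) : Prop :=
  ∀ x σ s, |g (Function.update σ x s) - g σ| ≤ a x

variable {c : Site d → S → Config d S → ℝ} {D : KalikowDecomposition c}
  {W : Site d → ℕ → Config d S → ℝ → S} {g : Config d S → ℝ} {a : Site d → ℝ}

theorem OscillationLE.abs_increment_le (hg : OscillationLE g a) (x : Site d) (r : ℕ)
    (σ : Config d S) : |increment W g x r σ| ≤ a x :=
  norm_setIntegral_unit_le fun _ => hg x σ _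

-- Changing the spin at `y` before an update at `x` has two effects: a direct one, bounded by `a y`,
-- and, only if the written spin changes, an indirect one, bounded by `a x`.
open Classical in
theorem OscillationLE.abs_update_update_sub_le (hg : OscillationLE g a) (ha : ∀ x, 0 ≤ a x)
    {x y : Site d} (σ : Config d S) (s w w' : S) :
    |g (Function.update (Function.update σ y s) x w') - g (Function.update σ x w)| ≤
      a y + if w' = w then 0 else a x := by
  rcases eq_or_ne y x with rfl | hyx
  · rw [Function.update_idem]
    split_ifs with h
    · rw [h]
      simp [ha]
    · have := hg y (Function.update σ y w) w'
      rw [Function.update_idem] at this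
      exact this.trans (by linarith [ha y])
  · have h1 := hg y (Function.update σ x w) s
    rw [Function.update_comm hyx.symm] at h1
    split_ifs with h
    · rw [h, add_zero]
      exact h1
    · have h2 := hg x (Function.update (Function.update σ y s) x w) w'
      rw [Function.update_idem] at h2
      calc _ ≤ |g (Function.update (Function.update σ y s) x w') -
            g (Function.update (Function.update σ y s) x w)| +
            |g (Function.update (Function.update σ y s) x w) - g (Function.update σ x w)| :=
          abs_sub_le _ _ _
        _ ≤ _ := by linarith

variable [MeasurableSpace S] [DiscreteMeasurableSpace S]

theorem KalikowDecomposition.IsUpdateRule.integrable_update (hW : D.IsUpdateRule W) {B : ℝ}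
    (hB : ∀ σ, |g σ| ≤ B) (x : Site d) (r : ℕ) (σ τ : Config d S) :
    IntegrableOn (fun u => g (Function.update τ x (W x r σ u))) (Set.Icc 0 1) := by
  have hm : Measurable fun s => g (Function.update τ x s) := .of_discrete
  exact Integrable.of_bound (hm.comp (hW.measurable x r σ)).aestronglyMeasurable B
    (ae_of_all _ fun _ => hB _)

theorem KalikowDecomposition.IsUpdateRule.add_increment_eq (hW : D.IsUpdateRule W) {B : ℝ}
    (hB : ∀ σ, |g σ| ≤ B) (x : Site d) (r : ℕ) (σ : Config d S) :
    g σ + increment W g x r σ = ∫ u in Set.Icc (0 : ℝ) 1, g (Function.update σ x (W x r σ u)) := by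
  rw [increment, integral_sub (hW.integrable_update hB x r σ σ) (integrable_const _)]
  simp

theorem KalikowDecomposition.IsUpdateRule.abs_add_increment_le (hW : D.IsUpdateRule W) {B : ℝ}
    (hB : ∀ σ, |g σ| ≤ B) (x : Site d) (r : ℕ) (σ : Config d S) :
    |g σ + increment W g x r σ| ≤ B := by
  rw [hW.add_increment_eq hB]
  exact norm_setIntegral_unit_le fun _ => hB _

-- Couple the updates from both configurations by the same uniform variable. The written spins can
-- differ only if the changed site `y` is in the ball that the update reads.
open Classical in
theorem KalikowDecomposition.IsUpdateRule.oscillationLE_add_increment (hW : D.IsUpdateRule W)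
    {B : ℝ} (hB : ∀ σ, |g σ| ≤ B) (hg : OscillationLE g a) (ha : ∀ x, 0 ≤ a x) (x : Site d)
    (r : ℕ) : OscillationLE (fun σ => g σ + increment W g x r σ)
      fun y => a y + if y ∈ ball x r then a x else 0 := by
  intro y σ s
  simp only []
  rw [hW.add_increment_eq hB, hW.add_increment_eq hB,
    ← integral_sub (hW.integrable_update hB ..) (hW.integrable_update hB ..)]
  refine norm_setIntegral_unit_le fun u => (hg.abs_update_update_sub_le ha _ _ _ _).trans ?_
  gcongr
  split_ifs with h1 h2 h2
  · exact ha x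
  · exact le_rfl
  · exact le_rfl
  · refine absurd (congrFun (hW.dependsOn x r fun z hz => ?_) u) h1
    exact Function.update_of_ne (fun h : z = y => h2 (h ▸ hz)) _ _

end Oscillation

/-! ### The Euler scheme for truncated generators -/

section Euler

variable {d : ℕ} {S : Type*} {c : Site d → S → Config d S → ℝ}

/-- The rate of the updates at the site `i.1` with range `i.2`. -/
noncomputable def KalikowDecomposition.rate (D : KalikowDecomposition c) (i : Site d × ℕ) : ℝ :=
  D.M i.1 * (D.ν i.1 i.2).toReal

/-- The part of the generator that is due to finitely many pairs of a site and a range. -/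
noncomputable def KalikowDecomposition.partialGenerator (D : KalikowDecomposition c)
    (W : Site d → ℕ → Config d S → ℝ → S) (F : Finset (Site d × ℕ)) (g : Config d S → ℝ)
    (σ : Config d S) : ℝ :=
  ∑ i ∈ F, D.rate i * increment W g i.1 i.2 σ

/-- One step of the Euler scheme for the partial generator. -/
noncomputable def KalikowDecomposition.eulerStep (D : KalikowDecomposition c)
    (W : Site d → ℕ → Config d S → ℝ → S) (F : Finset (Site d × ℕ)) (h : ℝ) (g : Config d S → ℝ)
    (σ : Config d S) : ℝ :=
  g σ + h * D.partialGenerator W F g σ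

variable {D : KalikowDecomposition c} {W : Site d → ℕ → Config d S → ℝ → S}
  {g : Config d S → ℝ} {a : Site d → ℝ} {F : Finset (Site d × ℕ)} {h : ℝ}

theorem KalikowDecomposition.rate_nonneg (i : Site d × ℕ) : 0 ≤ D.rate i :=
  mul_nonneg (D.M_pos _).le ENNReal.toReal_nonneg

/-- For `0 ≤ h` and `h * ∑ rate ≤ 1` the coefficients are nonnegative with sum `1`: the step
averages `g` over "no update" and the possible updates. Stability of the scheme rests on this. -/
theorem KalikowDecomposition.eulerStep_eq (σ : Config d S) :
    D.eulerStep W F h g σ = (1 - h * ∑ i ∈ F, D.rate i) * g σ +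
      h * ∑ i ∈ F, D.rate i * (g σ + increment W g i.1 i.2 σ) := by
  simp only [eulerStep, partialGenerator, mul_add, Finset.sum_add_distrib, ← Finset.sum_mul]
  ring

theorem KalikowDecomposition.abs_partialGenerator_le {B : ℝ} (hB : ∀ σ, |g σ| ≤ B)
    (σ : Config d S) : |D.partialGenerator W F g σ| ≤ ∑ i ∈ F, D.rate i * (2 * B) := by
  refine (Finset.abs_sum_le_sum_abs _ _).trans (Finset.sum_le_sum fun i _ => ?_)
  rw [abs_mul, abs_of_nonneg (rate_nonneg i)]
  exact mul_le_mul_of_nonneg_left (abs_increment_le hB _ _ _) (rate_nonneg i)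

open Classical in
/-- A weight on the sites that grows under the influence of the updates by the factor `C` at
most. -/
structure KalikowDecomposition.IsWeight (D : KalikowDecomposition c) (a : Site d → ℝ) (C : ℝ) :
    Prop where
  nonneg : ∀ x, 0 ≤ a x
  summable : Summable fun i : Site d × ℕ => D.rate i * a i.1
  sum_le : ∀ (F : Finset (Site d × ℕ)) (y : Site d),
    ∑ i ∈ F, D.rate i * (if y ∈ ball i.1 i.2 then a i.1 else 0) ≤ C * a y

theorem KalikowDecomposition.IsWeight.const_mul {C : ℝ} (ha : D.IsWeight a C) {α : ℝ}
    (hα : 0 ≤ α) : D.IsWeight (fun x => α * a x) C where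
  nonneg x := mul_nonneg hα (ha.nonneg x)
  summable := by
    refine (ha.summable.mul_left α).congr fun i => ?_
    ring
  sum_le F y := by
    classical
    calc _ = α * ∑ i ∈ F, D.rate i * (if y ∈ ball i.1 i.2 then a i.1 else 0) := by
          rw [Finset.mul_sum]
          refine Finset.sum_congr rfl fun i _ => ?_
          split_ifs <;> ring
      _ ≤ α * (C * a y) := mul_le_mul_of_nonneg_left (ha.sum_le F y) hα
      _ = _ := by ring

theorem IsBoundedCylinder.add_const_mul {g g' : Config d S → ℝ} (hg : IsBoundedCylinder g)
    (hg' : IsBoundedCylinder g') (h : ℝ) : IsBoundedCylinder fun σ => g σ + h * g' σ := by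
  classical
  obtain ⟨⟨Λ, hΛ⟩, B, hB⟩ := hg
  obtain ⟨⟨Λ', hΛ'⟩, B', hB'⟩ := hg'
  refine ⟨⟨Λ ∪ Λ', fun σ τ hστ => ?_⟩, B + |h| * B', fun σ => ?_⟩
  · rw [Finset.coe_union] at hστ
    simp only [hΛ fun y hy => hστ y (.inl hy), hΛ' fun y hy => hστ y (.inr hy)]
  · refine (abs_add_le _ _).trans (add_le_add (hB σ) ?_)
    rw [abs_mul]
    exact mul_le_mul_of_nonneg_left (hB' σ) (abs_nonneg h)

variable [MeasurableSpace S]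

theorem KalikowDecomposition.IsUpdateRule.dependsOn_increment (hW : D.IsUpdateRule W)
    {Λ : Set (Site d)} (hg : DependsOn g Λ) {x : Site d} {r : ℕ} (hx : ball x r ⊆ Λ) :
    DependsOn (increment W g x r) Λ := by
  intro σ τ hστ
  rw [increment, increment, hW.dependsOn x r fun y hy => hστ y (hx hy), hg hστ]
  congr 1
  funext u
  congr 1
  refine hg fun y hy => ?_
  rcases eq_or_ne y x with rfl | hyx
  · simp
  · rw [Function.update_of_ne hyx, Function.update_of_ne hyx, hστ y hy]

theorem KalikowDecomposition.IsUpdateRule.isBoundedCylinder_partialGenerator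
    (hW : D.IsUpdateRule W) (hg : IsBoundedCylinder g) (F : Finset (Site d × ℕ)) :
    IsBoundedCylinder (D.partialGenerator W F g) := by
  classical
  obtain ⟨⟨Λ, hΛ⟩, B, hB⟩ := hg
  refine ⟨⟨Λ ∪ F.biUnion fun i => box i.1 i.2, fun σ τ hστ => ?_⟩, _, abs_partialGenerator_le hB⟩
  refine Finset.sum_congr rfl fun i hi => ?_
  congr 1
  refine hW.dependsOn_increment (Λ := ↑(Λ ∪ F.biUnion fun i => box i.1 i.2))
    (fun σ τ h => hΛ fun y hy => h y (by simp [Finset.mem_coe.1 hy])) (fun y hy => ?_) hστ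
  have hy' : y ∈ box i.1 i.2 := ball_subset_box _ _ hy
  exact Finset.mem_coe.2 (Finset.mem_union_right _ (Finset.mem_biUnion.2 ⟨i, hi, hy'⟩))

theorem KalikowDecomposition.IsUpdateRule.isBoundedCylinder_eulerStep
    (hW : D.IsUpdateRule W) (hg : IsBoundedCylinder g) (F : Finset (Site d × ℕ)) (h : ℝ) :
    IsBoundedCylinder (D.eulerStep W F h g) :=
  hg.add_const_mul (hW.isBoundedCylinder_partialGenerator hg F) h

variable [DiscreteMeasurableSpace S]

theorem KalikowDecomposition.IsUpdateRule.abs_eulerStep_le (hW : D.IsUpdateRule W) {B : ℝ}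
    (hB : ∀ σ, |g σ| ≤ B) (hh : 0 ≤ h) (hF : h * ∑ i ∈ F, D.rate i ≤ 1) (σ : Config d S) :
    |D.eulerStep W F h g σ| ≤ B := by
  have hsum : |∑ i ∈ F, D.rate i * (g σ + increment W g i.1 i.2 σ)| ≤ ∑ i ∈ F, D.rate i * B := by
    refine (Finset.abs_sum_le_sum_abs _ _).trans (Finset.sum_le_sum fun i _ => ?_)
    rw [abs_mul, abs_of_nonneg (rate_nonneg i)]
    exact mul_le_mul_of_nonneg_left (hW.abs_add_increment_le hB _ _ _) (rate_nonneg i)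
  rw [eulerStep_eq]
  refine (abs_add_le _ _).trans ?_
  rw [abs_mul, abs_mul, abs_of_nonneg (sub_nonneg.2 hF), abs_of_nonneg hh]
  calc _ ≤ (1 - h * ∑ i ∈ F, D.rate i) * B + h * ∑ i ∈ F, D.rate i * B :=
        add_le_add (mul_le_mul_of_nonneg_left (hB σ) (sub_nonneg.2 hF))
          (mul_le_mul_of_nonneg_left hsum hh)
    _ = B := by
        rw [← Finset.sum_mul]
        ring

/-- In the convex combination the direct effects add up to `a y`; the indirect effects add at most
`h C a y`, by the defining inequality of a weight. -/
theorem KalikowDecomposition.IsUpdateRule.oscillationLE_eulerStep (hW : D.IsUpdateRule W) {B : ℝ}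
    (hB : ∀ σ, |g σ| ≤ B) (hg : OscillationLE g a) {C : ℝ} (ha : D.IsWeight a C) (hh : 0 ≤ h)
    (hF : h * ∑ i ∈ F, D.rate i ≤ 1) :
    OscillationLE (D.eulerStep W F h g) fun x => (1 + h * C) * a x := by
  classical
  intro y σ s
  have hsum : |∑ i ∈ F, D.rate i * (g (Function.update σ y s) +
      increment W g i.1 i.2 (Function.update σ y s)) -
      ∑ i ∈ F, D.rate i * (g σ + increment W g i.1 i.2 σ)| ≤
      (∑ i ∈ F, D.rate i) * a y + C * a y := by
    rw [← Finset.sum_sub_distrib]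
    refine (Finset.abs_sum_le_sum_abs _ _).trans ?_
    calc _ ≤ ∑ i ∈ F, D.rate i * (a y + if y ∈ ball i.1 i.2 then a i.1 else 0) := by
          refine Finset.sum_le_sum fun i _ => ?_
          rw [← mul_sub, abs_mul, abs_of_nonneg (rate_nonneg i)]
          exact mul_le_mul_of_nonneg_left
            (hW.oscillationLE_add_increment hB hg ha.nonneg i.1 i.2 y σ s) (rate_nonneg i)
      _ ≤ _ := by
          simp only [mul_add, Finset.sum_add_distrib, ← Finset.sum_mul]
          gcongr
          exact ha.sum_le F y
  have h1 := mul_le_mul_of_nonneg_left (hg y σ s) (sub_nonneg.2 hF)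
  have h2 := mul_le_mul_of_nonneg_left hsum hh
  rw [eulerStep_eq, eulerStep_eq]
  rw [← abs_of_nonneg (sub_nonneg.2 hF), ← abs_mul] at h1
  rw [← abs_of_nonneg hh, ← abs_mul] at h2
  rw [abs_of_nonneg (sub_nonneg.2 hF), mul_sub] at h1
  rw [abs_of_nonneg hh, mul_sub] at h2
  rw [abs_le] at *
  constructor <;> nlinarith [h1.1, h1.2, h2.1, h2.2]

/-- A crude bound, from writing each increment as an average minus `g`. It depends on `F`, which is
harmless because it enters the Euler error only with an extra factor `h`. -/
theorem KalikowDecomposition.IsUpdateRule.oscillationLE_partialGenerator (hW : D.IsUpdateRule W)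
    {B : ℝ} (hB : ∀ σ, |g σ| ≤ B) (hg : OscillationLE g a) {C : ℝ} (ha : D.IsWeight a C)
    (F : Finset (Site d × ℕ)) :
    OscillationLE (D.partialGenerator W F g) fun x => (2 * ∑ i ∈ F, D.rate i + C) * a x := by
  classical
  intro y σ s
  rw [partialGenerator, partialGenerator, ← Finset.sum_sub_distrib]
  refine (Finset.abs_sum_le_sum_abs _ _).trans ?_
  calc _ ≤ ∑ i ∈ F, D.rate i * (2 * a y + if y ∈ ball i.1 i.2 then a i.1 else 0) := by
        refine Finset.sum_le_sum fun i _ => ?_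
        rw [← mul_sub, abs_mul, abs_of_nonneg (rate_nonneg i)]
        refine mul_le_mul_of_nonneg_left ?_ (rate_nonneg i)
        have h1 := hW.oscillationLE_add_increment hB hg ha.nonneg i.1 i.2 y σ s
        have h2 := hg y σ s
        rw [abs_le] at *
        constructor <;> linarith [h1.1, h1.2, h2.1, h2.2]
    _ ≤ _ := by
        simp only [mul_add, Finset.sum_add_distrib, ← Finset.sum_mul]
        have := ha.sum_le F y
        linarith

theorem KalikowDecomposition.IsUpdateRule.iterate_eulerStep (hW : D.IsUpdateRule W)
    (hg : IsBoundedCylinder g) {B : ℝ} (hB : ∀ σ, |g σ| ≤ B) (ho : OscillationLE g a) {C : ℝ}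
    (ha : D.IsWeight a C) (hh : 0 ≤ h)
    (hF : h * ∑ i ∈ F, D.rate i ≤ 1) (n : ℕ) :
    IsBoundedCylinder ((D.eulerStep W F h)^[n] g) ∧
      (∀ σ, |(D.eulerStep W F h)^[n] g σ| ≤ B) ∧
      OscillationLE ((D.eulerStep W F h)^[n] g) fun x => Real.exp (n * h * C) * a x := by
  induction n with
  | zero => simpa using ⟨hg, hB, ho⟩
  | succ n ih =>
    obtain ⟨h1, h2, h3⟩ := ih
    simp only [Function.iterate_succ_apply']
    refine ⟨hW.isBoundedCylinder_eulerStep h1 F h, hW.abs_eulerStep_le h2 hh hF, fun x σ s => ?_⟩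
    refine (hW.oscillationLE_eulerStep h2 h3 (ha.const_mul (Real.exp_pos _).le) hh hF x σ s).trans ?_
    have e : ((n + 1 : ℕ) : ℝ) * h * C = h * C + n * h * C := by
      push_cast
      ring
    have h5 : 1 + h * C ≤ Real.exp (h * C) := by linarith [Real.add_one_le_exp (h * C)]
    simp only [e, Real.exp_add, mul_assoc]
    exact mul_le_mul_of_nonneg_right h5 (mul_nonneg (Real.exp_pos _).le (ha.nonneg x))

end Euler

/-! ### Uniqueness of the semigroup -/

/-- For a matrix with bounded row sums every summable function is dominated by a summable one which
the transposed matrix multiplies by a bounded factor. -/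
theorem exists_superharmonic {α : Type*} (A : α → α → ℝ≥0∞) {θ : ℝ≥0∞} (hθ : θ ≠ ⊤)
    (hA : ∀ x, ∑' y, A x y ≤ θ) (a₀ : α → ℝ≥0∞) (ha₀ : ∑' x, a₀ x ≠ ⊤) :
    ∃ a : α → ℝ≥0∞, a₀ ≤ a ∧ ∑' x, a x ≠ ⊤ ∧ ∀ y, ∑' x, a x * A x y ≤ (2 * θ + 1) * a y := by
  -- The dominating function is `∑ k, C^{-k} a₀ A^k`. As `C ≥ 2θ`, the total mass at least halves
  -- from one term to the next; the summand `1` keeps `C` invertible if `θ = 0`. Multiplication by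
  -- `A` shifts the series at the cost of a factor `C`.
  set C : ℝ≥0∞ := 2 * θ + 1 with hC
  have hC0 : C ≠ 0 := by simp [hC]
  have hCt : C ≠ ⊤ := by finiteness
  let u : ℕ → α → ℝ≥0∞ := fun k => Nat.rec a₀ (fun _ v y => C⁻¹ * ∑' x, v x * A x y) k
  have hsucc : ∀ k y, u (k + 1) y = C⁻¹ * ∑' x, u k x * A x y := fun k y => rfl
  have hsum : ∀ k, ∑' x, u k x ≤ 2⁻¹ ^ k * ∑' x, a₀ x := by
    intro k
    induction k with
    | zero => simp [u]
    | succ k ih =>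
      calc ∑' y, u (k + 1) y = C⁻¹ * ∑' x, u k x * ∑' y, A x y := by
            simp_rw [hsucc, ENNReal.tsum_mul_left]
            rw [ENNReal.tsum_comm]
            simp_rw [ENNReal.tsum_mul_left]
        _ ≤ C⁻¹ * ∑' x, u k x * θ := by
            gcongr
            exact hA _
        _ = (C⁻¹ * θ) * ∑' x, u k x := by
            rw [ENNReal.tsum_mul_right]
            ring
        _ ≤ 2⁻¹ * (2⁻¹ ^ k * ∑' x, a₀ x) := by
            gcongr
            rw [mul_comm, ← div_eq_mul_inv]
            refine ENNReal.div_le_of_le_mul' ?_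
            rw [hC, add_mul, mul_right_comm, ENNReal.mul_inv_cancel two_ne_zero ENNReal.ofNat_ne_top,
              one_mul]
            exact le_self_add
        _ = _ := by ring
  refine ⟨fun x => ∑' k, u k x, fun x => ENNReal.le_tsum (f := fun k => u k x) 0, ?_, fun y => ?_⟩
  · rw [ENNReal.tsum_comm]
    refine ne_top_of_le_ne_top ?_ (ENNReal.tsum_le_tsum hsum)
    rw [ENNReal.tsum_mul_right, ENNReal.tsum_geometric]
    refine ENNReal.mul_ne_top ?_ ha₀
    simp
  · simp_rw [← ENNReal.tsum_mul_right]
    rw [ENNReal.tsum_comm, ← ENNReal.tsum_mul_left]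
    have e : ∀ k, ∑' x, u k x * A x y = C * u (k + 1) y := fun k => by
      rw [hsucc, ← mul_assoc, ENNReal.mul_inv_cancel hC0 hCt, one_mul]
    simp_rw [e]
    rw [tsum_eq_zero_add' (f := fun k => C * u k y) ENNReal.summable]
    exact le_add_self

section Weight

variable {d : ℕ} {S : Type*} {c : Site d → S → Config d S → ℝ} {D : KalikowDecomposition c}

theorem KalikowDecomposition.ofReal_rate (i : Site d × ℕ) :
    ENNReal.ofReal (D.rate i) = ENNReal.ofReal (D.M i.1) * D.ν i.1 i.2 := by
  rw [rate, ENNReal.ofReal_mul (D.M_pos _).le, ENNReal.ofReal_toReal ((D.ν _).apply_ne_top _)]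

theorem tsum_indicator_ball_le (x : Site d) (r : ℕ) [DecidablePred (· ∈ ball x r)] :
    ∑' y, (if y ∈ ball x r then (1 : ℝ≥0∞) else 0) ≤ ((2 * r + 1 : ℕ) : ℝ≥0∞) ^ d := by
  rw [tsum_eq_sum (s := box x r) fun y hy => if_neg fun h => hy (ball_subset_box _ _ h)]
  calc _ ≤ ∑ y ∈ box x r, (1 : ℝ≥0∞) := Finset.sum_le_sum fun y _ => by split_ifs <;> simp
    _ = _ := by simp [card_box]

/-- The influence matrix `A x y`, the rate at which `x` is updated with a range reaching `y`, has
bounded row sums by the moment condition. `exists_superharmonic` applied to `B` times the indicator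
of `Λ` gives a weight that dominates the oscillations of a cylinder function on `Λ`. -/
theorem KalikowDecomposition.exists_isWeight (D : KalikowDecomposition c)
    (hsup : BddAbove (Set.range D.M))
    (hmoment : (∑' r : ℕ, (r : ℝ≥0∞) ^ d * (⨆ x, D.ν x r)) ≠ ⊤) (Λ : Finset (Site d)) {B : ℝ}
    (hB : 0 ≤ B) : ∃ a C, 0 ≤ C ∧ D.IsWeight a C ∧ ∀ x ∈ Λ, B ≤ a x := by
  classical
  obtain ⟨K, hK⟩ := hsup
  have hK' : ∀ x, D.M x ≤ K := fun x => hK ⟨x, rfl⟩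
  have hs0 : (⨆ x, D.ν x 0) ≠ ⊤ :=
    ne_top_of_le_ne_top ENNReal.one_ne_top (iSup_le fun x => (D.ν x).coe_le_one 0)
  have hs := tsum_card_box_mul_ne_top hs0 hmoment
  let A : Site d → Site d → ℝ≥0∞ := fun x y =>
    ∑' r, ENNReal.ofReal (D.M x) * D.ν x r * if y ∈ ball x r then 1 else 0
  set θ : ℝ≥0∞ := ENNReal.ofReal K * ∑' r : ℕ, ((2 * r + 1 : ℕ) : ℝ≥0∞) ^ d * ⨆ x, D.ν x r with hθ
  have hθt : θ ≠ ⊤ := ENNReal.mul_ne_top ENNReal.ofReal_ne_top hs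
  have hA : ∀ x, ∑' y, A x y ≤ θ := by
    intro x
    rw [ENNReal.tsum_comm, hθ, ← ENNReal.tsum_mul_left]
    refine ENNReal.tsum_le_tsum fun r => ?_
    rw [ENNReal.tsum_mul_left, mul_assoc, mul_comm (_ ^ d)]
    gcongr
    · exact hK' x
    · exact le_iSup (fun x => D.ν x r) x
    · exact tsum_indicator_ball_le x r
  obtain ⟨a, ha₀, ha, hTa⟩ := exists_superharmonic A hθt hA
    (fun x => if x ∈ Λ then ENNReal.ofReal B else 0) (by
      rw [tsum_eq_sum (s := Λ) fun x hx => if_neg hx]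
      exact ENNReal.sum_ne_top.2 fun x hx => by simp [hx])
  have hat : ∀ x, a x ≠ ⊤ := fun x => ne_top_of_le_ne_top ha (ENNReal.le_tsum x)
  have hCt : 2 * θ + 1 ≠ ⊤ := by finiteness
  refine ⟨fun x => (a x).toReal, (2 * θ + 1).toReal, ENNReal.toReal_nonneg,
    ⟨fun x => ENNReal.toReal_nonneg, ?_, fun F y => ?_⟩, fun x hx => ?_⟩
  · have h : ∑' i : Site d × ℕ, ENNReal.ofReal (D.rate i) * a i.1 ≠ ⊤ := by
      simp_rw [ofReal_rate]
      rw [ENNReal.tsum_prod (f := fun x r => ENNReal.ofReal (D.M x) * D.ν x r * a x)]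
      refine ne_top_of_le_ne_top (ENNReal.mul_ne_top (ENNReal.ofReal_ne_top (r := K)) ha) ?_
      rw [← ENNReal.tsum_mul_left]
      refine ENNReal.tsum_le_tsum fun x => ?_
      simp_rw [mul_right_comm]
      rw [ENNReal.tsum_mul_left, (D.ν x).tsum_coe, mul_one]
      gcongr
      exact hK' x
    refine (ENNReal.summable_toReal h).congr fun i => ?_
    rw [ENNReal.toReal_mul, ENNReal.toReal_ofReal (rate_nonneg i)]
  · have h : ∑ i ∈ F, ENNReal.ofReal (D.rate i) * (if y ∈ ball i.1 i.2 then a i.1 else 0) ≤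
        (2 * θ + 1) * a y := by
      refine (ENNReal.sum_le_tsum F).trans (le_trans (le_of_eq ?_) (hTa y))
      rw [ENNReal.tsum_prod (f := fun x r => ENNReal.ofReal (D.rate (x, r)) *
        if y ∈ ball x r then a x else 0)]
      refine tsum_congr fun x => ?_
      rw [← ENNReal.tsum_mul_left]
      refine tsum_congr fun r => ?_
      rw [ofReal_rate]
      split_ifs <;> ring
    have h' := ENNReal.toReal_mono (ENNReal.mul_ne_top hCt (hat y)) h
    rw [ENNReal.toReal_mul, ENNReal.toReal_sum fun i _ => ENNReal.mul_ne_top ENNReal.ofReal_ne_top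
      (by split_ifs <;> simp [hat])] at h'
    refine le_trans (le_of_eq (Finset.sum_congr rfl fun i _ => ?_)) h'
    rw [ENNReal.toReal_mul, ENNReal.toReal_ofReal (rate_nonneg i)]
    split_ifs <;> simp
  · have h := ha₀ x
    simp only [if_pos hx] at h
    have h' := ENNReal.toReal_mono (hat x) h
    rwa [ENNReal.toReal_ofReal hB] at h'

end Weight

section Uniqueness

variable {d : ℕ} {S : Type*} [Countable S] [MeasurableSpace S] [DiscreteMeasurableSpace S]
  {c : Site d → S → Config d S → ℝ} {D : KalikowDecomposition c}
  {W : Site d → ℕ → Config d S → ℝ → S} {g : Config d S → ℝ} {a : Site d → ℝ}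

theorem abs_tsum_sub_sum_le {ι : Type*} {f b : ι → ℝ} (hb : Summable b) (hf : ∀ i, |f i| ≤ b i)
    (F : Finset ι) : |∑' i, f i - ∑ i ∈ F, f i| ≤ ∑' i, b i - ∑ i ∈ F, b i := by
  have hfs : Summable f := .of_norm_bounded hb hf
  rw [← hfs.sum_add_tsum_subtype_compl F, ← hb.sum_add_tsum_subtype_compl F, add_sub_cancel_left,
    add_sub_cancel_left]
  exact tsum_of_norm_bounded (f := fun i : {i // i ∉ F} => f i) (g := fun i => b i)
    (hb.subtype fun i => i ∉ F).hasSum fun i => hf i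

/-- A summable weight that dominates the oscillations makes the double series absolutely convergent,
so truncation to any finite set of pairs is controlled by the tail of the weight, whatever the
support of `g`. -/
theorem KalikowDecomposition.IsUpdateRule.generator_eq_tsum (hW : D.IsUpdateRule W)
    (hg : IsBoundedCylinder g) (ho : OscillationLE g a)
    (ha : Summable fun i : Site d × ℕ => D.rate i * a i.1) (σ : Config d S) :
    generator c g σ = ∑' i, D.rate i * increment W g i.1 i.2 σ := by
  obtain ⟨⟨Λ, hΛ⟩, B, hB⟩ := hg
  have hs : Summable fun i => D.rate i * increment W g i.1 i.2 σ :=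
    .of_norm_bounded ha fun i => by
      rw [norm_mul, Real.norm_of_nonneg (rate_nonneg i)]
      exact mul_le_mul_of_nonneg_left (ho.abs_increment_le _ _ _) (rate_nonneg i)
  rw [hs.tsum_prod, hW.generator_eq_sum hB hΛ, tsum_eq_sum (s := Λ)]
  · refine Finset.sum_congr rfl fun x _ => ?_
    simp_rw [rate, mul_assoc, tsum_mul_left]
  · intro x hx
    simp [increment_eq_zero hΛ (Finset.mem_coe.not.2 hx)]

theorem KalikowDecomposition.IsUpdateRule.abs_generator_sub_partialGenerator_le
    (hW : D.IsUpdateRule W) (hg : IsBoundedCylinder g) (ho : OscillationLE g a)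
    (ha : Summable fun i : Site d × ℕ => D.rate i * a i.1) (F : Finset (Site d × ℕ))
    (σ : Config d S) : |generator c g σ - D.partialGenerator W F g σ| ≤
      ∑' i : Site d × ℕ, D.rate i * a i.1 - ∑ i ∈ F, D.rate i * a i.1 := by
  rw [hW.generator_eq_tsum hg ho ha]
  refine abs_tsum_sub_sum_le ha (fun i => ?_) F
  rw [abs_mul, abs_of_nonneg (rate_nonneg i)]
  exact mul_le_mul_of_nonneg_left (ho.abs_increment_le _ _ _) (rate_nonneg i)

theorem KalikowDecomposition.IsUpdateRule.abs_generator_le_tsum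
    (hW : D.IsUpdateRule W) (hg : IsBoundedCylinder g) (ho : OscillationLE g a)
    (ha : Summable fun i : Site d × ℕ => D.rate i * a i.1) (σ : Config d S) :
    |generator c g σ| ≤ ∑' i : Site d × ℕ, D.rate i * a i.1 := by
  simpa [partialGenerator] using hW.abs_generator_sub_partialGenerator_le hg ho ha ∅ σ

variable {κ : ℝ≥0 → Kernel (Config d S) (Config d S)}

/-- Error of the Euler scheme. -/
theorem KalikowDecomposition.IsUpdateRule.abs_integral_sub_iterate_le (hW : D.IsUpdateRule W)
    (hκ : IsTransitionSemigroup κ) (hgen : HasGenerator κ c) {f : Config d S → ℝ}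
    (hf : IsBoundedCylinder f) (ho : OscillationLE f a) {C : ℝ}
    (hC : 0 ≤ C) (ha : D.IsWeight a C) {F : Finset (Site d × ℕ)} {h : ℝ≥0}
    (hF : h * ∑ i ∈ F, D.rate i ≤ 1) (n : ℕ) (ζ : Config d S) :
    |∫ ξ, f ξ ∂(κ (n * h) ζ) - (D.eulerStep W F h)^[n] f ζ| ≤
      n * h * (Real.exp (n * h * C) *
        (∑' i : Site d × ℕ, D.rate i * a i.1 - ∑ i ∈ F, D.rate i * a i.1) +
        h * ((2 * ∑ i ∈ F, D.rate i + C) *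
          (Real.exp (n * h * C) * ∑' i : Site d × ℕ, D.rate i * a i.1))) := by
  obtain ⟨B, hB⟩ := hf.2
  set g : ℕ → Config d S → ℝ := fun i => (D.eulerStep W F h)^[i] f with hg
  set α : ℝ := Real.exp (n * h * C) with hα
  have hα0 : 0 ≤ α := (Real.exp_pos _).le
  have hcyl : ∀ i, IsBoundedCylinder (g i) := fun i =>
    (hW.iterate_eulerStep hf hB ho ha h.coe_nonneg hF i).1
  have hbd : ∀ i σ, |g i σ| ≤ B := fun i =>
    (hW.iterate_eulerStep hf hB ho ha h.coe_nonneg hF i).2.1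
  have hosc : ∀ i ≤ n, OscillationLE (g i) fun x => α * a x := fun i hi x σ s => by
    refine ((hW.iterate_eulerStep hf hB ho ha h.coe_nonneg hF i).2.2 x σ s).trans ?_
    exact mul_le_mul_of_nonneg_right (Real.exp_le_exp.2 (by gcongr)) (ha.nonneg x)
  have haα := ha.const_mul hα0
  have e1 : ∑' i : Site d × ℕ, D.rate i * (α * a i.1) =
      α * ∑' i : Site d × ℕ, D.rate i * a i.1 := by
    rw [← tsum_mul_left]
    exact tsum_congr fun i => by ring
  have e2 : ∑ i ∈ F, D.rate i * (α * a i.1) = α * ∑ i ∈ F, D.rate i * a i.1 := by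
    rw [Finset.mul_sum]
    exact Finset.sum_congr rfl fun i _ => by ring
  have e3 : ∀ m : ℝ, ∑' i : Site d × ℕ, D.rate i * (m * (α * a i.1)) =
      m * (α * ∑' i : Site d × ℕ, D.rate i * a i.1) := fun m => by
    rw [← e1, ← tsum_mul_left]
    exact tsum_congr fun i => by ring
  have hm : (0 : ℝ) ≤ 2 * ∑ i ∈ F, D.rate i + C := by
    have : 0 ≤ ∑ i ∈ F, D.rate i := Finset.sum_nonneg fun i _ => rate_nonneg i
    positivity
  set e : ℝ := α * (∑' i : Site d × ℕ, D.rate i * a i.1 - ∑ i ∈ F, D.rate i * a i.1) +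
        h * ((2 * ∑ i ∈ F, D.rate i + C) * (α * ∑' i : Site d × ℕ, D.rate i * a i.1)) with he
  -- Error of one step: the truncation of the generator plus `h` times the bound on the generator
  -- applied to the truncated generator.
  have hstep : ∀ i ≤ n, ∀ ζ, |∫ ξ, g i ξ ∂(κ h ζ) - g (i + 1) ζ| ≤ h * e := by
    intro i hi ζ
    have h1 := fun σ => hW.abs_generator_sub_partialGenerator_le (hcyl i) (hosc i hi) haα.summable
      F σ
    have h2 := fun σ => hW.abs_generator_le_tsum
      (hW.isBoundedCylinder_partialGenerator (hcyl i) F)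
      (hW.oscillationLE_partialGenerator (hbd i) (hosc i hi) haα F)
      (haα.const_mul hm).summable σ
    simp only [e3] at h2
    simp only [e1, e2, ← mul_sub] at h1
    have h3 := abs_integral_sub_sub_le hκ hgen (hcyl i)
      (hW.isBoundedCylinder_partialGenerator (hcyl i) F) h1 h2 h ζ
    rwa [sub_sub, show g i ζ + h * D.partialGenerator W F (g i) ζ = g (i + 1) ζ by
      simp only [hg, Function.iterate_succ_apply']
      rfl] at h3
  -- Errors add up without amplification, because each kernel is a contraction in the sup norm.
  have hiter : ∀ j i, i + j ≤ n → ∀ ζ, |∫ ξ, g i ξ ∂(κ (j * h) ζ) - g (i + j) ζ| ≤ j * (h * e) := by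
    intro j
    induction j with
    | zero =>
      intro i _ ζ
      rw [Nat.cast_zero, zero_mul, integral_kernel_zero hκ (hcyl i).measurable]
      simp
    | succ j ih =>
      intro i hi ζ
      have h1 := ih (i + 1) (by omega) ζ
      have h2 := ParticleSystem.abs_integral_kernel_sub_le hκ (measurable_integral_kernel (hcyl i).measurable h)
        (abs_integral_kernel_le hκ (hbd i) h) (hcyl (i + 1)).measurable (hbd (i + 1))
        (hstep i (by omega)) (j * h) ζ
      rw [← integral_kernel_add hκ (hcyl i).measurable (hbd i)] at h2
      have e4 : ((j + 1 : ℕ) : ℝ≥0) * h = j * h + h := by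
        push_cast
        ring
      rw [e4, show i + (j + 1) = i + 1 + j by omega]
      push_cast
      refine (abs_sub_le _ _ _).trans ((add_le_add h2 h1).trans (le_of_eq ?_))
      ring
  have := hiter n 0 (by omega) ζ
  rw [zero_add] at this
  exact this.trans (le_of_eq (by ring))

/-- The generator determines the semigroup on bounded cylinder functions. -/
theorem KalikowDecomposition.IsUpdateRule.exists_approx (hW : D.IsUpdateRule W)
    (hsup : BddAbove (Set.range D.M))
    (hmoment : (∑' r : ℕ, (r : ℝ≥0∞) ^ d * (⨆ x, D.ν x r)) ≠ ⊤) {f : Config d S → ℝ}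
    (hf : IsBoundedCylinder f) (t : ℝ≥0) {ε : ℝ} (hε : 0 < ε) :
    ∃ φ : Config d S → ℝ, ∀ κ : ℝ≥0 → Kernel (Config d S) (Config d S), IsTransitionSemigroup κ →
      HasGenerator κ c → ∀ ζ, |∫ ξ, f ξ ∂(κ t ζ) - φ ζ| ≤ ε := by
  obtain ⟨⟨Λ, hΛ⟩, B, hB⟩ := id hf
  have hB' : ∀ σ, |f σ| ≤ |B| := fun σ => (hB σ).trans (le_abs_self B)
  obtain ⟨a, C, hC, ha, haΛ⟩ := D.exists_isWeight hsup hmoment Λ (B := 2 * |B|) (by positivity)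
  have ho : OscillationLE f a := fun x σ s => by
    by_cases hx : x ∈ Λ
    · exact (abs_sub_le_two_mul (hB' _) (hB' _)).trans (haΛ x hx)
    · rw [update_eq_of_notMem hΛ (by exact_mod_cast hx), sub_self, abs_zero]
      exact ha.nonneg x
  set α : ℝ := Real.exp (t * C)
  have htail : Tendsto (fun F : Finset (Site d × ℕ) => t * (α *
      (∑' i : Site d × ℕ, D.rate i * a i.1 - ∑ i ∈ F, D.rate i * a i.1))) atTop (𝓝 0) := by
    have := ((tendsto_const_nhds (x := ∑' i : Site d × ℕ, D.rate i * a i.1)).sub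
      ha.summable.hasSum).const_mul α |>.const_mul (t : ℝ)
    simpa using this
  -- The truncation `F` is fixed before the number of steps, since the admissible step size depends
  -- on the total rate of `F`.
  obtain ⟨F, hF⟩ := (htail.eventually_le_const (half_pos hε)).exists
  set lam : ℝ := ∑ i ∈ F, D.rate i
  set K : ℝ := (2 * lam + C) * (α * ∑' i : Site d × ℕ, D.rate i * a i.1)
  obtain ⟨n, hn0, hn1, hn2⟩ : ∃ n : ℕ, 0 < n ∧ t / n * lam ≤ 1 ∧ t * (t / n * K) ≤ ε / 2 := by
    have h0 : Tendsto (fun n : ℕ => (t : ℝ) / n) atTop (𝓝 0) :=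
      tendsto_const_div_atTop_nhds_zero_nat _
    have h1 : Tendsto (fun n : ℕ => (t : ℝ) / n * lam) atTop (𝓝 0) := by
      simpa using h0.mul_const lam
    have h2 : Tendsto (fun n : ℕ => (t : ℝ) * ((t : ℝ) / n * K)) atTop (𝓝 0) := by
      simpa using (h0.mul_const K).const_mul (t : ℝ)
    exact ((eventually_gt_atTop 0).and ((h1.eventually_le_const one_pos).and
      (h2.eventually_le_const (half_pos hε)))).exists
  refine ⟨(D.eulerStep W F (t / n : ℝ≥0))^[n] f, fun κ hκ hgen ζ => ?_⟩
  have hnt : (n : ℝ≥0) * (t / n) = t := mul_div_cancel₀ t (by exact_mod_cast hn0.ne')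
  have hnt' : (n : ℝ) * ((t / n : ℝ≥0) : ℝ) = t := by exact_mod_cast hnt
  have := hW.abs_integral_sub_iterate_le hκ hgen hf ho hC ha (h := t / n)
    (by push_cast; exact hn1) n ζ
  rw [hnt, hnt'] at this
  refine this.trans ?_
  push_cast
  rw [mul_add]
  linarith

/-- The Euler approximation is built from the decomposition and the update rule alone, so both
semigroups are within `ε / 2` of the same function. -/
theorem KalikowDecomposition.IsUpdateRule.integral_kernel_unique (hW : D.IsUpdateRule W)
    (hsup : BddAbove (Set.range D.M))
    (hmoment : (∑' r : ℕ, (r : ℝ≥0∞) ^ d * (⨆ x, D.ν x r)) ≠ ⊤) {f : Config d S → ℝ}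
    (hf : IsBoundedCylinder f) {κ κ' : ℝ≥0 → Kernel (Config d S) (Config d S)}
    (hκ : IsTransitionSemigroup κ) (hgen : HasGenerator κ c) (hκ' : IsTransitionSemigroup κ')
    (hgen' : HasGenerator κ' c) (t : ℝ≥0) (ζ : Config d S) :
    ∫ ξ, f ξ ∂(κ t ζ) = ∫ ξ, f ξ ∂(κ' t ζ) := by
  refine eq_of_abs_sub_le_all fun ε hε => ?_
  obtain ⟨φ, hφ⟩ := hW.exists_approx hsup hmoment hf t (half_pos hε)
  have h1 := hφ κ hκ hgen ζ
  have h2 := hφ κ' hκ' hgen' ζ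
  rw [abs_sub_comm] at h2
  exact (abs_sub_le _ (φ ζ) _).trans (by linarith)

end Uniqueness

section Uniqueness

variable {d : ℕ} {S : Type*} [Countable S] [MeasurableSpace S] [DiscreteMeasurableSpace S]
  {c : Site d → S → Config d S → ℝ} {D : KalikowDecomposition c}
  {W : Site d → ℕ → Config d S → ℝ → S}

theorem isBoundedCylinder_indicator {d : ℕ} {S : Type*} (Λ : Finset (Site d)) (t : Site d → Set S) :
    IsBoundedCylinder (((Λ : Set (Site d)).pi t).indicator (1 : Config d S → ℝ)) := by
  classical
  refine ⟨⟨Λ, fun σ τ h => ?_⟩, 1, fun σ => ?_⟩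
  · have : σ ∈ (Λ : Set (Site d)).pi t ↔ τ ∈ (Λ : Set (Site d)).pi t :=
      forall₂_congr fun x hx => by rw [h x hx]
    simp only [Set.indicator_apply, this, Pi.one_apply]
  · by_cases h : σ ∈ (Λ : Set (Site d)).pi t <;> simp [h]

/-- The generator determines the semigroup. -/
theorem KalikowDecomposition.IsUpdateRule.kernel_unique (hW : D.IsUpdateRule W)
    (hsup : BddAbove (Set.range D.M))
    (hmoment : (∑' r : ℕ, (r : ℝ≥0∞) ^ d * (⨆ x, D.ν x r)) ≠ ⊤)
    {κ κ' : ℝ≥0 → Kernel (Config d S) (Config d S)}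
    (hκ : IsTransitionSemigroup κ) (hgen : HasGenerator κ c) (hκ' : IsTransitionSemigroup κ')
    (hgen' : HasGenerator κ' c) : κ = κ' := by
  ext1 t
  ext1 ζ
  have := hκ.isMarkov t
  have := hκ'.isMarkov t
  refine ext_of_generate_finite _ generateFrom_squareCylinders.symm
    (isPiSystem_squareCylinders (fun _ => MeasurableSpace.isPiSystem_measurableSet)
      fun _ => .univ) ?_ (by simp)
  rintro _ ⟨Λ, A, hA, rfl⟩
  have hm : MeasurableSet ((Λ : Set (Site d)).pi A) :=
    MeasurableSet.pi Λ.countable_toSet fun x _ => hA x trivial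
  have h := hW.integral_kernel_unique hsup hmoment (isBoundedCylinder_indicator Λ A) hκ hgen hκ'
    hgen' t ζ
  rw [integral_indicator_one hm, integral_indicator_one hm] at h
  exact (measureReal_eq_measureReal_iff).1 h

end Uniqueness

/-! ### The law of a Markov process -/

section Markov

variable {Ω E : Type*} [MeasurableSpace Ω] [MeasurableSpace E] {P : Measure Ω}
  [IsProbabilityMeasure P] {κ : ℝ≥0 → Kernel E E} {X : ℝ≥0 → Ω → E}

/-- The Markov property with transition kernels `κ`. -/
def IsMarkovWith (P : Measure Ω) (X : ℝ≥0 → Ω → E) (κ : ℝ≥0 → Kernel E E) : Prop :=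
  ∀ s t : ℝ≥0, ∀ A : Set E, MeasurableSet A →
    P⟦X (s + t) ⁻¹' A | history X s⟧ =ᵐ[P] fun ω => (κ t (X s ω)).real A

theorem measurable_history {Ω E : Type*} [MeasurableSpace E] {X : ℝ≥0 → Ω → E} {s t : ℝ≥0}
    (h : s ≤ t) : Measurable[history X t] (X s) :=
  measurable_iff_comap_le.2 (le_iSup (fun u : Set.Iic t => MeasurableSpace.comap (X u) _) ⟨s, h⟩)

theorem measurableSet_history_biInter {Ω E : Type*} [MeasurableSpace E] {X : ℝ≥0 → Ω → E} (I : Finset ℝ≥0) {t : ℝ≥0} (hI : ∀ s ∈ I, s ≤ t)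
    {A : ℝ≥0 → Set E} (hA : ∀ s, MeasurableSet (A s)) :
    MeasurableSet[history X t] (⋂ s ∈ I, X s ⁻¹' A s) :=
  Finset.measurableSet_biInter I fun s hs => measurable_history (hI s hs) (hA s)

/-- Integrate the Markov property over a past event. The right side involves the past only through
the law of `X s` restricted to `F`, the quantity on which the comparison of two processes proceeds
by induction. -/
theorem IsMarkovWith.measureReal_inter (hX : ∀ t, Measurable (X t))
    (h : IsMarkovWith P X κ) (s t : ℝ≥0) {F : Set Ω} (hF : MeasurableSet[history X s] F)
    {A₀ A : Set E} (hA₀ : MeasurableSet A₀) (hA : MeasurableSet A) :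
    P.real (F ∩ X s ⁻¹' A₀ ∩ X (s + t) ⁻¹' A) =
      ∫ x in A₀, (κ t x).real A ∂((P.restrict F).map (X s)) := by
  have hle := history_le hX s
  have hF' : MeasurableSet F := hle F hF
  have hAm : MeasurableSet (X (s + t) ⁻¹' A) := hX _ hA
  have hFA : MeasurableSet[history X s] (F ∩ X s ⁻¹' A₀) :=
    hF.inter (measurable_history le_rfl hA₀)
  have h1 := setIntegral_condExp (μ := P) hle
    ((integrable_const (1 : ℝ)).indicator hAm) hFA
  rw [setIntegral_congr_ae (hle _ hFA) ((h s t A hA).mono fun ω hω _ => hω)] at h1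
  rw [setIntegral_indicator hAm, setIntegral_const, smul_eq_mul, mul_one] at h1
  rw [← h1, setIntegral_map hA₀ ?_ (hX s).aemeasurable, Measure.restrict_restrict (hX s hA₀),
    Set.inter_comm]
  exact ((κ t).measurable_coe hA).ennreal_toReal.aestronglyMeasurable

theorem IsMarkovWith.measureReal_preimage {η : E} (hX : ∀ t, Measurable (X t))
    (h : IsMarkovWith P X κ) (h0 : ∀ᵐ ω ∂P, X 0 ω = η) (t : ℝ≥0) {F : Set E}
    (hF : MeasurableSet F) : P.real (X t ⁻¹' F) = (κ t η).real F := by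
  have h1 := h.measureReal_inter hX 0 t .univ .univ hF
  rw [Set.univ_inter, Set.preimage_univ, Set.univ_inter, zero_add, Measure.restrict_univ,
    Measure.restrict_univ] at h1
  have hm : Measurable fun x => (κ t x).real F := ((κ t).measurable_coe hF).ennreal_toReal
  rw [h1, Measure.map_congr (h0 : X 0 =ᵐ[P] fun _ => η), Measure.map_const, measure_univ,
    one_smul, integral_dirac' _ _ hm.stronglyMeasurable]

variable {Ω' : Type*} [MeasurableSpace Ω'] {P' : Measure Ω'} [IsProbabilityMeasure P']
  {X' : ℝ≥0 → Ω' → E} {η : E}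

/-- Induction on the number of times, removing the largest one, `a`. The hypothesis for the earlier
times, with arbitrary final set `F`, says that the restricted laws at time `a` coincide; the common
kernels carry this on to `t`. -/
theorem IsMarkovWith.measureReal_eq (hX : ∀ t, Measurable (X t)) (hX' : ∀ t, Measurable (X' t))
    (h : IsMarkovWith P X κ) (h' : IsMarkovWith P' X' κ)
    (h0 : ∀ᵐ ω ∂P, X 0 ω = η) (h0' : ∀ᵐ ω ∂P', X' 0 ω = η) {A : ℝ≥0 → Set E}
    (hA : ∀ s, MeasurableSet (A s)) (I : Finset ℝ≥0) :
    ∀ t, (∀ s ∈ I, s ≤ t) → ∀ F, MeasurableSet F →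
      P ((⋂ s ∈ I, X s ⁻¹' A s) ∩ X t ⁻¹' F) = P' ((⋂ s ∈ I, X' s ⁻¹' A s) ∩ X' t ⁻¹' F) := by
  classical
  induction I using Finset.induction_on_max with
  | empty =>
    intro t _ F hF
    simp only [Finset.notMem_empty, Set.iInter_of_empty, Set.iInter_univ, Set.univ_inter]
    rw [← measureReal_eq_measureReal_iff, h.measureReal_preimage hX h0 t hF, h'.measureReal_preimage hX' h0' t hF]
  | insert a I hI ih =>
    intro t ht F hF
    have hIa : ∀ s ∈ I, s ≤ a := fun s hs => (hI s hs).le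
    obtain ⟨u, rfl⟩ := exists_add_of_le (ht a (Finset.mem_insert_self a I))
    have hlaw : (P.restrict (⋂ s ∈ I, X s ⁻¹' A s)).map (X a) =
        (P'.restrict (⋂ s ∈ I, X' s ⁻¹' A s)).map (X' a) := by
      ext G hG
      rw [Measure.map_apply (hX a) hG, Measure.map_apply (hX' a) hG,
        Measure.restrict_apply (hX a hG), Measure.restrict_apply (hX' a hG), Set.inter_comm,
        ih a hIa G hG, Set.inter_comm]
    rw [← measureReal_eq_measureReal_iff, Finset.set_biInter_insert, Finset.set_biInter_insert, Set.inter_comm (X a ⁻¹' A a),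
      Set.inter_comm (X' a ⁻¹' A a),
      h.measureReal_inter hX a u (measurableSet_history_biInter I hIa hA) (hA a) hF,
      h'.measureReal_inter hX' a u (measurableSet_history_biInter I hIa hA) (hA a) hF, hlaw]

/-- The transition kernels and the initial state determine the law of a Markov process. -/
theorem IsMarkovWith.map_eq (hX : ∀ t, Measurable (X t)) (hX' : ∀ t, Measurable (X' t))
    (h : IsMarkovWith P X κ) (h' : IsMarkovWith P' X' κ)
    (h0 : ∀ᵐ ω ∂P, X 0 ω = η) (h0' : ∀ᵐ ω ∂P', X' 0 ω = η) :
    P.map (fun ω t => X t ω) = P'.map fun ω t => X' t ω := by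
  have hm : Measurable fun ω t => X t ω := measurable_pi_lambda _ hX
  have hm' : Measurable fun ω t => X' t ω := measurable_pi_lambda _ hX'
  have := Measure.isProbabilityMeasure_map (μ := P) hm.aemeasurable
  have := Measure.isProbabilityMeasure_map (μ := P') hm'.aemeasurable
  refine ext_of_generate_finite _ generateFrom_squareCylinders.symm
    (isPiSystem_squareCylinders (fun _ => MeasurableSpace.isPiSystem_measurableSet)
      fun _ => .univ) ?_ (by simp)
  rintro _ ⟨I, A, hA, rfl⟩
  have hA' : ∀ s, MeasurableSet (A s) := fun s => hA s trivial
  have hmA : MeasurableSet ((I : Set ℝ≥0).pi A) :=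
    MeasurableSet.pi I.countable_toSet fun s _ => hA' s
  rw [Measure.map_apply hm hmA, Measure.map_apply hm' hmA]
  have key := h.measureReal_eq hX hX' h' h0 h0' hA' I (I.sup id)
    (fun s hs => Finset.le_sup (f := id) hs) Set.univ .univ
  simp only [Set.preimage_univ, Set.inter_univ] at key
  convert key using 2 <;> ext ω <;> simp

end Markov

/-! ### Existence of update rules -/

theorem map_projIcc_volume :
    (volume.restrict (Set.Icc (0 : ℝ) 1)).map (Set.projIcc 0 1 zero_le_one) =
      (volume : Measure unitInterval) := by
  have h : (volume.restrict (Set.Icc (0 : ℝ) 1)) = (volume : Measure unitInterval).map (↑) :=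
    (map_comap_subtype_coe measurableSet_Icc volume).symm
  rw [h, Measure.map_map continuous_projIcc.measurable measurable_subtype_coe]
  have e : Set.projIcc (0 : ℝ) 1 zero_le_one ∘ ((↑) : unitInterval → ℝ) = id :=
    funext fun u => Set.projIcc_val zero_le_one u
  rw [e, Measure.map_id]

/-- A law on a standard Borel space is an image of the uniform law; the projection onto the unit
interval extends the map to the real line. -/
theorem exists_measurable_map_unit_eq {S : Type*} [Countable S] [MeasurableSpace S]
    [DiscreteMeasurableSpace S] (p : PMF S) :
    ∃ q : ℝ → S, Measurable q ∧ (volume.restrict (Set.Icc (0 : ℝ) 1)).map q = p.toMeasure := by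
  have : Nonempty S := p.support_nonempty.to_type
  obtain ⟨f, hf, hfp⟩ := p.toMeasure.exists_measurable_map_eq
  refine ⟨f ∘ Set.projIcc 0 1 zero_le_one, hf.comp continuous_projIcc.measurable, ?_⟩
  rw [← Measure.map_map hf continuous_projIcc.measurable, map_projIcc_volume, hfp]

/-- The sampling map is chosen once for each law on `S`, so the rule sees the configuration only
through `p x r σ` and inherits its locality. -/
theorem KalikowDecomposition.exists_isUpdateRule {d : ℕ} {S : Type*} [Countable S]
    [MeasurableSpace S] [DiscreteMeasurableSpace S] {c : Site d → S → Config d S → ℝ}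
    (D : KalikowDecomposition c) : ∃ W, D.IsUpdateRule W := by
  choose q hq hqp using fun p : PMF S => exists_measurable_map_unit_eq p
  exact ⟨fun x r σ => q (D.p x r σ), fun x r σ => hq _,
    fun x r σ τ h => congrArg q (D.p_dependsOn x r h), fun x r σ => hqp _⟩

/-! ### The interacting particle system -/

section Main

variable {d : ℕ} {S : Type*} [Countable S] [MeasurableSpace S] [DiscreteMeasurableSpace S]
  [TopologicalSpace S] {c : Site d → S → Config d S → ℝ} {D : KalikowDecomposition c}
  {W : Site d → ℕ → Config d S → ℝ → S}

theorem KalikowDecomposition.IsUpdateRule.map_eq_of_isParticleSystem (hW : D.IsUpdateRule W)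
    (hsup : BddAbove (Set.range D.M))
    (hmoment : (∑' r : ℕ, (r : ℝ≥0∞) ^ d * (⨆ x, D.ν x r)) ≠ ⊤) {η : Config d S}
    {Ω Ω' : Type*} [MeasurableSpace Ω] [MeasurableSpace Ω'] {P : Measure Ω} {P' : Measure Ω'}
    [IsProbabilityMeasure P] [IsProbabilityMeasure P'] {σ : ℝ≥0 → Ω → Config d S}
    {σ' : ℝ≥0 → Ω' → Config d S} (hσ : IsParticleSystem c η P σ)
    (hσ' : IsParticleSystem c η P' σ') :
    P.map (fun ω t => σ t ω) = P'.map fun ω t => σ' t ω := by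
  obtain ⟨κ, hκ, hgen, hmarkov⟩ := hσ.markov
  obtain ⟨κ', hκ', hgen', hmarkov'⟩ := hσ'.markov
  obtain rfl := hW.kernel_unique hsup hmoment hκ hgen hκ' hgen'
  exact IsMarkovWith.map_eq hσ.measurable hσ'.measurable hmarkov hmarkov' hσ.start
    hσ'.start

variable [T2Space S]

theorem KalikowDecomposition.IsUpdateRule.isParticleSystem (hW : D.IsUpdateRule W)
    (hsup : BddAbove (Set.range D.M))
    (hmoment : (∑' r : ℕ, (r : ℝ≥0∞) ^ d * (⨆ x, D.ν x r)) ≠ ⊤)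
    (hgood : ∀ᵐ ω ∂D.harrisMeasure, Good ω) (η : Config d S) :
    IsParticleSystem c η D.harrisMeasure fun t ω => harrisPath W η ω t where
  measurable := hW.measurable_path_right η
  start := hgood.mono fun _ hω => (isHarrisPath_harrisPath hW.dependsOn hω).start
  cadlag := hgood.mono fun _ hω => (isHarrisPath_harrisPath hW.dependsOn hω).cadlag
  markov := ⟨hW.kernel, hW.isTransitionSemigroup hgood, hW.hasGenerator hgood hsup hmoment,
    fun s t _ hA => hW.markov hgood η s t hA⟩

end Main

end ParticleSystem

theorem theorem4 {d : ℕ} {S : Type*} [Countable S] [TopologicalSpace S] [DiscreteTopology S]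
    [MeasurableSpace S] [BorelSpace S]
    {c : ParticleSystem.Site d → S → ParticleSystem.Config d S → ℝ}
    (D : ParticleSystem.KalikowDecomposition c)
    (hinf : 0 < ⨅ x, D.M x) (hsup : BddAbove (Set.range D.M))
    (hmoment : (∑' r : ℕ, (r : ℝ≥0∞) ^ d * (⨆ x, D.ν x r)) ≠ ⊤) :
    -- update rules exist
    (∃ W, D.IsUpdateRule W) ∧
    -- the finite islands, between which there is no interaction
    (∃ t₀ : ℝ≥0, 0 < t₀ ∧ ∀ W, D.IsUpdateRule W → ∀ᵐ ω ∂D.harrisMeasure, ∀ k : ℕ,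
      ∀ C : (ParticleSystem.harrisGraph ω (k * t₀) ((k + 1) * t₀)).ConnectedComponent,
        C.supp.Finite ∧
        ∀ η η' π π', ParticleSystem.IsHarrisPath W ω η π → ParticleSystem.IsHarrisPath W ω η' π' →
          (∀ x ∈ C.supp, π (k * t₀) x = π' (k * t₀) x) →
          ∀ t ∈ Set.Icc (k * t₀) ((k + 1) * t₀), ∀ x ∈ C.supp, π t x = π' t x) ∧
    -- existence, almost sure uniqueness and uniqueness in law of the particle system
    ∀ W, D.IsUpdateRule W → ∀ η : ParticleSystem.Config d S,
      ∃ σ : ℝ≥0 → ParticleSystem.Marks d → ParticleSystem.Config d S,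
        ParticleSystem.IsParticleSystem c η D.harrisMeasure σ ∧
        (∀ᵐ ω ∂D.harrisMeasure, ∀ π,
          ParticleSystem.IsHarrisPath W ω η π ↔ π = fun t => σ t ω) ∧
        ∀ (Ω : Type*) [MeasurableSpace Ω] (P : Measure Ω) [IsProbabilityMeasure P]
          (σ' : ℝ≥0 → Ω → ParticleSystem.Config d S),
          ParticleSystem.IsParticleSystem c η P σ' →
          P.map (fun ω t => σ' t ω) = D.harrisMeasure.map (fun ω t => σ t ω) := by
  classical
  have : DiscreteMeasurableSpace S := inferInstance
  obtain ⟨t₀, ht₀, hislands⟩ := D.exists_finiteIslands hsup hmoment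
  have hboth : ∀ᵐ ω ∂D.harrisMeasure, ParticleSystem.Good ω ∧ ParticleSystem.FiniteIslands t₀ ω := by
    filter_upwards [D.ae_regular, hislands] with ω hω hI using ⟨hω.good ht₀ hI, hI⟩
  have hgood := hboth.mono fun _ h => h.1
  refine ⟨D.exists_isUpdateRule, ⟨t₀, ht₀, fun W hW => ?_⟩, fun W hW η =>
    ⟨fun t ω => ParticleSystem.harrisPath W η ω t,
      hW.isParticleSystem hsup hmoment hgood η, ?_, ?_⟩⟩
  · filter_upwards [hboth] with ω hω k C
    refine ⟨hω.2 k C, fun η η' π π' hπ hπ' hC t ht x hx => ?_⟩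
    -- An update in the slab at a site of the island reads only neighbours in the Harris graph and
    -- the site itself, hence sites of the island.
    exact hω.1.eq_of_eq_on hW.dependsOn hπ hπ'
      (fun y hy n hn z hz => ParticleSystem.mem_supp_of_mem_ball hy hn hz) hC ht hx
  · filter_upwards [hgood] with ω hω π
    refine ⟨fun hπ => hω.eq_harrisPath hW.dependsOn hπ, fun hπ => ?_⟩
    rw [hπ]
    exact ParticleSystem.isHarrisPath_harrisPath hW.dependsOn hω
  · intro Ω _ P _ σ' hσ'
    exact hW.map_eq_of_isParticleSystem hsup hmoment hσ'
      (hW.isParticleSystem hsup hmoment hgood η)
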